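/- **Setting.** Let $T>0$, $\alpha>1/3$, and let $(\zeta,\zeta^2)$ be an $\alpha$-Hölder geometric rough path on $[0,T]$ over $\mathbb R^d$: $\zeta\in C^\alpha([0,T];\mathbb R^d)$, $\zeta_0=0$, $|\zeta^2_{st}|\lesssim|t-s|^{2\alpha}$, $\zeta^{2;ij}_{st}-\zeta^{2;ij}_{su}-\zeta^{2;ij}_{ut}=\delta\zeta^i_{su}\,\delta\zeta^j_{ut}$ and $\zeta^{2;ij}_{st}+\zeta^{2;ji}_{st}=\delta\zeta^i_{st}\,\delta\zeta^j_{st}$, where $\delta\zeta_{st}=\zeta_t-\zeta_s$. Let $U\subset\mathbb R^k$, let $\mathcal P(U)$ be the set of Borel probability measures on $U$ with the topology of weak convergence, and let $\mathcal K\subset\mathcal P(U)$ be compact (if $U$ is compact, $\mathcal K=\mathcal P(U)$ is allowed). Let $b\in C_b^{0,1,1}([0,T]\times\mathbb R^m\times U;\mathbb R^m)$ be uniformly continuous in time (uniformly in space and control) and Lipschitz in space, uniformly in time and control; let $\sigma=(\sigma_1,\dots,\sigma_d)\in C_b^{1,3}([0,T]\times\mathbb R^m;\mathbb R^{m\times d})$,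 $F\in C_b^{0,1,0}([0,T]\times\mathbb R^m\times\mathcal K;\mathbb R)$ and $G\in C_b^1(\mathbb R^m;\mathbb R)$. Here $D$ denotes the derivative (the gradient, for $F$ and $G$) in $x\in\mathbb R^m$. A *relaxed control* is a measurable path $\gamma:[0,T]\to\mathcal K$. For $y\in\mathbb R^m$, its state $x^\gamma$ is the solution, in the sense of paths controlled by $\zeta$, of $$x_t=y+\int_0^t\int_U b(r,x_r,a)\,\gamma_r(da)\,dr+\int_0^t\sigma(r,x_r)\,d\zeta_r,\qquad t\in[0,T],$$ and its reward is $J(\gamma)=\int_0^T F(r,x^\gamma_r,\gamma_r)\,dr+G(x^\gamma_T)$. A pair $(\bar x,\bar\gamma)$ is *optimal* if $\bar\gamma$ is a relaxed control, $\bar x=x^{\bar\gamma}$, and $J(\gamma)\le J(\bar\gamma)$ for every relaxed control $\gamma$. **Theorem (Pontryagin maximum principle).** Let $(\bar x,\bar\gamma)$ be an optimal pair such that, for some $\varepsilon,L>0$, $W_2(\bar\gamma_s,\bar\gamma_t)\le L|t-s|^\varepsilon$ for all $s,t\in[0,T]$, where $W_2$ is the 2-Wasserstein distance. Let $p:[0,T]\to\mathbb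 R^m$ be the solution, as a path controlled by $\zeta$, of the backward adjoint equation $$-dp_t=\Big(\int_U Db(t,\bar x_t,a)\,\bar\gamma_t(da)\Big)^{T}p_t\,dt+\sum_{j=1}^d D\sigma_j(t,\bar x_t)^{T}p_t\,d\zeta^j_t+DF(t,\bar x_t,\bar\gamma_t)\,dt,\qquad p_T=DG(\bar x_T).$$ Then for every $t\in[0,T]$, $$\Big\langle\int_U b(t,\bar x_t,a)\,\bar\gamma_t(da),p_t\Big\rangle+F(t,\bar x_t,\bar\gamma_t)=\max_{\gamma\in\mathcal K}\Big\{\Big\langle\int_U b(t,\bar x_t,a)\,\gamma(da),p_t\Big\rangle+F(t,\bar x_t,\gamma)\Big\}.$$ In particular the maximum is over $\mathcal P(U)$ when $\mathcal K=\mathcal P(U)$. -/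

import Mathlib

open Set MeasureTheory
open scoped ENNReal

namespace RoughControl

/-- Euclidean space `ℝⁿ`. -/
abbrev Vec (n : ℕ) := EuclideanSpace ℝ (Fin n)

/-! ### Rough paths and controlled paths on `[0, T]` -/

/-- `ζ` is an `α`-Hölder path on `[0, T]` started at `0`, and the two-index map `A` (the Lévy area,
`A s t i j` standing for `∫_s^t (ζ^i_r - ζ^i_s) dζ^j_r`) is `2α`-Hölder, satisfies Chen's relation,
and is geometric. -/
structure IsGeometricRoughPath {d : ℕ} (α T : ℝ) (ζ : ℝ → Vec d)
    (A : ℝ → ℝ → Fin d → Fin d → ℝ) : Prop where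
  zero : ζ 0 = 0
  holder : ∃ C : ℝ, ∀ s t, 0 ≤ s → s ≤ t → t ≤ T → ‖ζ t - ζ s‖ ≤ C * (t - s) ^ α
  area_holder : ∃ C : ℝ, ∀ s t, 0 ≤ s → s ≤ t → t ≤ T → ∀ i j,
    |A s t i j| ≤ C * (t - s) ^ (2 * α)
  chen : ∀ s u t, 0 ≤ s → s ≤ u → u ≤ t → t ≤ T → ∀ i j,
    A s t i j - A s u i j - A u t i j = (ζ u i - ζ s i) * (ζ t j - ζ u j)
  geometric : ∀ s t, 0 ≤ s → s ≤ t → t ≤ T → ∀ i j,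
    A s t i j + A s t j i = (ζ t i - ζ s i) * (ζ t j - ζ s j)

/-- `z` is weakly controlled by `ζ` on `[0, T]` with Hölder exponent `κ` and Gubinelli derivative
`z'`, where `z' t j` is the derivative in the direction of the `j`-th component of `ζ`. -/
structure IsWeaklyControlled {d n : ℕ} (κ T : ℝ) (ζ : ℝ → Vec d) (z : ℝ → Vec n)
    (z' : ℝ → Fin d → Vec n) : Prop where
  holder : ∃ C : ℝ, ∀ s t, 0 ≤ s → s ≤ t → t ≤ T → ‖z t - z s‖ ≤ C * (t - s) ^ κ
  deriv_holder : ∃ C : ℝ, ∀ s t, 0 ≤ s → s ≤ t → t ≤ T → ∀ j,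
    ‖z' t j - z' s j‖ ≤ C * (t - s) ^ κ
  remainder : ∃ C : ℝ, ∀ s t, 0 ≤ s → s ≤ t → t ≤ T →
    ‖z t - z s - ∑ j, (ζ t j - ζ s j) • z' s j‖ ≤ C * (t - s) ^ (2 * κ)

/-- The two-index map `I` is the increment `I s t = ∫_s^t ∑ⱼ μʲ_r dζʲ_r` of the rough integral of
the controlled integrand `μ`, whose Gubinelli derivative is `μ'` (`μ' r j i` is the derivative of
`μ r j` in the direction of the `i`-th component of `ζ`): it is the additive map (unique by the
sewing lemma) that agrees with the compensated Riemann sum on `[s, t]` up to a remainder of Hölder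
order larger than one. -/
def IsRoughIntegral {d n : ℕ} (T : ℝ) (ζ : ℝ → Vec d) (A : ℝ → ℝ → Fin d → Fin d → ℝ)
    (μ : ℝ → Fin d → Vec n) (μ' : ℝ → Fin d → Fin d → Vec n) (I : ℝ → ℝ → Vec n) : Prop :=
  (∀ s u t, 0 ≤ s → s ≤ u → u ≤ t → t ≤ T → I s t = I s u + I u t) ∧
  ∃ θ C : ℝ, 1 < θ ∧ ∀ s t, 0 ≤ s → s ≤ t → t ≤ T →
    ‖I s t - ((∑ j, (ζ t j - ζ s j) • μ s j) + ∑ j, ∑ i, A s t i j • μ' s j i)‖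
      ≤ C * (t - s) ^ θ

/-- The path `z` satisfies `dz = η dt + ∑ⱼ μʲ dζʲ` on `[0, T]` as a controlled path: the first
integral is a Lebesgue integral, the second one the rough integral of the integrand `μ` with
Gubinelli derivative `μ'`. -/
structure SolvesRough {d n : ℕ} (α T : ℝ) (ζ : ℝ → Vec d) (A : ℝ → ℝ → Fin d → Fin d → ℝ)
    (η : ℝ → Vec n) (μ : ℝ → Fin d → Vec n) (μ' : ℝ → Fin d → Fin d → Vec n)
    (z : ℝ → Vec n) : Prop where
  controlled : ∃ κ : ℝ, 1 / 3 < κ ∧ κ < α ∧ IsWeaklyControlled κ T ζ z μ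
  drift_integrable : IntervalIntegrable η volume 0 T
  equation : ∃ I : ℝ → ℝ → Vec n, IsRoughIntegral T ζ A μ μ' I ∧
    ∀ s t, 0 ≤ s → s ≤ t → t ≤ T → z t - z s = (∫ r in s..t, η r) + I s t

/-! ### Regularity of the coefficients -/

/-- `b ∈ C_b^{0,1,1}([0,T] × ℝᵐ × U; ℝᵐ)`, uniformly continuous in time (uniformly in space and
control) and Lipschitz in space, uniformly in time and control. -/
structure IsDriftCoeff {m k : ℕ} (T : ℝ) (U : Set (Vec k)) (b : ℝ → Vec m → Vec k → Vec m) :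
    Prop where
  continuous : ContinuousOn (fun q : ℝ × Vec m × Vec k => b q.1 q.2.1 q.2.2)
    (Icc 0 T ×ˢ univ ×ˢ U)
  bounded : ∃ C : ℝ, ∀ t ∈ Icc 0 T, ∀ x, ∀ a ∈ U, ‖b t x a‖ ≤ C
  differentiable : ∀ t ∈ Icc 0 T, ∀ a ∈ U, Differentiable ℝ (fun x => b t x a)
  continuous_fderiv : ContinuousOn
    (fun q : ℝ × Vec m × Vec k => fderiv ℝ (fun x => b q.1 x q.2.2) q.2.1)
    (Icc 0 T ×ˢ univ ×ˢ U)
  bounded_fderiv : ∃ C : ℝ, ∀ t ∈ Icc 0 T, ∀ x, ∀ a ∈ U, ‖fderiv ℝ (fun z => b t z a) x‖ ≤ C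
  control_deriv : ∃ D : ℝ → Vec m → Vec k → (Vec k →L[ℝ] Vec m),
    ContinuousOn (fun q : ℝ × Vec m × Vec k => D q.1 q.2.1 q.2.2) (Icc 0 T ×ˢ univ ×ˢ U) ∧
    (∃ C : ℝ, ∀ t ∈ Icc 0 T, ∀ x, ∀ a ∈ U, ‖D t x a‖ ≤ C) ∧
    ∀ t ∈ Icc 0 T, ∀ x, ∀ a ∈ U, HasFDerivWithinAt (fun a' => b t x a') (D t x a) U a
  uniform_in_time : ∀ ε > 0, ∃ δ > 0, ∀ s ∈ Icc 0 T, ∀ t ∈ Icc 0 T, |t - s| < δ →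
    ∀ x, ∀ a ∈ U, ‖b t x a - b s x a‖ < ε
  lipschitz : ∃ C : ℝ, ∀ t ∈ Icc 0 T, ∀ a ∈ U, ∀ x x', ‖b t x a - b t x' a‖ ≤ C * ‖x - x'‖

/-- `σ ∈ C_b^{1,3}([0,T] × ℝᵐ; ℝ^{m,d})`, given by its columns `σ j`: the functions `σ`, `∂ₜσ`,
`Dσ`, `D²σ`, `D³σ` (derivatives in space) are bounded and continuous. -/
structure IsNoiseCoeff {m d : ℕ} (T : ℝ) (σ : Fin d → ℝ → Vec m → Vec m) : Prop where
  contDiff : ∀ j, ∀ t ∈ Icc 0 T, ContDiff ℝ 3 (σ j t)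
  continuous : ∀ j, ∀ l ≤ 3, ContinuousOn
    (fun q : ℝ × Vec m => iteratedFDeriv ℝ l (σ j q.1) q.2) (Icc 0 T ×ˢ univ)
  bounded : ∀ j, ∀ l ≤ 3, ∃ C : ℝ, ∀ t ∈ Icc 0 T, ∀ x, ‖iteratedFDeriv ℝ l (σ j t) x‖ ≤ C
  time_deriv : ∀ j, ∃ D : ℝ → Vec m → Vec m,
    ContinuousOn (fun q : ℝ × Vec m => D q.1 q.2) (Icc 0 T ×ˢ univ) ∧
    (∃ C : ℝ, ∀ t ∈ Icc 0 T, ∀ x, ‖D t x‖ ≤ C) ∧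
    ∀ t ∈ Icc 0 T, ∀ x, HasDerivWithinAt (fun s => σ j s x) (D t x) (Icc 0 T) t

/-- `F ∈ C_b^{0,1,0}([0,T] × ℝᵐ × K; ℝ)`, where `K` carries the topology of weak convergence. -/
structure IsRunningReward {m k : ℕ} {U : Set (Vec k)} (T : ℝ) (K : Set (ProbabilityMeasure U))
    (F : ℝ → Vec m → ProbabilityMeasure U → ℝ) : Prop where
  continuous : ContinuousOn (fun q : ℝ × Vec m × ProbabilityMeasure U => F q.1 q.2.1 q.2.2)
    (Icc 0 T ×ˢ univ ×ˢ K)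
  bounded : ∃ C : ℝ, ∀ t ∈ Icc 0 T, ∀ x, ∀ ν ∈ K, |F t x ν| ≤ C
  differentiable : ∀ t ∈ Icc 0 T, ∀ ν ∈ K, Differentiable ℝ (fun x => F t x ν)
  continuous_gradient : ContinuousOn
    (fun q : ℝ × Vec m × ProbabilityMeasure U => gradient (fun x => F q.1 x q.2.2) q.2.1)
    (Icc 0 T ×ˢ univ ×ˢ K)
  bounded_gradient : ∃ C : ℝ, ∀ t ∈ Icc 0 T, ∀ x, ∀ ν ∈ K,
    ‖gradient (fun z => F t z ν) x‖ ≤ C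

/-- `G ∈ C_b^1(ℝᵐ; ℝ)`. -/
structure IsTerminalReward {m : ℕ} (G : Vec m → ℝ) : Prop where
  contDiff : ContDiff ℝ 1 G
  bounded : ∃ C : ℝ, ∀ x, |G x| ≤ C
  bounded_gradient : ∃ C : ℝ, ∀ x, ‖gradient G x‖ ≤ C

/-! ### Relaxed controls -/

/-- The 2-Wasserstein distance: infimum over all couplings of the `L²` transport cost. -/
noncomputable def wasserstein2 {k : ℕ} {U : Set (Vec k)} (ν₁ ν₂ : ProbabilityMeasure U) : ℝ≥0∞ :=
  ⨅ π ∈ {π : Measure (U × U) | π.map Prod.fst = ν₁ ∧ π.map Prod.snd = ν₂},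
    (∫⁻ q, edist q.1 q.2 ^ 2 ∂π) ^ (1 / 2 : ℝ)

/-- Admissible relaxed controls: measurable paths `[0, T] → K`. -/
structure IsRelaxedControl {k : ℕ} {U : Set (Vec k)} (T : ℝ) (K : Set (ProbabilityMeasure U))
    (γ : ℝ → ProbabilityMeasure U) : Prop where
  mem : ∀ t ∈ Icc 0 T, γ t ∈ K
  measurable : Measurable (fun t : Icc (0 : ℝ) T => (γ t : Measure U))

/-- The set `𝒱^{ε,L}` of `K`-valued paths on `[0, T]` with
`W₂(γ_s, γ_t) ≤ L |t - s|^ε`. -/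
def HolderControls {k : ℕ} {U : Set (Vec k)} (T ε L : ℝ) (K : Set (ProbabilityMeasure U)) :
    Set (ℝ → ProbabilityMeasure U) :=
  {γ | (∀ t ∈ Icc 0 T, γ t ∈ K) ∧ ∀ s ∈ Icc 0 T, ∀ t ∈ Icc 0 T,
    wasserstein2 (γ s) (γ t) ≤ ENNReal.ofReal (L * |t - s| ^ ε)}

/-- `x_t = y + ∫_0^t ∫_U b(r, x_r, a) γ_r(da) dr + ∫_0^t σ(r, x_r) dζ_r` on `[0, T]`. -/
def SolvesState {m d k : ℕ} {U : Set (Vec k)} (α T : ℝ) (ζ : ℝ → Vec d)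
    (A : ℝ → ℝ → Fin d → Fin d → ℝ) (b : ℝ → Vec m → Vec k → Vec m)
    (σ : Fin d → ℝ → Vec m → Vec m) (y : Vec m) (γ : ℝ → ProbabilityMeasure U)
    (x : ℝ → Vec m) : Prop :=
  x 0 = y ∧ SolvesRough α T ζ A
    (fun t => ∫ a : U, b t (x t) a ∂(γ t : Measure U))
    (fun t j => σ j t (x t))
    (fun t j i => fderiv ℝ (σ j t) (x t) (σ i t (x t))) x

/-- The reward `J = ∫_0^T F(r, x_r, γ_r) dr + G(x_T)`. -/
noncomputable def reward {m k : ℕ} {U : Set (Vec k)} (T : ℝ)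
    (F : ℝ → Vec m → ProbabilityMeasure U → ℝ) (G : Vec m → ℝ)
    (γ : ℝ → ProbabilityMeasure U) (x : ℝ → Vec m) : ℝ :=
  (∫ r in (0 : ℝ)..T, F r (x r) (γ r)) + G (x T)

/-- `(x, γ)` is an optimal pair: `γ` is a relaxed control, `x` is the corresponding state, and no
relaxed control has a larger reward. -/
def IsOptimalPair {m d k : ℕ} {U : Set (Vec k)} (α T : ℝ) (ζ : ℝ → Vec d)
    (A : ℝ → ℝ → Fin d → Fin d → ℝ) (b : ℝ → Vec m → Vec k → Vec m)
    (σ : Fin d → ℝ → Vec m → Vec m) (F : ℝ → Vec m → ProbabilityMeasure U → ℝ) (G : Vec m → ℝ)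
    (K : Set (ProbabilityMeasure U)) (y : Vec m)
    (x : ℝ → Vec m) (γ : ℝ → ProbabilityMeasure U) : Prop :=
  IsRelaxedControl T K γ ∧ SolvesState α T ζ A b σ y γ x ∧
  ∀ γ' x', IsRelaxedControl T K γ' → SolvesState α T ζ A b σ y γ' x' →
    reward T F G γ' x' ≤ reward T F G γ x

/-! ### Adjoint equation and Hamiltonian -/

open ContinuousLinearMap in
/-- The backward adjoint equation
`-dp_t = (∫_U Db(t, x_t, a) γ_t(da))ᵀ p_t dt + ∑ⱼ Dσⱼ(t, x_t)ᵀ p_t dζʲ_t + DF(t, x_t, γ_t) dt`,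
`p_T = DG(x_T)`. As `-p` has Gubinelli derivative `Dσᵢ(t, x_t)ᵀ p_t` and `x` has Gubinelli
derivative `σᵢ(t, x_t)` in direction `i`, the Gubinelli derivative of `Dσⱼ(t, x_t)ᵀ p_t` is
`(D²σⱼ(t, x_t) σᵢ(t, x_t))ᵀ p_t - Dσⱼ(t, x_t)ᵀ Dσᵢ(t, x_t)ᵀ p_t`. -/
def SolvesAdjoint {m d k : ℕ} {U : Set (Vec k)} (α T : ℝ) (ζ : ℝ → Vec d)
    (A : ℝ → ℝ → Fin d → Fin d → ℝ) (b : ℝ → Vec m → Vec k → Vec m)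
    (σ : Fin d → ℝ → Vec m → Vec m) (F : ℝ → Vec m → ProbabilityMeasure U → ℝ) (G : Vec m → ℝ)
    (x : ℝ → Vec m) (γ : ℝ → ProbabilityMeasure U) (p : ℝ → Vec m) : Prop :=
  p T = gradient G (x T) ∧ SolvesRough α T ζ A
    (fun t => adjoint (∫ a : U, fderiv ℝ (fun z => b t z a) (x t) ∂(γ t : Measure U)) (p t)
      + gradient (fun z => F t z (γ t)) (x t))
    (fun t j => adjoint (fderiv ℝ (σ j t) (x t)) (p t))
    (fun t j i => adjoint (fderiv ℝ (fderiv ℝ (σ j t)) (x t) (σ i t (x t))) (p t)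
      - adjoint (fderiv ℝ (σ j t) (x t)) (adjoint (fderiv ℝ (σ i t) (x t)) (p t)))
    (fun t => - p t)

/-- The Hamiltonian `H(t, x, ν, p) = ⟨∫_U b(t, x, a) ν(da), p⟩ + F(t, x, ν)`. -/
noncomputable def hamiltonian {m k : ℕ} {U : Set (Vec k)} (b : ℝ → Vec m → Vec k → Vec m)
    (F : ℝ → Vec m → ProbabilityMeasure U → ℝ) (t : ℝ) (x : Vec m) (ν : ProbabilityMeasure U)
    (p : Vec m) : ℝ :=
  inner ℝ (∫ a : U, b t x a ∂(ν : Measure U)) p + F t x ν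

end RoughControl

/-! The proof is by needle variation. Use `ν ∈ K` on `(t, t + h]` and the optimal control elsewhere.
The state becomes `x + δ`, where `δ` solves a rough equation whose noise coefficients are the
increments of `σ` over `x`, hence vanish at `δ = 0`. Optimality makes the change of reward
nonpositive; dividing by `h` and letting `h → 0` gives the inequality between Hamiltonians.

Size of `δ`. A solution exists with bounds linear in its value at any earlier time `u` plus the
supremum since `u` of the drift at zero (`RoughField.exists_linearGrowthSolution`). That drift
vanishes off the needle, so `δ` is zero up to `t`. On the needle the noise starts from a zero
coefficient and leaves an error of order `h ^ (κ + 2/3)` only; as `κ > 1/3`, `δ` at time `t + h` is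
`h` times the jump of the mean drift at `t`, up to `o(h)`, and `δ` is `O(h)` throughout
(`LinearGrowthSolution.norm_le_mul`). The solution comes from Davie's scheme, discrete sewing
(`discrete_sewing`, `RoughField.scheme_estimate`) and a compactness argument. Existence suffices:
optimality compares with every solution, so uniqueness is never needed.

Duality. Geometricity of the rough path makes the rough parts cancel in the increment of `⟨p, δ⟩`
(`inner_increment_eq`). No linearised state equation is solved: over a step of length `τ` the error
is `N τ ^ θ'` with `θ' > 1`, plus a quadratic term `N ^ 2 τ ^ κ`, where `N` bounds `δ`. Summing over
`n` equal steps, with `n` large first and `N` small afterwards, the total is `o(N)`, that is `o(h)`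
(`AdjointPath.inner_integral_le`).

Reward. The drift of the adjoint equation is the gradient of the Hamiltonian in space, so after the
needle the running reward and the duality pairing combine into a first-order Taylor remainder, which
is `o(h)` by dominated convergence. What survives is the difference of the Hamiltonians at `t`. The
Wasserstein condition enters only through weak continuity of the control: it gives the limit at
every `t < T`, and the case `t = T` by continuity. -/

namespace RoughControl

/-! ### Discrete sewing -/

/-- Discrete sewing: a nearly additive two-index family vanishing on consecutive points of a
partition is of order `θ > 1`. -/
theorem discrete_sewing {g : ℕ → ℝ} (hg : Monotone g) {ρ : ℕ → ℕ → ℝ} {B M N θ κ : ℝ} {n₀ n₁ : ℕ}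
    (hM : 0 ≤ M) (hN : 0 ≤ N) (hθ : 1 < θ) (hB : 0 ≤ B) (hκ : 0 ≤ κ)
    (h0 : ∀ i, ρ i i = 0) (h1 : ∀ i, ρ i (i + 1) = 0)
    (hadd : ∀ i k j, n₀ ≤ i → i ≤ k → k ≤ j → j ≤ n₁ →
      ρ i j ≤ ρ i k + ρ k j + B * (M * (g j - g i) ^ θ + ρ i k * (g j - g i) ^ κ))
    (hsmall : N * ((2 + B * (g n₁ - g n₀) ^ κ) * (1 / 2) ^ θ) + 2 * B ≤ N) :
    ∀ n i j, j - i ≤ n → n₀ ≤ i → i ≤ j → j ≤ n₁ → ρ i j ≤ N * M * (g j - g i) ^ θ := by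
  intro n
  induction n with
  | zero =>
    intro i j hn hi hij hj
    obtain rfl : i = j := by omega
    rw [h0]
    have := Real.rpow_nonneg (le_of_eq (sub_self (g i)).symm) θ
    positivity
  | succ n ih =>
    intro i j hn hi hij hj
    rcases hij.eq_or_lt with rfl | hlt
    · rw [h0]
      have := Real.rpow_nonneg (le_of_eq (sub_self (g i)).symm) θ
      positivity
    set τ := g j - g i with hτ
    have hτ0 : 0 ≤ τ := sub_nonneg.2 (hg hij)
    -- Take `k` to be the last index, short of `j`, at which `g` has not passed the midpoint. Both
    -- `[i, k]` and `[k + 1, j]` then have length at most `τ / 2`, and the single step from `k` to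
    -- `k + 1`, possibly long, costs nothing because `ρ` vanishes there.
    obtain ⟨k, hik, hkj, hk1, hk2⟩ : ∃ k, i ≤ k ∧ k + 1 ≤ j ∧ g k - g i ≤ τ / 2 ∧
        g j - g (k + 1) ≤ τ / 2 := by
      classical
      let P : ℕ → Prop := fun k => g (k + i) ≤ g i + τ / 2
      have hP0 : P 0 := by simp only [P, zero_add]; linarith
      set k := Nat.findGreatest P (j - 1 - i) with hk
      have hkle : k ≤ j - 1 - i := Nat.findGreatest_le _
      have hPk : P k := Nat.findGreatest_spec (P := P) (Nat.zero_le _) hP0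
      refine ⟨k + i, by omega, by omega, by simp only [P] at hPk; linarith, ?_⟩
      rcases hkle.eq_or_lt with heq | hlt'
      · have : k + i + 1 = j := by omega
        rw [this]; linarith
      · have := Nat.findGreatest_is_greatest (P := P) (k := k + 1) (n := j - 1 - i)
          (by omega) (by omega)
        simp only [P, not_le] at this
        have h2 : k + 1 + i = k + i + 1 := by omega
        rw [h2] at this
        linarith
    have e1 := hadd i k j hi hik (by omega) hj
    have e2 := hadd k (k + 1) j (by omega) (by omega) hkj hj
    have r1 := ih i k (by omega) hi hik (by omega)
    have r2 := ih (k + 1) j (by omega) (by omega) hkj hj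
    rw [h1, zero_mul, add_zero, zero_add] at e2
    have hhalf : (τ / 2) ^ θ = τ ^ θ * (1 / 2) ^ θ := by
      rw [div_eq_mul_one_div, Real.mul_rpow hτ0 (by norm_num)]
    have b1 : (g k - g i) ^ θ ≤ τ ^ θ * (1 / 2) ^ θ := by
      rw [← hhalf]; exact Real.rpow_le_rpow (sub_nonneg.2 (hg hik)) hk1 (by linarith)
    have b2 : (g j - g (k + 1)) ^ θ ≤ τ ^ θ * (1 / 2) ^ θ := by
      rw [← hhalf]; exact Real.rpow_le_rpow (sub_nonneg.2 (hg hkj)) hk2 (by linarith)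
    have b3 : (g j - g k) ^ θ ≤ τ ^ θ :=
      Real.rpow_le_rpow (sub_nonneg.2 (hg (by omega))) (by linarith [hg hik]) (by linarith)
    have b4 : τ ^ κ ≤ (g n₁ - g n₀) ^ κ :=
      Real.rpow_le_rpow hτ0 (by linarith [hg hi, hg hj]) hκ
    have hp : 0 ≤ τ ^ θ := Real.rpow_nonneg hτ0 _
    have hq : (0 : ℝ) ≤ (1 / 2) ^ θ := Real.rpow_nonneg (by norm_num) _
    have hw : 0 ≤ τ ^ κ := Real.rpow_nonneg hτ0 _
    have hNM : 0 ≤ N * M := mul_nonneg hN hM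
    have r1' : ρ i k ≤ N * M * (τ ^ θ * (1 / 2) ^ θ) := r1.trans (by gcongr)
    have r2' : ρ (k + 1) j ≤ N * M * (τ ^ θ * (1 / 2) ^ θ) := r2.trans (by gcongr)
    have r3 : ρ i k * τ ^ κ ≤ N * M * (τ ^ θ * (1 / 2) ^ θ) * (g n₁ - g n₀) ^ κ :=
      (mul_le_mul_of_nonneg_right r1' hw).trans (by gcongr)
    calc ρ i j ≤ N * M * (τ ^ θ * (1 / 2) ^ θ)
          + (N * M * (τ ^ θ * (1 / 2) ^ θ) + B * (M * τ ^ θ))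
          + B * (M * τ ^ θ + N * M * (τ ^ θ * (1 / 2) ^ θ) * (g n₁ - g n₀) ^ κ) := by
          refine e1.trans ?_
          have : B * (M * (g j - g k) ^ θ) ≤ B * (M * τ ^ θ) := by gcongr
          gcongr
          linarith
      -- The bracket is the left side of `hsmall`: two halves contribute `2 * (1 / 2) ^ θ < 1`, and
      -- the feedback of `ρ i k` into the defect contributes the term with `κ`.
      _ = (N * ((2 + B * (g n₁ - g n₀) ^ κ) * (1 / 2) ^ θ) + 2 * B) * (M * τ ^ θ) := by ring
      _ ≤ N * (M * τ ^ θ) := by gcongr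
      _ = N * M * τ ^ θ := by ring

end RoughControl

/-! ### Rough vector fields and the defect of the local expansion -/

namespace RoughControl

variable {E : Type*} [NormedAddCommGroup E] [NormedSpace ℝ E]

/-- Families `φ j s`, `ψ j i s` of Lipschitz maps vanishing at `0`, which are controlled by the
rough path `(ζ, A)` along every path that is controlled with derivative `φ`. -/
structure RoughField {d : ℕ} (T κ C : ℝ) (ζ : ℝ → Vec d) (A : ℝ → ℝ → Fin d → Fin d → ℝ)
    (φ : Fin d → ℝ → E → E) (ψ : Fin d → Fin d → ℝ → E → E) : Prop where
  nonneg : 0 ≤ C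
  path_le : ∀ s t, 0 ≤ s → s ≤ t → t ≤ T → ∀ j, |ζ t j - ζ s j| ≤ C * (t - s) ^ κ
  area_le : ∀ s t, 0 ≤ s → s ≤ t → t ≤ T → ∀ i j, |A s t i j| ≤ C * (t - s) ^ (2 * κ)
  chen : ∀ s u t, 0 ≤ s → s ≤ u → u ≤ t → t ≤ T → ∀ i j,
    A s t i j - A s u i j - A u t i j = (ζ u i - ζ s i) * (ζ t j - ζ u j)
  zero : ∀ s ∈ Icc 0 T, ∀ j, φ j s 0 = 0
  zero' : ∀ s ∈ Icc 0 T, ∀ j i, ψ j i s 0 = 0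
  lip : ∀ s ∈ Icc 0 T, ∀ j e e', ‖φ j s e - φ j s e'‖ ≤ C * ‖e - e'‖
  lip' : ∀ s ∈ Icc 0 T, ∀ j i e e', ‖ψ j i s e - ψ j i s e'‖ ≤ C * ‖e - e'‖
  -- Every bound is linear in `‖e‖` and in the first-order remainder of the step from `e` to `e'`,
  -- so that smallness of a solution propagates. The orders `2/3` and `1/3` suffice because `κ >
  -- 1/3` makes `κ + 2/3` and `2 * κ + 1/3` exceed one.
  step : ∀ s u, 0 ≤ s → s ≤ u → u ≤ T → ∀ j e e',
    ‖φ j u e' - φ j s e - ∑ i, (ζ u i - ζ s i) • ψ j i s e‖ ≤ C * (‖e‖ * (u - s) ^ (2 / 3 : ℝ)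
      + ‖e' - e - ∑ i, (ζ u i - ζ s i) • φ i s e‖)
  step' : ∀ s u, 0 ≤ s → s ≤ u → u ≤ T → ∀ j i e e',
    ‖ψ j i u e' - ψ j i s e‖ ≤ C * (‖e‖ * (u - s) ^ (1 / 3 : ℝ) + ‖e' - e‖)

/-- The compensated increment of the rough integral of `(φ, ψ)` at `e`. -/
noncomputable def noise {d : ℕ} (ζ : ℝ → Vec d) (A : ℝ → ℝ → Fin d → Fin d → ℝ)
    (φ : Fin d → ℝ → E → E) (ψ : Fin d → Fin d → ℝ → E → E) (s t : ℝ) (e : E) : E :=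
  (∑ j, (ζ t j - ζ s j) • φ j s e) + ∑ j, ∑ i, A s t i j • ψ j i s e

theorem norm_sum_smul_le {d : ℕ} {a v : ℝ} {c : Fin d → ℝ} {w : Fin d → E} (ha : 0 ≤ a)
    (hc : ∀ j, |c j| ≤ a) (hw : ∀ j, ‖w j‖ ≤ v) : ‖∑ j, c j • w j‖ ≤ d * (a * v) := by
  refine (norm_sum_le _ _).trans ?_
  have : ∀ j ∈ (Finset.univ : Finset (Fin d)), ‖c j • w j‖ ≤ a * v := fun j _ => by
    rw [norm_smul, Real.norm_eq_abs]
    exact mul_le_mul (hc j) (hw j) (norm_nonneg _) ha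
  simpa using Finset.sum_le_sum this

theorem norm_sum_sum_smul_le {d : ℕ} {a v : ℝ} {c : Fin d → Fin d → ℝ} {w : Fin d → Fin d → E}
    (ha : 0 ≤ a) (hc : ∀ j i, |c j i| ≤ a) (hw : ∀ j i, ‖w j i‖ ≤ v) :
    ‖∑ j, ∑ i, c j i • w j i‖ ≤ d * (d * (a * v)) := by
  refine (norm_sum_le _ _).trans ?_
  have : ∀ j ∈ (Finset.univ : Finset (Fin d)), ‖∑ i, c j i • w j i‖ ≤ d * (a * v) := fun j _ =>
    norm_sum_smul_le ha (hc j) (hw j)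
  simpa using Finset.sum_le_sum this

namespace RoughField

variable {d : ℕ} {T κ C : ℝ} {ζ : ℝ → Vec d} {A : ℝ → ℝ → Fin d → Fin d → ℝ}
  {φ : Fin d → ℝ → E → E} {ψ : Fin d → Fin d → ℝ → E → E}

theorem norm_le (h : RoughField T κ C ζ A φ ψ) {s : ℝ} (hs : s ∈ Icc 0 T) (j : Fin d) (e : E) :
    ‖φ j s e‖ ≤ C * ‖e‖ := by
  simpa [h.zero s hs] using h.lip s hs j e 0

theorem norm_le' (h : RoughField T κ C ζ A φ ψ) {s : ℝ} (hs : s ∈ Icc 0 T) (j i : Fin d) (e : E) :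
    ‖ψ j i s e‖ ≤ C * ‖e‖ := by
  simpa [h.zero' s hs] using h.lip' s hs j i e 0

theorem norm_noise_le (h : RoughField T κ C ζ A φ ψ) {s t : ℝ} (hs : 0 ≤ s) (hst : s ≤ t)
    (ht : t ≤ T) (e : E) : ‖noise ζ A φ ψ s t e‖ ≤
      (d * C ^ 2 * (t - s) ^ κ + d ^ 2 * C ^ 2 * (t - s) ^ (2 * κ)) * ‖e‖ := by
  have hsT : s ∈ Icc 0 T := ⟨hs, hst.trans ht⟩
  have hC := h.nonneg
  have h0 : 0 ≤ t - s := sub_nonneg.2 hst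
  refine (norm_add_le _ _).trans ?_
  have e1 := norm_sum_smul_le (mul_nonneg hC (Real.rpow_nonneg h0 κ)) (h.path_le s t hs hst ht)
    (fun j => h.norm_le hsT j e)
  have e2 := norm_sum_sum_smul_le (mul_nonneg hC (Real.rpow_nonneg h0 (2 * κ)))
    (fun j i => h.area_le s t hs hst ht i j) (fun j i => h.norm_le' hsT j i e)
  refine (add_le_add e1 e2).trans (le_of_eq ?_)
  ring

theorem continuous_noise (h : RoughField T κ C ζ A φ ψ) {s : ℝ} (hs : s ∈ Icc 0 T) (t : ℝ) :
    Continuous (noise ζ A φ ψ s t) := by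
  have h1 : ∀ j, Continuous (φ j s) := fun j => (LipschitzWith.of_dist_le' (K := C)
    fun e e' => by simpa [dist_eq_norm] using h.lip s hs j e e').continuous
  have h2 : ∀ j i, Continuous (ψ j i s) := fun j i => (LipschitzWith.of_dist_le' (K := C)
    fun e e' => by simpa [dist_eq_norm] using h.lip' s hs j i e e').continuous
  unfold noise
  fun_prop

/-- Chen's relation reduces the defect to `ζ`-increments times the second-order variation of `φ`
plus area times the variation of `ψ`, both controlled by `step` and `step'`. The point `e'` is
arbitrary, so its own remainder stays in the bound, multiplied by `(t - s) ^ κ`; `discrete_sewing`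
is shaped to absorb exactly this term. The vector `f` stands for the drift contribution. -/
theorem noise_defect (h : RoughField T κ C ζ A φ ψ) (hκ : 1 / 3 < κ) {L : ℝ} (hL : 0 ≤ L) :
    ∃ B, 0 ≤ B ∧ ∀ s u t, 0 ≤ s → s ≤ u → u ≤ t → t ≤ T → t - s ≤ 1 → ∀ (e e' f : E) (M : ℝ),
      ‖e‖ ≤ M → ‖f‖ ≤ L * M * (u - s) →
      ‖noise ζ A φ ψ s u e + noise ζ A φ ψ u t e' - noise ζ A φ ψ s t e‖ ≤
        B * (M * (t - s) ^ (κ + 2 / 3) +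
          ‖e' - e - f - noise ζ A φ ψ s u e‖ * (t - s) ^ κ) := by
  have hC := h.nonneg
  set B₁ : ℝ := L + d ^ 2 * C ^ 2 with hB₁
  have hB₁0 : 0 ≤ B₁ := by positivity
  refine ⟨d * C ^ 2 * (1 + B₁) + d ^ 2 * C ^ 2 * (1 + B₁ + d * C ^ 2), by positivity, ?_⟩
  intro s u t hs hsu hut ht h1 e e' f M he hf
  have hM : 0 ≤ M := (norm_nonneg e).trans he
  have hsT : s ∈ Icc 0 T := ⟨hs, by linarith⟩
  set τ := t - s with hτ
  set ρ := ‖e' - e - f - noise ζ A φ ψ s u e‖ with hρ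
  have hρ0 : 0 ≤ ρ := norm_nonneg _
  have hτ0 : 0 ≤ τ := by simp only [hτ]; linarith
  have pw : ∀ {a b : ℝ}, 0 ≤ a → a ≤ b → τ ^ b ≤ τ ^ a := fun ha hab =>
    Real.rpow_le_rpow_of_exponent_ge' hτ0 h1 ha hab
  have pn : ∀ a : ℝ, 0 ≤ τ ^ a := fun a => Real.rpow_nonneg hτ0 a
  have pm : ∀ {a : ℝ}, 0 ≤ a → (u - s) ^ a ≤ τ ^ a := fun ha =>
    Real.rpow_le_rpow (by linarith) (by simp only [hτ]; linarith) ha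
  have pm' : ∀ {a : ℝ}, 0 ≤ a → (t - u) ^ a ≤ τ ^ a := fun ha =>
    Real.rpow_le_rpow (by linarith) (by simp only [hτ]; linarith) ha
  have hZ : ∀ j, |ζ u j - ζ s j| ≤ C * τ ^ κ := fun j =>
    (h.path_le s u hs hsu (by linarith) j).trans (mul_le_mul_of_nonneg_left (pm (by linarith)) hC)
  have hZ' : ∀ j, |ζ t j - ζ u j| ≤ C * τ ^ κ := fun j =>
    (h.path_le u t (by linarith) hut ht j).trans (mul_le_mul_of_nonneg_left (pm' (by linarith)) hC)
  have hA : ∀ i j, |A s u i j| ≤ C * τ ^ (2 * κ) := fun i j =>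
    (h.area_le s u hs hsu (by linarith) i j).trans (mul_le_mul_of_nonneg_left (pm (by linarith)) hC)
  have hA' : ∀ i j, |A u t i j| ≤ C * τ ^ (2 * κ) := fun i j =>
    (h.area_le u t (by linarith) hut ht i j).trans (mul_le_mul_of_nonneg_left (pm' (by linarith)) hC)
  -- The first-order remainder `y` differs from the full remainder of norm `ρ` by `f` and the area
  -- term; this is where `B₁` comes from.
  set y := e' - e - ∑ i, (ζ u i - ζ s i) • φ i s e with hy
  have hyn : ‖y‖ ≤ B₁ * M * τ ^ (2 / 3 : ℝ) + ρ := by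
    have e0 : y = f + (∑ j, ∑ i, A s u i j • ψ j i s e) +
        (e' - e - f - noise ζ A φ ψ s u e) := by
      simp only [hy, noise]; abel
    have e1 := norm_sum_sum_smul_le (mul_nonneg hC (pn (2 * κ))) (fun j i => hA i j)
      (fun j i => (h.norm_le' hsT j i e).trans (mul_le_mul_of_nonneg_left he hC))
    have e2 : ‖f‖ ≤ L * M * τ ^ (2 / 3 : ℝ) := hf.trans (by
      have := pw (a := 2 / 3) (b := 1) (by norm_num) (by norm_num)
      rw [Real.rpow_one] at this
      have h3 : u - s ≤ τ ^ (2 / 3 : ℝ) := by linarith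
      gcongr)
    have e3 : (d : ℝ) * (d * (C * τ ^ (2 * κ) * (C * M))) ≤
        d ^ 2 * C ^ 2 * M * τ ^ (2 / 3 : ℝ) := by
      have := pw (a := 2 / 3) (b := 2 * κ) (by norm_num) (by linarith)
      calc (d : ℝ) * (d * (C * τ ^ (2 * κ) * (C * M))) = d ^ 2 * C ^ 2 * M * τ ^ (2 * κ) := by ring
        _ ≤ _ := by gcongr
    calc ‖y‖ ≤ ‖f‖ + ‖∑ j, ∑ i, A s u i j • ψ j i s e‖ + ρ := by
          rw [e0]; exact norm_add₃_le
      _ ≤ L * M * τ ^ (2 / 3 : ℝ) + d ^ 2 * C ^ 2 * M * τ ^ (2 / 3 : ℝ) + ρ := by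
          gcongr; exact e1.trans e3
      _ = _ := by simp only [hB₁]; ring
  have hdiff : ‖e' - e‖ ≤ ‖y‖ + d * C ^ 2 * M * τ ^ (1 / 3 : ℝ) := by
    have e0 : e' - e = y + ∑ i, (ζ u i - ζ s i) • φ i s e := by simp only [hy]; abel
    have e1 := norm_sum_smul_le (mul_nonneg hC (pn κ)) hZ
      (fun j => (h.norm_le hsT j e).trans (mul_le_mul_of_nonneg_left he hC))
    have := pw (a := 1 / 3) (b := κ) (by norm_num) hκ.le
    calc ‖e' - e‖ ≤ ‖y‖ + d * (C * τ ^ κ * (C * M)) := by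
          rw [e0]; exact (norm_add_le _ _).trans (by gcongr)
      _ = ‖y‖ + d * C ^ 2 * M * τ ^ κ := by ring
      _ ≤ _ := by gcongr
  have hφ : ∀ j, ‖φ j u e' - φ j s e - ∑ i, (ζ u i - ζ s i) • ψ j i s e‖ ≤
      C * (M * τ ^ (2 / 3 : ℝ) + ‖y‖) := fun j =>
    (h.step s u hs hsu (by linarith) j e e').trans (by
      have := pm (a := 2 / 3) (by norm_num)
      have h2 : 0 ≤ (u - s) ^ (2 / 3 : ℝ) := Real.rpow_nonneg (by linarith) _
      gcongr)
  have hψ : ∀ j i, ‖ψ j i u e' - ψ j i s e‖ ≤ C * (M * τ ^ (1 / 3 : ℝ) + ‖e' - e‖) := fun j i =>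
    (h.step' s u hs hsu (by linarith) j i e e').trans (by
      have := pm (a := 1 / 3) (by norm_num)
      have h2 : 0 ≤ (u - s) ^ (1 / 3 : ℝ) := Real.rpow_nonneg (by linarith) _
      gcongr)
  -- The product in Chen's relation supplies the term with `ψ j i s e` that compensates the
  -- variation of `φ`.
  have key : noise ζ A φ ψ s u e + noise ζ A φ ψ u t e' - noise ζ A φ ψ s t e =
      (∑ j, (ζ t j - ζ u j) • (φ j u e' - φ j s e - ∑ i, (ζ u i - ζ s i) • ψ j i s e)) +
      ∑ j, ∑ i, A u t i j • (ψ j i u e' - ψ j i s e) := by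
    have hch : ∀ i j, A s t i j = A s u i j + A u t i j + (ζ t j - ζ u j) * (ζ u i - ζ s i) :=
      fun i j => by linarith [h.chen s u t hs hsu hut ht i j]
    simp only [noise, hch, smul_sub, Finset.sum_sub_distrib, add_smul, Finset.sum_add_distrib,
      Finset.smul_sum, mul_smul, sub_smul]
    abel
  rw [key]
  refine (norm_add_le _ _).trans ?_
  have f1 := norm_sum_smul_le (mul_nonneg hC (pn κ)) hZ' hφ
  have f2 := norm_sum_sum_smul_le (mul_nonneg hC (pn (2 * κ))) (fun j i => hA' i j) hψ
  refine (add_le_add f1 f2).trans ?_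
  have q1 : τ ^ κ * τ ^ (2 / 3 : ℝ) = τ ^ (κ + 2 / 3) :=
    (Real.rpow_add_of_nonneg hτ0 (by linarith) (by norm_num)).symm
  have q2 : τ ^ (2 * κ) * τ ^ (1 / 3 : ℝ) ≤ τ ^ (κ + 2 / 3) := by
    rw [← Real.rpow_add_of_nonneg hτ0 (by linarith) (by norm_num)]
    exact pw (by linarith) (by linarith)
  have q3 : τ ^ (2 * κ) ≤ τ ^ κ := pw (by linarith) (by linarith)
  have q4 : τ ^ (2 * κ) * τ ^ (2 / 3 : ℝ) ≤ τ ^ (κ + 2 / 3) := by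
    rw [← q1]; gcongr
  calc (d : ℝ) * (C * τ ^ κ * (C * (M * τ ^ (2 / 3 : ℝ) + ‖y‖))) +
        d * (d * (C * τ ^ (2 * κ) * (C * (M * τ ^ (1 / 3 : ℝ) + ‖e' - e‖))))
      ≤ d * (C * τ ^ κ * (C * (M * τ ^ (2 / 3 : ℝ) + (B₁ * M * τ ^ (2 / 3 : ℝ) + ρ)))) +
        d * (d * (C * τ ^ (2 * κ) * (C * (M * τ ^ (1 / 3 : ℝ) +
          ((B₁ * M * τ ^ (2 / 3 : ℝ) + ρ) + d * C ^ 2 * M * τ ^ (1 / 3 : ℝ)))))) := by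
        have := hdiff.trans (add_le_add_left hyn _)
        have := pn κ
        have := pn (2 * κ)
        gcongr
    _ = d * C ^ 2 * (1 + B₁) * M * (τ ^ κ * τ ^ (2 / 3 : ℝ)) + d * C ^ 2 * ρ * τ ^ κ +
        (d ^ 2 * C ^ 2 * (1 + d * C ^ 2) * M * (τ ^ (2 * κ) * τ ^ (1 / 3 : ℝ)) +
        d ^ 2 * C ^ 2 * B₁ * M * (τ ^ (2 * κ) * τ ^ (2 / 3 : ℝ)) +
        d ^ 2 * C ^ 2 * ρ * τ ^ (2 * κ)) := by ring
    _ ≤ d * C ^ 2 * (1 + B₁) * M * τ ^ (κ + 2 / 3) + d * C ^ 2 * (1 + B₁) * ρ * τ ^ κ +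
        (d ^ 2 * C ^ 2 * (1 + d * C ^ 2) * M * τ ^ (κ + 2 / 3) +
        d ^ 2 * C ^ 2 * B₁ * M * τ ^ (κ + 2 / 3) +
        d ^ 2 * C ^ 2 * (1 + B₁ + d * C ^ 2) * ρ * τ ^ κ) := by
        rw [q1]
        have := pn κ
        have i1 : d * C ^ 2 * ρ * τ ^ κ ≤ d * C ^ 2 * (1 + B₁) * ρ * τ ^ κ := by
          have : d * C ^ 2 * 1 ≤ d * C ^ 2 * (1 + B₁) := by gcongr; linarith
          rw [mul_one] at this
          gcongr
        have i2 : d ^ 2 * C ^ 2 * ρ * τ ^ (2 * κ) ≤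
            d ^ 2 * C ^ 2 * (1 + B₁ + d * C ^ 2) * ρ * τ ^ κ := by
          have : (d : ℝ) ^ 2 * C ^ 2 * 1 ≤ d ^ 2 * C ^ 2 * (1 + B₁ + d * C ^ 2) := by
            gcongr
            have : 0 ≤ d * C ^ 2 := by positivity
            linarith
          rw [mul_one] at this
          gcongr
        gcongr
    _ = _ := by ring

end RoughField

end RoughControl

/-! ### The Davie scheme and its estimates, uniform in the partition -/

namespace RoughControl

variable {E : Type*} [NormedAddCommGroup E]

theorem exists_mul_rpow_le {κ K ε : ℝ} (hκ : 0 < κ) (hK : 0 ≤ K) (hε : 0 < ε) :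
    ∃ ℓ : ℝ, 0 < ℓ ∧ ℓ ≤ 1 ∧ K * ℓ ^ κ ≤ ε := by
  have hq : 0 < min 1 (ε / (K + 1)) := by positivity
  refine ⟨(min 1 (ε / (K + 1))) ^ (1 / κ), Real.rpow_pos_of_pos hq _,
    Real.rpow_le_one hq.le (min_le_left _ _) (by positivity), ?_⟩
  rw [← Real.rpow_mul hq.le, one_div_mul_cancel hκ.ne', Real.rpow_one]
  calc K * min 1 (ε / (K + 1)) ≤ (K + 1) * (ε / (K + 1)) := by
        gcongr
        · linarith
        · exact min_le_right _ _
    _ = ε := by field_simp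

/-- A time-dependent vector field which is integrable in time and Lipschitz in space. -/
structure LipschitzDrift (T L : ℝ) (D : ℝ → E → E) : Prop where
  integrable : ∀ e, IntervalIntegrable (fun r => D r e) volume 0 T
  lip : ∀ r ∈ Icc 0 T, ∀ e e', ‖D r e - D r e'‖ ≤ L * ‖e - e'‖

theorem LipschitzDrift.norm_le {T L : ℝ} {D : ℝ → E → E} (hD : LipschitzDrift T L D) {r c : ℝ}
    (hr : r ∈ Icc 0 T) (hc : ‖D r 0‖ ≤ c) (e : E) : ‖D r e‖ ≤ L * ‖e‖ + c := by
  have := hD.lip r hr e 0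
  rw [sub_zero] at this
  calc ‖D r e‖ = ‖(D r e - D r 0) + D r 0‖ := by rw [sub_add_cancel]
    _ ≤ _ := (norm_add_le _ _).trans (add_le_add this hc)

theorem LipschitzDrift.integrable_of_mem {T L : ℝ} {D : ℝ → E → E} (hD : LipschitzDrift T L D)
    {s t : ℝ} (hs : s ∈ Icc 0 T) (ht : t ∈ Icc 0 T) (e : E) :
    IntervalIntegrable (fun r => D r e) volume s t := by
  refine (hD.integrable e).mono_set ?_
  rw [uIcc_of_le (hs.1.trans hs.2)]
  exact uIcc_subset_Icc hs ht

variable [NormedSpace ℝ E]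

/-- The Davie scheme along the times `g`. -/
noncomputable def scheme {d : ℕ} (ζ : ℝ → Vec d) (A : ℝ → ℝ → Fin d → Fin d → ℝ)
    (φ : Fin d → ℝ → E → E) (ψ : Fin d → Fin d → ℝ → E → E) (D : ℝ → E → E) (g : ℕ → ℝ) : ℕ → E
  | 0 => 0
  | i + 1 => scheme ζ A φ ψ D g i + (∫ r in g i..g (i + 1), D r (scheme ζ A φ ψ D g i))
      + noise ζ A φ ψ (g i) (g (i + 1)) (scheme ζ A φ ψ D g i)

theorem norm_sum_integral_le {g : ℕ → ℝ} (hg : Monotone g) {u : ℕ → ℝ → E} {K : ℝ} {i j : ℕ}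
    (hij : i ≤ j)
    (hu : ∀ l, i ≤ l → l + 1 ≤ j → ∀ r ∈ Ioc (g l) (g (l + 1)), ‖u l r‖ ≤ K) :
    ‖∑ l ∈ Finset.Ico i j, ∫ r in g l..g (l + 1), u l r‖ ≤ K * (g j - g i) := by
  refine (norm_sum_le _ _).trans ?_
  have : ∀ l ∈ Finset.Ico i j, ‖∫ r in g l..g (l + 1), u l r‖ ≤ K * (g (l + 1) - g l) := by
    intro l hl
    rw [Finset.mem_Ico] at hl
    have hle : g l ≤ g (l + 1) := hg (Nat.le_succ l)
    refine (intervalIntegral.norm_integral_le_of_norm_le_const (C := K) fun r hr => ?_).trans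
      (by rw [abs_of_nonneg (sub_nonneg.2 hle)])
    rw [uIoc_of_le hle] at hr
    exact hu l hl.1 (by omega) r hr
  refine (Finset.sum_le_sum this).trans ?_
  rw [← Finset.mul_sum, Finset.sum_Ico_sub g hij]

namespace RoughField

variable {d : ℕ} {T κ C : ℝ} {ζ : ℝ → Vec d} {A : ℝ → ℝ → Fin d → Fin d → ℝ}
  {φ : Fin d → ℝ → E → E} {ψ : Fin d → Fin d → ℝ → E → E}

theorem noise_self (h : RoughField T κ C ζ A φ ψ) (hκ : 0 < κ) {s : ℝ} (hs : s ∈ Icc 0 T) (e : E) :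
    noise ζ A φ ψ s s e = 0 := by
  have := h.norm_noise_le hs.1 le_rfl hs.2 e
  rw [sub_self, Real.zero_rpow hκ.ne', Real.zero_rpow (by positivity)] at this
  simpa using this

/-- The remainder `R i j` of the scheme vanishes on consecutive indices by the recursion and is
nearly additive by `noise_defect`, so discrete sewing applies once the window is short. The
constants `ℓ` and `B` depend on the field and on `L` only, and `M` is an a priori bound inside the
window. The condition `B * ℓ ^ κ ≤ 1 / 2` serves to remove `M` later. -/
theorem scheme_window (h : RoughField T κ C ζ A φ ψ) (hκ : 1 / 3 < κ) (hκ' : κ ≤ 1 / 2) {L : ℝ}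
    (hL : 0 ≤ L) : ∃ ℓ B, 0 < ℓ ∧ ℓ ≤ 1 ∧ 0 ≤ B ∧ B * ℓ ^ κ ≤ 1 / 2 ∧
      ∀ D, LipschitzDrift T L D → ∀ g : ℕ → ℝ, Monotone g → (∀ i, g i ∈ Icc 0 T) →
      ∀ i j, i ≤ j → g j - g i ≤ ℓ → ∀ c M, 0 ≤ c → (∀ r ∈ Ioc (g i) (g j), ‖D r 0‖ ≤ c) →
      (∀ l, i ≤ l → l ≤ j → ‖scheme ζ A φ ψ D g l‖ + c ≤ M) →
      ‖scheme ζ A φ ψ D g j - scheme ζ A φ ψ D g i -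
        (∑ l ∈ Finset.Ico i j, ∫ r in g l..g (l + 1), D r (scheme ζ A φ ψ D g l)) -
        noise ζ A φ ψ (g i) (g j) (scheme ζ A φ ψ D g i)‖ ≤ B * M * (g j - g i) ^ (κ + 2 / 3) ∧
      ‖scheme ζ A φ ψ D g j - scheme ζ A φ ψ D g i‖ ≤ B * M * (g j - g i) ^ κ := by
  obtain ⟨B, hB, hdef⟩ := h.noise_defect hκ (L := L + 1) (by linarith)
  set θ := κ + 2 / 3 with hθ
  set q : ℝ := (1 / 2) ^ (θ - 1) with hq
  have hq0 : 0 < q := Real.rpow_pos_of_pos (by norm_num) _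
  have hq1 : q < 1 := Real.rpow_lt_one (by norm_num) (by norm_num) (by linarith)
  have hqθ : (1 / 2 : ℝ) ^ θ = q / 2 := by
    have : θ = (θ - 1) + 1 := by ring
    rw [this, Real.rpow_add_one (by norm_num)]; ring
  -- With `B * ℓ ^ κ ≤ 1 - q` the sewing factor is at most `(3 - q) * q / 2 ≤ (1 + q) / 2`, the gap
  -- being `(1 - q) ^ 2 / 2`. This `N` is the fixed point of `N ↦ N * (1 + q) / 2 + 2 * B`.
  set N : ℝ := 2 * B / ((1 - q) / 2) with hN
  have hN0 : 0 ≤ N := div_nonneg (by positivity) (by linarith)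
  have hNeq : N * ((1 - q) / 2) = 2 * B := by
    rw [hN, div_mul_cancel₀ _ (by linarith)]
  set B₃ : ℝ := N + (L + 1) + d * C ^ 2 + d ^ 2 * C ^ 2 with hB₃
  have hB₃0 : 0 ≤ B₃ := by positivity
  have hNB : N ≤ B₃ := by
    have : 0 ≤ d * C ^ 2 := by positivity
    have : 0 ≤ (d : ℝ) ^ 2 * C ^ 2 := by positivity
    linarith
  obtain ⟨ℓ, hℓ0, hℓ1, hℓ⟩ := exists_mul_rpow_le (κ := κ) (K := B + B₃) (ε := min (1 - q) (1 / 2))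
    (by linarith) (by positivity) (by rw [lt_min_iff]; constructor <;> linarith)
  have hℓp : 0 ≤ ℓ ^ κ := Real.rpow_nonneg hℓ0.le _
  have hBℓ : B * ℓ ^ κ ≤ 1 - q := by
    have := hℓ.trans (min_le_left _ _)
    nlinarith [mul_nonneg hB₃0 hℓp]
  have hB₃ℓ : B₃ * ℓ ^ κ ≤ 1 / 2 := by
    have := hℓ.trans (min_le_right _ _)
    nlinarith [mul_nonneg hB hℓp]
  refine ⟨ℓ, B₃, hℓ0, hℓ1, hB₃0, hB₃ℓ, ?_⟩
  intro D hD g hg hgT i₀ j₀ hij₀ hwin c M hc hDc hM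
  set e := scheme ζ A φ ψ D g with he
  set f : ℕ → ℕ → E := fun i j => ∑ l ∈ Finset.Ico i j, ∫ r in g l..g (l + 1), D r (e l) with hf
  have hM0 : 0 ≤ M := (add_nonneg (norm_nonneg _) hc).trans (hM i₀ le_rfl hij₀)
  have heM : ∀ l, i₀ ≤ l → l ≤ j₀ → ‖e l‖ ≤ M := fun l h1 h2 => by linarith [hM l h1 h2]
  have hfb : ∀ i j, i₀ ≤ i → i ≤ j → j ≤ j₀ → ‖f i j‖ ≤ (L + 1) * M * (g j - g i) := by
    intro i j hi hij hj
    refine norm_sum_integral_le hg hij fun l hl hl' r hr => ?_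
    have hr' : r ∈ Ioc (g i₀) (g j₀) :=
      ⟨(hg (hi.trans hl)).trans_lt hr.1, hr.2.trans (hg (hl'.trans hj))⟩
    have := hD.norm_le ⟨(hgT i₀).1.trans hr'.1.le, hr'.2.trans (hgT j₀).2⟩ (hDc r hr') (e l)
    have hm := hM l (by omega) (by omega)
    have := norm_nonneg (e l)
    nlinarith
  set R : ℕ → ℕ → E := fun i j => e j - e i - f i j - noise ζ A φ ψ (g i) (g j) (e i) with hR
  have hR0 : ∀ i, ‖R i i‖ = 0 := by
    intro i
    simp [hR, hf, h.noise_self (by linarith) (hgT i)]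
  have hR1 : ∀ i, ‖R i (i + 1)‖ = 0 := by
    intro i
    rw [norm_eq_zero]
    simp only [hR, hf, Nat.Ico_succ_singleton, Finset.sum_singleton]
    rw [he]
    simp only [scheme]
    abel
  have hadd : ∀ i k j, i₀ ≤ i → i ≤ k → k ≤ j → j ≤ j₀ → ‖R i j‖ ≤ ‖R i k‖ + ‖R k j‖ +
      B * (M * (g j - g i) ^ θ + ‖R i k‖ * (g j - g i) ^ κ) := by
    intro i k j hi hik hkj hj
    have hfs : f i j = f i k + f k j := (Finset.sum_Ico_consecutive _ hik hkj).symm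
    have key : R i j = R i k + R k j + (noise ζ A φ ψ (g i) (g k) (e i) +
        noise ζ A φ ψ (g k) (g j) (e k) - noise ζ A φ ψ (g i) (g j) (e i)) := by
      simp only [hR, hfs]; abel
    rw [key]
    refine (norm_add₃_le).trans (add_le_add_right ?_ _)
    refine hdef (g i) (g k) (g j) (hgT i).1 (hg hik) (hg hkj) (hgT j).2 ?_ _ _ (f i k) M
      (heM i hi (by omega)) (hfb i k hi hik (by omega))
    linarith [hg hi, hg hj]
  have hsew := discrete_sewing hg (ρ := fun i j => ‖R i j‖) hM0 hN0 (θ := θ)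
    (by linarith) hB (κ := κ) (by linarith) hR0 hR1 hadd (by
      have h1 : (g j₀ - g i₀) ^ κ ≤ ℓ ^ κ :=
        Real.rpow_le_rpow (sub_nonneg.2 (hg hij₀)) hwin (by linarith)
      have h2 : B * (g j₀ - g i₀) ^ κ ≤ 1 - q :=
        (mul_le_mul_of_nonneg_left h1 hB).trans hBℓ
      have h3 : (2 + B * (g j₀ - g i₀) ^ κ) * (1 / 2) ^ θ ≤ (1 + q) / 2 := by
        rw [hqθ]; nlinarith
      have h4 := mul_le_mul_of_nonneg_left h3 hN0
      nlinarith) _ i₀ j₀ le_rfl le_rfl hij₀ le_rfl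
  set τ := g j₀ - g i₀ with hτ
  have hτ0 : 0 ≤ τ := sub_nonneg.2 (hg hij₀)
  have pn : ∀ a : ℝ, 0 ≤ τ ^ a := fun a => Real.rpow_nonneg hτ0 a
  have pw : ∀ {b : ℝ}, κ ≤ b → τ ^ b ≤ τ ^ κ := fun hab =>
    Real.rpow_le_rpow_of_exponent_ge' hτ0 (by linarith) (by linarith) hab
  refine ⟨hsew.trans ?_, ?_⟩
  · have := pn θ
    gcongr
  have hn := h.norm_noise_le (hgT i₀).1 (hg hij₀) (hgT j₀).2 (e i₀)
  have p1 : τ ≤ τ ^ κ := by simpa using pw (b := 1) (by linarith)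
  calc ‖e j₀ - e i₀‖ = ‖R i₀ j₀ + f i₀ j₀ + noise ζ A φ ψ (g i₀) (g j₀) (e i₀)‖ := by
        congr 1; simp only [hR]; abel
    _ ≤ N * M * τ ^ θ + (L + 1) * M * τ + (d * C ^ 2 * τ ^ κ + d ^ 2 * C ^ 2 * τ ^ (2 * κ)) * M := by
        refine norm_add₃_le.trans (add_le_add (add_le_add hsew (hfb _ _ le_rfl hij₀ le_rfl)) ?_)
        refine hn.trans ?_
        have := pn κ
        have := pn (2 * κ)
        have := heM i₀ le_rfl hij₀
        gcongr
    _ ≤ N * M * τ ^ κ + (L + 1) * M * τ ^ κ + (d * C ^ 2 * τ ^ κ + d ^ 2 * C ^ 2 * τ ^ κ) * M := by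
        have := pw (b := θ) (by linarith)
        have := pw (b := 2 * κ) (by linarith)
        gcongr
    _ = B₃ * M * τ ^ κ := by simp only [hB₃]; ring

/-- Inside a window of length `ℓ` the quantity `‖e‖ + c` at most doubles. One step of the scheme,
however long, multiplies it by at most `Λ₁`. Chaining about `T / ℓ` windows joined by single steps
gives a growth constant independent of the partition. In the remainder the drift is frozen at the
left end; against the sum along the scheme this costs order `κ + 1`, better than `κ + 2/3`. Taking
`c` only over the interval after `g i` is what later exploits a drift that vanishes off the needle.
-/
theorem scheme_estimate (h : RoughField T κ C ζ A φ ψ) (hκ : 1 / 3 < κ) (hκ' : κ ≤ 1 / 2)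
    (hT : 0 ≤ T) {L : ℝ} (hL : 0 ≤ L) : ∃ Λ, 0 ≤ Λ ∧
      ∀ D, LipschitzDrift T L D → ∀ g : ℕ → ℝ, Monotone g → (∀ i, g i ∈ Icc 0 T) →
      ∀ i j k, i ≤ j → j ≤ k → ∀ c, 0 ≤ c → (∀ r ∈ Ioc (g i) (g k), ‖D r 0‖ ≤ c) →
      ‖scheme ζ A φ ψ D g k‖ ≤ Λ * (‖scheme ζ A φ ψ D g i‖ + c) ∧
      ‖scheme ζ A φ ψ D g k - scheme ζ A φ ψ D g j -
        (∫ r in g j..g k, D r (scheme ζ A φ ψ D g j)) -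
        noise ζ A φ ψ (g j) (g k) (scheme ζ A φ ψ D g j)‖ ≤
        Λ * (‖scheme ζ A φ ψ D g i‖ + c) * (g k - g j) ^ (κ + 2 / 3) := by
  obtain ⟨ℓ, B, hℓ0, hℓ1, hB, hBℓ, hwin⟩ := h.scheme_window hκ hκ' hL
  set θ := κ + 2 / 3 with hθ
  set Λ₁ : ℝ := 1 + ((L + 1) * T + (d * C ^ 2 * T ^ κ + d ^ 2 * C ^ 2 * T ^ (2 * κ))) with hΛ₁
  have hΛ₁1 : 1 ≤ Λ₁ := by
    have : 0 ≤ (L + 1) * T + (d * C ^ 2 * T ^ κ + d ^ 2 * C ^ 2 * T ^ (2 * κ)) := by positivity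
    linarith
  obtain ⟨m₀, hm₀⟩ := exists_nat_ge (T / ℓ)
  set Λ₂ : ℝ := 2 * (2 * Λ₁) ^ m₀ with hΛ₂
  have hΛ₂0 : 0 ≤ Λ₂ := by positivity
  refine ⟨Λ₂ + (B + L * B) * Λ₂ + (1 + Λ₁) * Λ₂ * ℓ ^ (-θ), by positivity, ?_⟩
  intro D hD g hg hgT
  set e := scheme ζ A φ ψ D g with he
  have hmem : ∀ {i k : ℕ} {r : ℝ}, r ∈ Ioc (g i) (g k) → r ∈ Icc 0 T := fun {i k r} hr =>
    ⟨(hgT i).1.trans hr.1.le, hr.2.trans (hgT k).2⟩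
  have hgrow : ∀ i j c, i ≤ j → 0 ≤ c → g j - g i ≤ ℓ → (∀ r ∈ Ioc (g i) (g j), ‖D r 0‖ ≤ c) →
      ‖e j‖ + c ≤ 2 * (‖e i‖ + c) := by
    intro i j c hij hc hℓij hDc
    -- With the maximum of `‖e‖ + c` over the window as `M`, the increment up to `l` is at most half
    -- of `M` and is absorbed.
    obtain ⟨l, hl, hlmax⟩ := Finset.exists_max_image (Finset.Icc i j) (fun l => ‖e l‖ + c)
      ⟨i, by simp [hij]⟩
    simp only [Finset.mem_Icc] at hl hlmax
    have h1 := (hwin D hD g hg hgT i l hl.1 (by linarith [hg hl.2]) c (‖e l‖ + c) hc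
      (fun r hr => hDc r ⟨hr.1, hr.2.trans (hg hl.2)⟩)
      (fun l' a b => hlmax l' ⟨a, b.trans hl.2⟩)).2
    have h2 : (g l - g i) ^ κ ≤ ℓ ^ κ := Real.rpow_le_rpow (sub_nonneg.2 (hg hl.1))
      (by linarith [hg hl.2]) (by linarith)
    have h3 : ‖e l - e i‖ ≤ (‖e l‖ + c) * (1 / 2) := by
      have hn : 0 ≤ ‖e l‖ + c := by positivity
      calc ‖e l - e i‖ ≤ B * (‖e l‖ + c) * (g l - g i) ^ κ := h1
        _ ≤ B * (‖e l‖ + c) * ℓ ^ κ := by gcongr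
        _ = (‖e l‖ + c) * (B * ℓ ^ κ) := by ring
        _ ≤ _ := by gcongr
    have h4 := hlmax j ⟨hij, le_rfl⟩
    have h5 := norm_sub_norm_le (e l) (e i)
    linarith
  have hstepn : ∀ i j c, i ≤ j → 0 ≤ c → (∀ r ∈ Ioc (g i) (g j), ‖D r 0‖ ≤ c) →
      ‖∫ r in g i..g j, D r (e i)‖ + ‖noise ζ A φ ψ (g i) (g j) (e i)‖ ≤
        (Λ₁ - 1) * (‖e i‖ + c) := by
    intro i j c hij hc hDc
    have hle := hg hij
    have h1 : ‖∫ r in g i..g j, D r (e i)‖ ≤ (L + 1) * (‖e i‖ + c) * T := by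
      refine (intervalIntegral.norm_integral_le_of_norm_le_const
        (C := (L + 1) * (‖e i‖ + c)) fun r hr => ?_).trans ?_
      · rw [uIoc_of_le hle] at hr
        have := hD.norm_le (hmem hr) (hDc r hr) (e i)
        have := norm_nonneg (e i)
        nlinarith
      · rw [abs_of_nonneg (sub_nonneg.2 hle)]
        gcongr
        linarith [(hgT i).1, (hgT j).2]
    have h2 := h.norm_noise_le (hgT i).1 hle (hgT j).2 (e i)
    have hτT : g j - g i ≤ T := by linarith [(hgT i).1, (hgT j).2]
    have h3 : (g j - g i) ^ κ ≤ T ^ κ := Real.rpow_le_rpow (sub_nonneg.2 hle) hτT (by linarith)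
    have h4 : (g j - g i) ^ (2 * κ) ≤ T ^ (2 * κ) :=
      Real.rpow_le_rpow (sub_nonneg.2 hle) hτT (by linarith)
    have h5 : ‖noise ζ A φ ψ (g i) (g j) (e i)‖ ≤
        (d * C ^ 2 * T ^ κ + d ^ 2 * C ^ 2 * T ^ (2 * κ)) * (‖e i‖ + c) := by
      refine h2.trans ?_
      have : 0 ≤ d * C ^ 2 * T ^ κ + d ^ 2 * C ^ 2 * T ^ (2 * κ) := by positivity
      gcongr
      linarith
    calc _ ≤ _ := add_le_add h1 h5
      _ = _ := by simp only [hΛ₁]; ring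
  have hstep : ∀ i c, 0 ≤ c → (∀ r ∈ Ioc (g i) (g (i + 1)), ‖D r 0‖ ≤ c) →
      ‖e (i + 1)‖ + c ≤ Λ₁ * (‖e i‖ + c) := by
    intro i c hc hDc
    have h1 := hstepn i (i + 1) c (Nat.le_succ i) hc hDc
    have h2 : ‖e (i + 1)‖ ≤ ‖e i‖ + ‖∫ r in g i..g (i + 1), D r (e i)‖ +
        ‖noise ζ A φ ψ (g i) (g (i + 1)) (e i)‖ := norm_add₃_le
    linarith
  have hglob : ∀ (m : ℕ) i j c, i ≤ j → 0 ≤ c → g j - g i ≤ m * ℓ →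
      (∀ r ∈ Ioc (g i) (g j), ‖D r 0‖ ≤ c) → ‖e j‖ + c ≤ 2 * (2 * Λ₁) ^ m * (‖e i‖ + c) := by
    intro m
    induction m with
    | zero =>
      intro i j c hij hc hm hDc
      simpa using hgrow i j c hij hc (by push_cast at hm; linarith) hDc
    | succ m ih =>
      intro i j c hij hc hm hDc
      have hn : 0 ≤ ‖e i‖ + c := by positivity
      by_cases hle : g j - g i ≤ ℓ
      · refine (hgrow i j c hij hc hle hDc).trans ?_
        have : (1 : ℝ) ≤ (2 * Λ₁) ^ (m + 1) := one_le_pow₀ (by linarith)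
        gcongr
        linarith
      · classical
        -- The index `k + i` is the last one within `ℓ` of `g i`. The next step leaves the window,
        -- and after it the remaining length has dropped by more than `ℓ`.
        let P : ℕ → Prop := fun k => g (k + i) ≤ g i + ℓ
        have hP0 : P 0 := by simp only [P, zero_add]; linarith
        set k := Nat.findGreatest P (j - i) with hk
        have hkle : k ≤ j - i := Nat.findGreatest_le _
        have hPk : P k := Nat.findGreatest_spec (P := P) (Nat.zero_le _) hP0
        simp only [P] at hPk
        have hkne : k ≠ j - i := fun hkk => by
          rw [hkk, Nat.sub_add_cancel hij] at hPk
          linarith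
        have hnext := Nat.findGreatest_is_greatest (P := P) (k := k + 1) (n := j - i)
          (by omega) (by omega)
        simp only [P, not_le] at hnext
        have h2 : k + 1 + i = k + i + 1 := by omega
        rw [h2] at hnext
        have hik : i ≤ k + i := by omega
        have hkj : k + i + 1 ≤ j := by omega
        have s1 := hgrow i (k + i) c hik hc (by linarith)
          fun r hr => hDc r ⟨hr.1, hr.2.trans (hg (by omega))⟩
        have s2 := hstep (k + i) c hc
          fun r hr => hDc r ⟨(hg hik).trans_lt hr.1, hr.2.trans (hg hkj)⟩
        have s3 := ih (k + i + 1) j c hkj hc (by push_cast at hm; linarith)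
          fun r hr => hDc r ⟨(hg (by omega)).trans_lt hr.1, hr.2⟩
        calc ‖e j‖ + c ≤ 2 * (2 * Λ₁) ^ m * (‖e (k + i + 1)‖ + c) := s3
          _ ≤ 2 * (2 * Λ₁) ^ m * (Λ₁ * (‖e (k + i)‖ + c)) := by gcongr
          _ ≤ 2 * (2 * Λ₁) ^ m * (Λ₁ * (2 * (‖e i‖ + c))) := by gcongr
          _ = _ := by ring
  have hall : ∀ i j c, i ≤ j → 0 ≤ c → (∀ r ∈ Ioc (g i) (g j), ‖D r 0‖ ≤ c) →
      ‖e j‖ + c ≤ Λ₂ * (‖e i‖ + c) := by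
    intro i j c hij hc hDc
    refine hglob m₀ i j c hij hc ?_ hDc
    rw [div_le_iff₀ hℓ0] at hm₀
    linarith [(hgT i).1, (hgT j).2]
  intro i j k hij hjk c hc hDc
  have hn : 0 ≤ ‖e i‖ + c := by positivity
  have hℓθ : 0 ≤ ℓ ^ (-θ) := Real.rpow_nonneg hℓ0.le _
  have hy1 : 0 ≤ (B + L * B) * Λ₂ := by positivity
  have hy2 : 0 ≤ (1 + Λ₁) * Λ₂ * ℓ ^ (-θ) := by positivity
  have hx1 : 0 ≤ (B + L * B) * Λ₂ * (‖e i‖ + c) := by positivity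
  have hx2 : 0 ≤ (1 + Λ₁) * Λ₂ * ℓ ^ (-θ) * (‖e i‖ + c) := by positivity
  have hx3 : 0 ≤ Λ₂ * (‖e i‖ + c) := by positivity
  refine ⟨by linarith [hall i k c (hij.trans hjk) hc hDc], ?_⟩
  set M := Λ₂ * (‖e i‖ + c) with hM
  have hMl : ∀ l, j ≤ l → l ≤ k → ‖e l‖ + c ≤ M := fun l h1 h2 =>
    hall i l c (by omega) hc fun r hr => hDc r ⟨hr.1, hr.2.trans (hg h2)⟩
  set τ := g k - g j with hτ
  have hτ0 : 0 ≤ τ := sub_nonneg.2 (hg hjk)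
  have hDc' : ∀ r ∈ Ioc (g j) (g k), ‖D r 0‖ ≤ c :=
    fun r hr => hDc r ⟨(hg hij).trans_lt hr.1, hr.2⟩
  have pθ : 0 ≤ τ ^ θ := Real.rpow_nonneg hτ0 _
  by_cases hle : τ ≤ ℓ
  · have hw := (hwin D hD g hg hgT j k hjk hle c M hc hDc' hMl).1
    have hfr : ‖(∑ l ∈ Finset.Ico j k, ∫ r in g l..g (l + 1), D r (e l)) -
        ∫ r in g j..g k, D r (e j)‖ ≤ L * (B * M * τ ^ κ) * τ := by
      rw [← intervalIntegral.sum_integral_adjacent_intervals_Ico hjk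
        (fun l _ => hD.integrable_of_mem (hgT l) (hgT (l + 1)) (e j)), ← Finset.sum_sub_distrib]
      have : ∀ l ∈ Finset.Ico j k, (∫ r in g l..g (l + 1), D r (e l)) -
          ∫ r in g l..g (l + 1), D r (e j) = ∫ r in g l..g (l + 1), (D r (e l) - D r (e j)) :=
        fun l _ => (intervalIntegral.integral_sub (hD.integrable_of_mem (hgT l) (hgT (l + 1)) _)
          (hD.integrable_of_mem (hgT l) (hgT (l + 1)) _)).symm
      rw [Finset.sum_congr rfl this]
      refine norm_sum_integral_le hg hjk fun l hl hl' r hr => ?_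
      refine (hD.lip r (hmem hr) _ _).trans ?_
      have hlk : g l - g j ≤ τ := by linarith [hg (show l ≤ k by omega)]
      have h1 := (hwin D hD g hg hgT j l hl (hlk.trans hle) c M hc
        (fun r hr => hDc' r ⟨hr.1, hr.2.trans (hg (by omega))⟩)
        (fun l' a b => hMl l' a (by omega))).2
      have h2 : (g l - g j) ^ κ ≤ τ ^ κ :=
        Real.rpow_le_rpow (sub_nonneg.2 (hg hl)) hlk (by linarith)
      refine mul_le_mul_of_nonneg_left (h1.trans ?_) hL
      gcongr
    have hp : τ ^ κ * τ ≤ τ ^ θ := by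
      rw [← Real.rpow_add_one' hτ0 (by linarith)]
      exact Real.rpow_le_rpow_of_exponent_ge' hτ0 (by linarith) (by linarith) (by linarith)
    calc _ = ‖(e k - e j - (∑ l ∈ Finset.Ico j k, ∫ r in g l..g (l + 1), D r (e l)) -
          noise ζ A φ ψ (g j) (g k) (e j)) +
          ((∑ l ∈ Finset.Ico j k, ∫ r in g l..g (l + 1), D r (e l)) -
          ∫ r in g j..g k, D r (e j))‖ := by congr 1; abel
      _ ≤ B * M * τ ^ θ + L * (B * M * τ ^ κ) * τ := (norm_add_le _ _).trans (add_le_add hw hfr)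
      _ = B * M * τ ^ θ + L * B * M * (τ ^ κ * τ) := by ring
      _ ≤ B * M * τ ^ θ + L * B * M * τ ^ θ := by gcongr
      _ = (B + L * B) * Λ₂ * (‖e i‖ + c) * τ ^ θ := by simp only [hM]; ring
      _ ≤ _ := by gcongr; linarith
  -- Over increments longer than `ℓ` the remainder is bounded crudely, since `ℓ ^ (-θ) * τ ^ θ ≥ 1`.
  · have h1 := hstepn j k c hjk hc hDc'
    have h2 := hMl k hjk le_rfl
    have h3 := hMl j le_rfl hjk
    have h4 : 1 ≤ ℓ ^ (-θ) * τ ^ θ := by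
      rw [Real.rpow_neg hℓ0.le, ← div_eq_inv_mul, one_le_div (Real.rpow_pos_of_pos hℓ0 _)]
      exact Real.rpow_le_rpow hℓ0.le (not_le.1 hle).le (by linarith)
    have h5 : (Λ₁ - 1) * (‖e j‖ + c) ≤ (Λ₁ - 1) * M :=
      mul_le_mul_of_nonneg_left h3 (by linarith)
    have h6 : 0 ≤ (1 + Λ₁) * M := by positivity
    calc _ ≤ ‖e k‖ + ‖e j‖ + ‖∫ r in g j..g k, D r (e j)‖ +
          ‖noise ζ A φ ψ (g j) (g k) (e j)‖ := by
          refine (norm_sub_le _ _).trans (add_le_add_left ?_ _)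
          exact (norm_sub_le _ _).trans (add_le_add_left (norm_sub_le _ _) _)
      _ ≤ (1 + Λ₁) * M := by linarith
      _ ≤ (1 + Λ₁) * M * (ℓ ^ (-θ) * τ ^ θ) := le_mul_of_one_le_right h6 h4
      _ = (1 + Λ₁) * Λ₂ * ℓ ^ (-θ) * (‖e i‖ + c) * τ ^ θ := by simp only [hM]; ring
      _ ≤ _ := by gcongr; linarith

end RoughField

end RoughControl

/-! ### Existence of solutions by compactness -/

namespace RoughControl

variable {E : Type*} [NormedAddCommGroup E] [NormedSpace ℝ E]

theorem exists_monotone_enumeration {T : ℝ} (P : Finset ℝ) (h0 : (0 : ℝ) ∈ P)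
    (hP : ∀ s ∈ P, s ∈ Icc 0 T) :
    ∃ g : ℕ → ℝ, Monotone g ∧ (∀ i, g i ∈ Icc 0 T) ∧ g 0 = 0 ∧ ∀ s ∈ P, ∃ i, g i = s := by
  have hc : 0 < P.card := Finset.card_pos.2 ⟨0, h0⟩
  let g : ℕ → ℝ := fun i => P.orderEmbOfFin rfl ⟨min i (P.card - 1), by omega⟩
  have hmono : Monotone g := fun i j hij => by
    refine (P.orderEmbOfFin rfl).monotone ?_
    rw [Fin.mk_le_mk]
    omega
  have hmem : ∀ i, g i ∈ P := fun i => Finset.orderEmbOfFin_mem _ _ _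
  have hsurj : ∀ s ∈ P, ∃ i, g i = s := by
    intro s hs
    have : s ∈ Set.range (P.orderEmbOfFin rfl) := by
      rw [Finset.range_orderEmbOfFin]; exact hs
    obtain ⟨⟨i, hi⟩, rfl⟩ := this
    refine ⟨i, ?_⟩
    simp only [g]
    congr 2
    omega
  refine ⟨g, hmono, fun i => hP _ (hmem i), ?_, hsurj⟩
  obtain ⟨i, hi⟩ := hsurj 0 h0
  have h1 := hmono (Nat.zero_le i)
  have h2 := (hP _ (hmem 0)).1
  linarith

theorem LipschitzDrift.continuous_integral {T L : ℝ} {D : ℝ → E → E}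
    (hD : LipschitzDrift T L D) {s t : ℝ} (hs : s ∈ Icc 0 T) (ht : t ∈ Icc 0 T) (hst : s ≤ t) :
    Continuous fun e => ∫ r in s..t, D r e := by
  refine (LipschitzWith.of_dist_le' (K := L * (t - s)) fun e e' => ?_).continuous
  rw [dist_eq_norm, dist_eq_norm, ← intervalIntegral.integral_sub
    (hD.integrable_of_mem hs ht e) (hD.integrable_of_mem hs ht e')]
  refine (intervalIntegral.norm_integral_le_of_norm_le_const
    (C := L * ‖e - e'‖) fun r hr => ?_).trans (le_of_eq ?_)
  · rw [uIoc_of_le hst] at hr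
    exact hD.lip r ⟨hs.1.trans hr.1.le, hr.2.trans ht.2⟩ e e'
  · rw [abs_of_nonneg (sub_nonneg.2 hst)]; ring

/-- Existence of a solution `δ` of `dδ = D(r, δ) dr + φ(r, δ) dζ` started at `0`, together with
its linear growth from every intermediate time. -/
theorem RoughField.exists_solution [ProperSpace E] {d : ℕ} {T κ C : ℝ} {ζ : ℝ → Vec d}
    {A : ℝ → ℝ → Fin d → Fin d → ℝ} {φ : Fin d → ℝ → E → E} {ψ : Fin d → Fin d → ℝ → E → E}
    (h : RoughField T κ C ζ A φ ψ) (hκ : 1 / 3 < κ) (hκ' : κ ≤ 1 / 2) (hT : 0 ≤ T) {L : ℝ}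
    (hL : 0 ≤ L) : ∃ Λ, 0 ≤ Λ ∧ ∀ D, LipschitzDrift T L D →
      ∀ c₀, (∀ r ∈ Icc 0 T, ‖D r 0‖ ≤ c₀) → ∃ δ : ℝ → E, δ 0 = 0 ∧
      ∀ u s t c, 0 ≤ u → u ≤ s → s ≤ t → t ≤ T → 0 ≤ c → (∀ r ∈ Ioc u t, ‖D r 0‖ ≤ c) →
      ‖δ t‖ ≤ Λ * (‖δ u‖ + c) ∧
      ‖δ t - δ s - (∫ r in s..t, D r (δ s)) - noise ζ A φ ψ s t (δ s)‖ ≤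
        Λ * (‖δ u‖ + c) * (t - s) ^ (κ + 2 / 3) := by
  classical
  obtain ⟨Λ, hΛ, hest⟩ := h.scheme_estimate hκ hκ' hT hL
  refine ⟨Λ, hΛ, fun D hD c₀ hc₀ => ?_⟩
  have hc₀0 : 0 ≤ c₀ := (norm_nonneg _).trans (hc₀ 0 ⟨le_rfl, hT⟩)
  -- The quadruple `q` stands for `(u, s, t, c)`.
  let Q : ℝ × ℝ × ℝ × ℝ → Prop := fun q => 0 ≤ q.1 ∧ q.1 ≤ q.2.1 ∧ q.2.1 ≤ q.2.2.1 ∧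
    q.2.2.1 ≤ T ∧ 0 ≤ q.2.2.2 ∧ ∀ r ∈ Ioc q.1 q.2.2.1, ‖D r 0‖ ≤ q.2.2.2
  let S : ℝ × ℝ × ℝ × ℝ → Set (ℝ → E) := fun q => {δ | δ 0 = 0} ∩ {δ | Q q →
    ‖δ q.2.2.1‖ ≤ Λ * (‖δ q.1‖ + q.2.2.2) ∧
      ‖δ q.2.2.1 - δ q.2.1 - (∫ r in q.2.1..q.2.2.1, D r (δ q.2.1)) -
        noise ζ A φ ψ q.2.1 q.2.2.1 (δ q.2.1)‖ ≤
        Λ * (‖δ q.1‖ + q.2.2.2) * (q.2.2.1 - q.2.1) ^ (κ + 2 / 3)}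
  -- Each condition `S q` is closed in the product topology, as it involves finitely many values of
  -- `δ`, and the uniform bound `Λ * c₀` places all candidates in a product of compact balls.
  -- Finitely many conditions concern finitely many times, and the scheme along those times
  -- satisfies them. Tychonoff's theorem then gives one `δ` for all conditions, without any
  -- convergence of schemes.
  have hne : ((Set.pi univ fun _ : ℝ => Metric.closedBall (0 : E) (Λ * c₀)) ∩ ⋂ q, S q).Nonempty := by
    refine IsCompact.inter_iInter_nonempty
      (isCompact_univ_pi fun _ => isCompact_closedBall _ _) S ?_ ?_
    · intro q
      refine (isClosed_eq (continuous_apply 0) continuous_const).inter ?_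
      by_cases hq : Q q
      · have hs : q.2.1 ∈ Icc 0 T := ⟨hq.1.trans hq.2.1, hq.2.2.1.trans hq.2.2.2.1⟩
        have ht : q.2.2.1 ∈ Icc 0 T := ⟨hs.1.trans hq.2.2.1, hq.2.2.2.1⟩
        have hn := h.continuous_noise hs q.2.2.1
        have hi := hD.continuous_integral hs ht hq.2.2.1
        have hi' : Continuous fun δ : ℝ → E => ∫ r in q.2.1..q.2.2.1, D r (δ q.2.1) :=
          hi.comp (continuous_apply q.2.1)
        have hn' : Continuous fun δ : ℝ → E => noise ζ A φ ψ q.2.1 q.2.2.1 (δ q.2.1) :=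
          hn.comp (continuous_apply q.2.1)
        simp only [hq, true_imp_iff, ofPred_and]
        refine IsClosed.inter (isClosed_le ?_ ?_) (isClosed_le ?_ ?_) <;> fun_prop
      · simp [hq]
    · intro F
      set P : Finset ℝ := insert 0 ((F.image (fun q => q.1) ∪ F.image (fun q => q.2.1) ∪
        F.image (fun q => q.2.2.1)).filter (fun s => s ∈ Icc 0 T)) with hP
      obtain ⟨g, hg, hgT, hg0, hsurj⟩ := exists_monotone_enumeration (T := T) P
        (Finset.mem_insert_self _ _) (by
          intro s hs
          rw [hP, Finset.mem_insert, Finset.mem_filter] at hs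
          rcases hs with rfl | hs
          · exact ⟨le_rfl, hT⟩
          · exact hs.2)
      have hest' := hest D hD g hg hgT
      set e := scheme ζ A φ ψ D g with he
      have he0 : e 0 = 0 := rfl
      let idx : ℝ → ℕ := fun s => if hs : ∃ i, g i = s then hs.choose else 0
      have hidx : ∀ s ∈ P, g (idx s) = s := by
        intro s hs
        have := hsurj s hs
        simp only [idx, dif_pos this]
        exact this.choose_spec
      have hidxle : ∀ s ∈ P, ∀ t ∈ P, s ≤ t → idx s ≤ idx t := by
        intro s hs t ht hst
        rcases hst.eq_or_lt with rfl | hlt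
        · exact le_rfl
        · by_contra hcon
          have := hg (not_le.1 hcon).le
          rw [hidx s hs, hidx t ht] at this
          linarith
      refine ⟨fun s => e (idx s), fun s _ => ?_, mem_iInter₂.2 fun q hq => ⟨?_, fun hQ => ?_⟩⟩
      · rw [mem_closedBall_zero_iff]
        have := (hest' 0 0 (idx s) le_rfl (Nat.zero_le _) c₀ hc₀0
          fun r hr => hc₀ r ⟨(hgT 0).1.trans hr.1.le, hr.2.trans (hgT _).2⟩).1
        rwa [he0, norm_zero, zero_add] at this
      -- The chosen index of time `0` need not be `0`, but `g` equals `0` there, so the growth bound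
      -- over an empty interval with `c = 0` still gives the value zero.
      · have h0P : (0 : ℝ) ∈ P := Finset.mem_insert_self _ _
        have := (hest' 0 0 (idx 0) le_rfl (Nat.zero_le _) 0 le_rfl (by
          rw [hidx 0 h0P, hg0, Ioc_self]; simp)).1
        rw [he0, norm_zero, zero_add, mul_zero] at this
        exact norm_le_zero_iff.1 this
      · obtain ⟨h1, h2, h3, h4, h5, h6⟩ := hQ
        have hu : q.1 ∈ P := by
          rw [hP, Finset.mem_insert, Finset.mem_filter]
          exact Or.inr ⟨Finset.mem_union_left _ (Finset.mem_union_left _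
            (Finset.mem_image_of_mem _ hq)), h1, by linarith⟩
        have hs : q.2.1 ∈ P := by
          rw [hP, Finset.mem_insert, Finset.mem_filter]
          exact Or.inr ⟨Finset.mem_union_left _ (Finset.mem_union_right _
            (Finset.mem_image_of_mem (fun q => q.2.1) hq)), by linarith, by linarith⟩
        have ht : q.2.2.1 ∈ P := by
          rw [hP, Finset.mem_insert, Finset.mem_filter]
          exact Or.inr ⟨Finset.mem_union_right _
            (Finset.mem_image_of_mem (fun q => q.2.2.1) hq), by linarith, by linarith⟩
        have := hest' (idx q.1) (idx q.2.1) (idx q.2.2.1) (hidxle _ hu _ hs h2)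
          (hidxle _ hs _ ht h3) q.2.2.2 h5 (by rwa [hidx _ hu, hidx _ ht])
        rwa [hidx _ hs, hidx _ ht] at this
  obtain ⟨δ, -, hδ⟩ := hne
  rw [mem_iInter] at hδ
  refine ⟨δ, (hδ (0, 0, 0, 0)).1, fun u s t c h1 h2 h3 h4 h5 h6 => ?_⟩
  exact (hδ (u, s, t, c)).2 ⟨h1, h2, h3, h4, h5, h6⟩

end RoughControl

/-! ### Taylor remainders and interpolation of derivatives -/

namespace RoughControl

section Calculus

variable {E F : Type*} [NormedAddCommGroup E] [NormedSpace ℝ E] [NormedAddCommGroup F]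
  [NormedSpace ℝ F]

theorem norm_taylor_two_le {f : E → F} (hf : Differentiable ℝ f) {K : ℝ} (hK : 0 ≤ K)
    (hlip : ∀ x y, ‖fderiv ℝ f x - fderiv ℝ f y‖ ≤ K * ‖x - y‖) (x w : E) :
    ‖f (x + w) - f x - fderiv ℝ f x w‖ ≤ K * ‖w‖ ^ 2 := by
  have := (convex_segment (𝕜 := ℝ) x (x + w)).norm_image_sub_le_of_norm_fderiv_le'
    (f := f) (φ := fderiv ℝ f x) (C := K * ‖w‖) (fun z _ => hf z) (fun z hz => by
      refine (hlip z x).trans (mul_le_mul_of_nonneg_left ?_ hK)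
      have := norm_sub_le_of_mem_segment hz
      simpa using this) (left_mem_segment ℝ x (x + w)) (right_mem_segment ℝ x (x + w))
  simp only [add_sub_cancel_left] at this
  calc _ ≤ K * ‖w‖ * ‖w‖ := this
    _ = _ := by ring

theorem opNorm_le_of_norm_eq {l : E →L[ℝ] F} {a M : ℝ} (ha : 0 < a) (hM : 0 ≤ M)
    (h : ∀ w, ‖w‖ = a → ‖l w‖ ≤ M * a) : ‖l‖ ≤ M := by
  refine l.opNorm_le_bound hM fun v => ?_
  rcases eq_or_ne v 0 with rfl | hv
  · simp
  have hv' : 0 < ‖v‖ := norm_pos_iff.2 hv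
  have := h ((a / ‖v‖) • v) (by
    rw [norm_smul, Real.norm_eq_abs, abs_of_pos (by positivity)]; field_simp)
  rw [map_smul, norm_smul, Real.norm_eq_abs, abs_of_pos (by positivity), div_mul_eq_mul_div,
    div_le_iff₀ hv'] at this
  nlinarith

/-- Interpolation: a small function with Lipschitz derivative has a small derivative. -/
theorem norm_fderiv_le_of_lipschitz {g : E → F} (hg : Differentiable ℝ g) {K a : ℝ} (hK : 0 ≤ K)
    (ha : 0 ≤ a) (hlip : ∀ x y, ‖fderiv ℝ g x - fderiv ℝ g y‖ ≤ K * ‖x - y‖)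
    (hb : ∀ x, ‖g x‖ ≤ K * a ^ 2) (x : E) : ‖fderiv ℝ g x‖ ≤ 3 * K * a := by
  rcases ha.eq_or_lt with rfl | ha
  · have : g = fun _ => 0 := funext fun x => norm_le_zero_iff.1 (by simpa using hb x)
    rw [this]; simp
  refine opNorm_le_of_norm_eq ha (by positivity) fun w hw => ?_
  have h1 := norm_taylor_two_le hg hK hlip x w
  have h2 : fderiv ℝ g x w = g (x + w) - g x - (g (x + w) - g x - fderiv ℝ g x w) := by abel
  rw [h2]
  refine (norm_sub_le _ _).trans ?_
  have h3 := norm_sub_le (g (x + w)) (g x)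
  have := hb (x + w)
  have := hb x
  rw [hw] at h1
  nlinarith

/-- Interpolation: a small function with Lipschitz second derivative has a small derivative. -/
theorem norm_fderiv_le_of_lipschitz₂ {g : E → F} (hg : Differentiable ℝ g)
    (hg' : Differentiable ℝ (fderiv ℝ g)) {K a : ℝ} (hK : 0 ≤ K) (ha : 0 ≤ a)
    (hlip : ∀ x y, ‖fderiv ℝ (fderiv ℝ g) x - fderiv ℝ (fderiv ℝ g) y‖ ≤ K * ‖x - y‖)
    (hb : ∀ x, ‖g x‖ ≤ K * a ^ 3) (x : E) : ‖fderiv ℝ g x‖ ≤ 2 * K * a ^ 2 := by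
  rcases ha.eq_or_lt with rfl | ha
  · have : g = fun _ => 0 := funext fun x => norm_le_zero_iff.1 (by simpa using hb x)
    rw [this]; simp
  refine opNorm_le_of_norm_eq ha (by positivity) fun w hw => ?_
  -- The symmetric difference has no second-order term, so its linear approximation has a cubic
  -- error in `‖w‖`. At `‖w‖ = a` this has the same order as the bound on `g`, whence `a ^ 2` after
  -- division by `a`.
  have hk : ∀ z, HasFDerivAt (fun z => g (x + z) - g (x - z))
      (fderiv ℝ g (x + z) + fderiv ℝ g (x - z)) z := by
    intro z
    have h1 : HasFDerivAt (fun z => g (x + z)) (fderiv ℝ g (x + z)) z := by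
      simpa [Function.comp_def] using (hg (x + z)).hasFDerivAt.comp z ((hasFDerivAt_id z).const_add x)
    have h2 : HasFDerivAt (fun z => g (x - z)) (-fderiv ℝ g (x - z)) z := by
      simpa [Function.comp_def] using (hg (x - z)).hasFDerivAt.comp z ((hasFDerivAt_id z).const_sub x)
    have := h1.sub h2
    rw [sub_neg_eq_add] at this
    exact this
  have h1 := (convex_segment (𝕜 := ℝ) (0 : E) w).norm_image_sub_le_of_norm_hasFDerivWithin_le'
    (f := fun z => g (x + z) - g (x - z)) (φ := (2 : ℝ) • fderiv ℝ g x) (C := 2 * K * ‖w‖ ^ 2)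
    (fun z _ => (hk z).hasFDerivWithinAt) (fun z hz => by
      have hz' : ‖z‖ ≤ ‖w‖ := by simpa using norm_sub_le_of_mem_segment hz
      have t1 := norm_taylor_two_le hg' hK hlip x z
      have t2 := norm_taylor_two_le hg' hK hlip x (-z)
      rw [norm_neg] at t2
      have : fderiv ℝ g (x + z) + fderiv ℝ g (x - z) - (2 : ℝ) • fderiv ℝ g x =
          (fderiv ℝ g (x + z) - fderiv ℝ g x - fderiv ℝ (fderiv ℝ g) x z) +
          (fderiv ℝ g (x + -z) - fderiv ℝ g x - fderiv ℝ (fderiv ℝ g) x (-z)) := by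
        rw [map_neg, two_smul, sub_eq_add_neg x z]; abel
      rw [this]
      have h3 : ‖z‖ ^ 2 ≤ ‖w‖ ^ 2 := by gcongr
      refine (norm_add_le _ _).trans ?_
      nlinarith) (left_mem_segment ℝ 0 w) (right_mem_segment ℝ 0 w)
  simp only [sub_zero, add_zero, sub_self] at h1
  have h2 : (2 : ℝ) • fderiv ℝ g x w = g (x + w) - g (x - w) -
      (g (x + w) - g (x - w) - ((2 : ℝ) • fderiv ℝ g x) w) := by
    rw [smul_apply]; abel
  have h3 : ‖(2 : ℝ) • fderiv ℝ g x w‖ ≤ 4 * K * a ^ 3 := by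
    rw [h2]
    refine (norm_sub_le _ _).trans ?_
    have h3 := norm_sub_le (g (x + w)) (g (x - w))
    have := hb (x + w)
    have := hb (x - w)
    rw [hw] at h1
    nlinarith
  rw [norm_smul, Real.norm_eq_abs, abs_of_pos (by norm_num : (0 : ℝ) < 2)] at h3
  nlinarith

/-- Mean value inequality for `z ↦ G (z + e) - G z`, whose derivative is of size `K * ‖e‖`. -/
theorem norm_four_point_le {G : E → F} (hG : Differentiable ℝ G) {K : ℝ}
    (hlip : ∀ x y, ‖fderiv ℝ G x - fderiv ℝ G y‖ ≤ K * ‖x - y‖) (x x' e : E) :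
    ‖(G (x' + e) - G x') - (G (x + e) - G x)‖ ≤ K * ‖e‖ * ‖x' - x‖ := by
  have hk : ∀ z, HasFDerivAt (fun z => G (z + e) - G z) (fderiv ℝ G (z + e) - fderiv ℝ G z) z := by
    intro z
    have h1 : HasFDerivAt (fun z => G (z + e)) (fderiv ℝ G (z + e)) z := by
      simpa [Function.comp_def] using (hG (z + e)).hasFDerivAt.comp z ((hasFDerivAt_id z).add_const e)
    exact h1.sub (hG z).hasFDerivAt
  exact convex_univ.norm_image_sub_le_of_norm_hasFDerivWithin_le
    (f := fun z => G (z + e) - G z) (fun z _ => (hk z).hasFDerivWithinAt)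
    (fun z _ => by simpa using hlip (z + e) z) (mem_univ x) (mem_univ x')

theorem norm_sub_le_of_norm_fderiv {f : E → F} (hf : Differentiable ℝ f) {C : ℝ}
    (h : ∀ x, ‖fderiv ℝ f x‖ ≤ C) (x y : E) : ‖f x - f y‖ ≤ C * ‖x - y‖ :=
  convex_univ.norm_image_sub_le_of_norm_fderiv_le (fun z _ => hf z) (fun z _ => h z)
    (mem_univ y) (mem_univ x)

/-- `f` is of class `C³`, and bounded by `C` together with its derivatives. -/
structure BoundedC3 (C : ℝ) (f : E → F) : Prop where
  contDiff : ContDiff ℝ 3 f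
  norm_le : ∀ x, ‖f x‖ ≤ C
  norm_fderiv_le : ∀ x, ‖fderiv ℝ f x‖ ≤ C
  norm_fderiv₂_le : ∀ x, ‖fderiv ℝ (fderiv ℝ f) x‖ ≤ C
  lip₂ : ∀ x y, ‖fderiv ℝ (fderiv ℝ f) x - fderiv ℝ (fderiv ℝ f) y‖ ≤ C * ‖x - y‖

namespace BoundedC3

variable {C : ℝ} {f : E → F} {h : E → E}

theorem nonneg (hf : BoundedC3 C f) : 0 ≤ C := (norm_nonneg _).trans (hf.norm_le 0)

theorem differentiable (hf : BoundedC3 C f) : Differentiable ℝ f :=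
  hf.contDiff.differentiable (by norm_num)

theorem contDiff_fderiv (hf : BoundedC3 C f) : ContDiff ℝ 2 (fderiv ℝ f) :=
  hf.contDiff.fderiv_right (by norm_num)

theorem differentiable_fderiv (hf : BoundedC3 C f) : Differentiable ℝ (fderiv ℝ f) :=
  hf.contDiff_fderiv.differentiable (by norm_num)

theorem lip (hf : BoundedC3 C f) (x y : E) : ‖f x - f y‖ ≤ C * ‖x - y‖ :=
  norm_sub_le_of_norm_fderiv hf.differentiable hf.norm_fderiv_le x y

theorem lip₁ (hf : BoundedC3 C f) (x y : E) : ‖fderiv ℝ f x - fderiv ℝ f y‖ ≤ C * ‖x - y‖ :=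
  norm_sub_le_of_norm_fderiv hf.differentiable_fderiv hf.norm_fderiv₂_le x y

theorem symm (hf : BoundedC3 C f) (x v w : E) :
    fderiv ℝ (fderiv ℝ f) x v w = fderiv ℝ (fderiv ℝ f) x w v :=
  (hf.contDiff.contDiffAt.isSymmSndFDerivAt (by simp; norm_num)) v w

theorem hasFDerivAt_apply (hf : BoundedC3 C f) {h : E → E} {h' : E →L[ℝ] E} {x : E}
    (hh : HasFDerivAt h h' x) : HasFDerivAt (fun x => fderiv ℝ f x (h x))
      ((fderiv ℝ (fderiv ℝ f) x).flip (h x) + (fderiv ℝ f x).comp h') x := by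
  have := (hf.differentiable_fderiv x).hasFDerivAt.clm_apply hh
  rwa [add_comm] at this

theorem fderiv_apply (hf : BoundedC3 C f) (hh : BoundedC3 C h) (x : E) :
    fderiv ℝ (fun x => fderiv ℝ f x (h x)) x =
      (fderiv ℝ (fderiv ℝ f) x).flip (h x) + (fderiv ℝ f x).comp (fderiv ℝ h x) :=
  (hf.hasFDerivAt_apply (hh.differentiable x).hasFDerivAt).fderiv

theorem differentiable_apply (hf : BoundedC3 C f) (hh : BoundedC3 C h) :
    Differentiable ℝ (fun x => fderiv ℝ f x (h x)) := fun x =>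
  (hf.hasFDerivAt_apply (hh.differentiable x).hasFDerivAt).differentiableAt

theorem norm_fderiv_apply_le (hf : BoundedC3 C f) (hh : BoundedC3 C h) (x : E) :
    ‖fderiv ℝ (fun x => fderiv ℝ f x (h x)) x‖ ≤ 2 * C ^ 2 := by
  have hC := hf.nonneg
  rw [hf.fderiv_apply hh]
  refine (norm_add_le _ _).trans ?_
  have h1 : ‖(fderiv ℝ (fderiv ℝ f) x).flip (h x)‖ ≤ C * C :=
    (ContinuousLinearMap.le_opNorm _ _).trans (by
      rw [ContinuousLinearMap.opNorm_flip]
      exact mul_le_mul (hf.norm_fderiv₂_le x) (hh.norm_le x) (norm_nonneg _) hC)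
  have h2 : ‖(fderiv ℝ f x).comp (fderiv ℝ h x)‖ ≤ C * C :=
    (ContinuousLinearMap.opNorm_comp_le _ _).trans
      (mul_le_mul (hf.norm_fderiv_le x) (hh.norm_fderiv_le x) (norm_nonneg _) hC)
  linarith

theorem lip_fderiv_apply (hf : BoundedC3 C f) (hh : BoundedC3 C h) (x y : E) :
    ‖fderiv ℝ (fun x => fderiv ℝ f x (h x)) x - fderiv ℝ (fun x => fderiv ℝ f x (h x)) y‖ ≤
      4 * C ^ 2 * ‖x - y‖ := by
  have hC := hf.nonneg
  rw [hf.fderiv_apply hh, hf.fderiv_apply hh]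
  have key : (fderiv ℝ (fderiv ℝ f) x).flip (h x) + (fderiv ℝ f x).comp (fderiv ℝ h x) -
      ((fderiv ℝ (fderiv ℝ f) y).flip (h y) + (fderiv ℝ f y).comp (fderiv ℝ h y)) =
      ((fderiv ℝ (fderiv ℝ f) x - fderiv ℝ (fderiv ℝ f) y).flip (h x) +
        (fderiv ℝ (fderiv ℝ f) y).flip (h x - h y)) +
      ((fderiv ℝ f x - fderiv ℝ f y).comp (fderiv ℝ h x) +
        (fderiv ℝ f y).comp (fderiv ℝ h x - fderiv ℝ h y)) := by
    ext w; simp; abel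
  rw [key]
  have n1 : ‖(fderiv ℝ (fderiv ℝ f) x - fderiv ℝ (fderiv ℝ f) y).flip (h x)‖ ≤
      C * ‖x - y‖ * C := (ContinuousLinearMap.le_opNorm _ _).trans (by
        rw [ContinuousLinearMap.opNorm_flip]
        exact mul_le_mul (hf.lip₂ x y) (hh.norm_le x) (norm_nonneg _) (by positivity))
  have n2 : ‖(fderiv ℝ (fderiv ℝ f) y).flip (h x - h y)‖ ≤ C * (C * ‖x - y‖) :=
    (ContinuousLinearMap.le_opNorm _ _).trans (by
        rw [ContinuousLinearMap.opNorm_flip]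
        exact mul_le_mul (hf.norm_fderiv₂_le y) (hh.lip x y) (norm_nonneg _) hC)
  have n3 : ‖(fderiv ℝ f x - fderiv ℝ f y).comp (fderiv ℝ h x)‖ ≤ C * ‖x - y‖ * C :=
    (ContinuousLinearMap.opNorm_comp_le _ _).trans
      (mul_le_mul (hf.lip₁ x y) (hh.norm_fderiv_le x) (norm_nonneg _) (by positivity))
  have n4 : ‖(fderiv ℝ f y).comp (fderiv ℝ h x - fderiv ℝ h y)‖ ≤ C * (C * ‖x - y‖) :=
    (ContinuousLinearMap.opNorm_comp_le _ _).trans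
      (mul_le_mul (hf.norm_fderiv_le y) (hh.lip₁ x y) (norm_nonneg _) hC)
  refine (norm_add_le _ _).trans ((add_le_add ((norm_add_le _ _).trans (add_le_add n1 n2))
    ((norm_add_le _ _).trans (add_le_add n3 n4))).trans (le_of_eq ?_))
  ring

/-- The second-order remainder of `f` along a step `v x + r` is Lipschitz in `(x, r)`. -/
theorem norm_remainder_sub_le {f : E → F} (hf : BoundedC3 C f) {v : E → E}
    (hv : Differentiable ℝ v) {K b : ℝ} (hK : 1 ≤ K) (hCK : C ≤ K) (hb : 0 ≤ b) (hbK : b ≤ K)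
    (hv0 : ∀ x, ‖v x‖ ≤ K * b) (hv1 : ∀ x, ‖fderiv ℝ v x‖ ≤ K * b) {r' : E}
    (hr' : ‖r'‖ ≤ K * b ^ 2) (x x' r : E) :
    ‖(f (x + v x + r) - f x - fderiv ℝ f x (v x)) -
      (f (x' + v x' + r') - f x' - fderiv ℝ f x' (v x'))‖ ≤
      5 * K ^ 4 * (‖x - x'‖ * b ^ 2 + ‖r - r'‖) := by
  have hC := hf.nonneg
  -- Only `r'` is known to be small, so `r` is first replaced by `r'`, at the cost of a multiple of
  -- `‖r - r'‖`. It then remains to see that `H` has derivative of order `b ^ 2`.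
  set H : E → F := fun x => f (x + v x + r') - f x - fderiv ℝ f x (v x) with hH
  have hder : ∀ x, HasFDerivAt H ((fderiv ℝ f (x + v x + r')).comp
      (ContinuousLinearMap.id ℝ E + fderiv ℝ v x) - fderiv ℝ f x -
      ((fderiv ℝ (fderiv ℝ f) x).flip (v x) + (fderiv ℝ f x).comp (fderiv ℝ v x))) x := by
    intro x
    have h1 : HasFDerivAt (fun x => x + v x + r') (ContinuousLinearMap.id ℝ E + fderiv ℝ v x) x :=
      ((hasFDerivAt_id x).add (hv x).hasFDerivAt).add_const r'
    exact (((hf.differentiable _).hasFDerivAt.comp x h1).sub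
      (hf.differentiable x).hasFDerivAt).sub (hf.hasFDerivAt_apply (hv x).hasFDerivAt)
  have hbound : ∀ x, ‖(fderiv ℝ f (x + v x + r')).comp
      (ContinuousLinearMap.id ℝ E + fderiv ℝ v x) - fderiv ℝ f x -
      ((fderiv ℝ (fderiv ℝ f) x).flip (v x) + (fderiv ℝ f x).comp (fderiv ℝ v x))‖ ≤
      4 * K ^ 4 * b ^ 2 := by
    intro x
    -- Symmetry of the second derivative turns the flipped term into `fderiv ℝ (fderiv ℝ f) x (v
    -- x)`, the linear term of the Taylor expansion of `fderiv ℝ f` along `v x`; every remaining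
    -- piece is of order `b ^ 2`.
    have key : (fderiv ℝ f (x + v x + r')).comp
        (ContinuousLinearMap.id ℝ E + fderiv ℝ v x) - fderiv ℝ f x -
        ((fderiv ℝ (fderiv ℝ f) x).flip (v x) + (fderiv ℝ f x).comp (fderiv ℝ v x)) =
        (fderiv ℝ f (x + v x + r') - fderiv ℝ f (x + v x)) +
        (fderiv ℝ f (x + v x) - fderiv ℝ f x - fderiv ℝ (fderiv ℝ f) x (v x)) +
        (fderiv ℝ f (x + v x + r') - fderiv ℝ f x).comp (fderiv ℝ v x) := by
      ext w
      simp only [sub_apply, add_apply,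
        ContinuousLinearMap.comp_apply, ContinuousLinearMap.flip_apply, map_add,
        ContinuousLinearMap.id_apply, hf.symm x w (v x)]
      abel
    rw [key]
    have n1 : ‖fderiv ℝ f (x + v x + r') - fderiv ℝ f (x + v x)‖ ≤ K * (K * b ^ 2) := by
      refine (hf.lip₁ _ _).trans ?_
      rw [add_sub_cancel_left]
      gcongr
    have n2 : ‖fderiv ℝ f (x + v x) - fderiv ℝ f x - fderiv ℝ (fderiv ℝ f) x (v x)‖ ≤
        K * (K * b) ^ 2 := by
      refine (norm_taylor_two_le hf.differentiable_fderiv hC hf.lip₂ x (v x)).trans ?_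
      have := hv0 x
      gcongr
    have n3 : ‖(fderiv ℝ f (x + v x + r') - fderiv ℝ f x).comp (fderiv ℝ v x)‖ ≤
        K * (K * b + K * b ^ 2) * (K * b) := by
      refine (ContinuousLinearMap.opNorm_comp_le _ _).trans ?_
      refine mul_le_mul ((hf.lip₁ _ _).trans ?_) (hv1 x) (norm_nonneg _) (by positivity)
      have : ‖x + v x + r' - x‖ ≤ K * b + K * b ^ 2 := by
        rw [show x + v x + r' - x = v x + r' by abel]
        exact (norm_add_le _ _).trans (add_le_add (hv0 x) hr')
      gcongr
    refine (norm_add₃_le.trans (add_le_add (add_le_add n1 n2) n3)).trans ?_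
    have p0 : 0 ≤ b ^ 2 := by positivity
    have p1 : K ^ 2 ≤ K ^ 4 := pow_le_pow_right₀ hK (by norm_num)
    have p2 : K ^ 3 ≤ K ^ 4 := pow_le_pow_right₀ hK (by norm_num)
    have p3 : K ^ 3 * b * b ^ 2 ≤ K ^ 4 * b ^ 2 := by
      have : K ^ 3 * b ≤ K ^ 4 := by
        calc K ^ 3 * b ≤ K ^ 3 * K := by gcongr
          _ = K ^ 4 := by ring
      gcongr
    nlinarith [mul_le_mul_of_nonneg_right p1 p0, mul_le_mul_of_nonneg_right p2 p0]
  have h1 : ‖H x - H x'‖ ≤ 4 * K ^ 4 * b ^ 2 * ‖x - x'‖ :=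
    convex_univ.norm_image_sub_le_of_norm_hasFDerivWithin_le
      (fun z _ => (hder z).hasFDerivWithinAt) (fun z _ => hbound z) (mem_univ x') (mem_univ x)
  have h2 : ‖f (x + v x + r) - f (x + v x + r')‖ ≤ K * ‖r - r'‖ := by
    refine (hf.lip _ _).trans ?_
    rw [add_sub_add_left_eq_sub]
    gcongr
  have h3 : (f (x + v x + r) - f x - fderiv ℝ f x (v x)) -
      (f (x' + v x' + r') - f x' - fderiv ℝ f x' (v x')) =
      (f (x + v x + r) - f (x + v x + r')) + (H x - H x') := by
    simp only [hH]; abel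
  rw [h3]
  refine (norm_add_le _ _).trans ((add_le_add h2 h1).trans ?_)
  have p1 : K ≤ 5 * K ^ 4 := by
    have := pow_le_pow_right₀ hK (show 1 ≤ 4 by norm_num)
    rw [pow_one] at this
    linarith [pow_pos (show 0 < K by linarith) 4]
  have p2 : 0 ≤ b ^ 2 * ‖x - x'‖ := by positivity
  have p3 : 0 ≤ ‖r - r'‖ := norm_nonneg _
  have p4 : 0 ≤ K ^ 4 := by positivity
  nlinarith [mul_le_mul_of_nonneg_right p1 p3, mul_nonneg p4 p2]

end BoundedC3

end Calculus

end RoughControl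

/-! ### Increments of the noise coefficient form a rough vector field -/

namespace RoughControl

theorem BoundedC3.sub {E F : Type*} [NormedAddCommGroup E] [NormedSpace ℝ E]
    [NormedAddCommGroup F] [NormedSpace ℝ F] {C : ℝ} {f g : E → F} (hf : BoundedC3 C f)
    (hg : BoundedC3 C g) : BoundedC3 (2 * C) (fun x => f x - g x) := by
  have h1 : fderiv ℝ (fun x => f x - g x) = fun x => fderiv ℝ f x - fderiv ℝ g x :=
    funext fun x => fderiv_fun_sub (hf.differentiable x) (hg.differentiable x)
  have h2 : fderiv ℝ (fderiv ℝ (fun x => f x - g x)) =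
      fun x => fderiv ℝ (fderiv ℝ f) x - fderiv ℝ (fderiv ℝ g) x := by
    rw [h1]
    exact funext fun x => fderiv_fun_sub (hf.differentiable_fderiv x) (hg.differentiable_fderiv x)
  refine ⟨hf.contDiff.sub hg.contDiff, fun x => ?_, fun x => ?_, fun x => ?_, fun x y => ?_⟩
  · refine (norm_sub_le _ _).trans ?_
    linarith [hf.norm_le x, hg.norm_le x]
  · simp only [h1]
    exact (norm_sub_le _ _).trans (by linarith [hf.norm_fderiv_le x, hg.norm_fderiv_le x])
  · rw [h2]
    refine (norm_sub_le (fderiv ℝ (fderiv ℝ f) x) (fderiv ℝ (fderiv ℝ g) x)).trans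
      (by linarith [hf.norm_fderiv₂_le x, hg.norm_fderiv₂_le x])
  · rw [h2]
    simp only
    rw [sub_sub_sub_comm]
    exact (norm_sub_le (fderiv ℝ (fderiv ℝ f) x - fderiv ℝ (fderiv ℝ f) y)
      (fderiv ℝ (fderiv ℝ g) x - fderiv ℝ (fderiv ℝ g) y)).trans
      (by linarith [hf.lip₂ x y, hg.lip₂ x y])

theorem BoundedC3.of_iteratedFDeriv {E F : Type*} [NormedAddCommGroup E] [NormedSpace ℝ E]
    [NormedAddCommGroup F] [NormedSpace ℝ F] {C : ℝ} {f : E → F} (hf : ContDiff ℝ 3 f)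
    (h0 : ∀ x, ‖iteratedFDeriv ℝ 0 f x‖ ≤ C) (h1 : ∀ x, ‖iteratedFDeriv ℝ 1 f x‖ ≤ C)
    (h2 : ∀ x, ‖iteratedFDeriv ℝ 2 f x‖ ≤ C) (h3 : ∀ x, ‖iteratedFDeriv ℝ 3 f x‖ ≤ C) :
    BoundedC3 C f := by
  have hc1 : ContDiff ℝ 2 (fderiv ℝ f) := hf.fderiv_right (by norm_num)
  have hc2 : ContDiff ℝ 1 (fderiv ℝ (fderiv ℝ f)) := hc1.fderiv_right (by norm_num)
  refine ⟨hf, fun x => ?_, fun x => ?_, fun x => ?_, norm_sub_le_of_norm_fderiv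
    (hc2.differentiable (by norm_num)) fun x => ?_⟩
  · rw [← norm_iteratedFDeriv_zero (𝕜 := ℝ) (f := f)]
    exact h0 x
  · rw [← norm_iteratedFDeriv_one]
    exact h1 x
  · rw [← norm_iteratedFDeriv_one, norm_iteratedFDeriv_fderiv]
    exact h2 x
  · rw [← norm_iteratedFDeriv_one, norm_iteratedFDeriv_fderiv, norm_iteratedFDeriv_fderiv]
    exact h3 x

variable {m d : ℕ}

theorem exists_uniform_bound {P : Fin d → ℝ → Prop} (hmono : ∀ j a b, a ≤ b → P j a → P j b)
    (h : ∀ j, ∃ a, P j a) (B : ℝ) : ∃ K, 1 ≤ K ∧ B ≤ K ∧ ∀ j, P j K := by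
  choose c hc using h
  have hs : 0 ≤ ∑ j, |c j| := Finset.sum_nonneg fun j _ => abs_nonneg _
  refine ⟨1 + |B| + ∑ j, |c j|, by linarith [abs_nonneg B], by linarith [le_abs_self B],
    fun j => hmono j (c j) _ ?_ (hc j)⟩
  have := Finset.single_le_sum (fun j _ => abs_nonneg (c j)) (Finset.mem_univ j)
  linarith [le_abs_self (c j), abs_nonneg B]

theorem BoundedC3.mono {E F : Type*} [NormedAddCommGroup E] [NormedSpace ℝ E]
    [NormedAddCommGroup F] [NormedSpace ℝ F] {C C' : ℝ} {f : E → F} (hf : BoundedC3 C f)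
    (h : C ≤ C') : BoundedC3 C' f :=
  ⟨hf.contDiff, fun x => (hf.norm_le x).trans h, fun x => (hf.norm_fderiv_le x).trans h,
    fun x => (hf.norm_fderiv₂_le x).trans h, fun x y => (hf.lip₂ x y).trans (by gcongr)⟩

theorem IsNoiseCoeff.exists_bound {T : ℝ} {σ : Fin d → ℝ → Vec m → Vec m}
    (hσ : IsNoiseCoeff T σ) (B : ℝ) : ∃ K, 1 ≤ K ∧ B ≤ K ∧ ∀ j,
      (∀ t ∈ Icc 0 T, BoundedC3 K (σ j t)) ∧
      ∀ s ∈ Icc 0 T, ∀ t ∈ Icc 0 T, ∀ x, ‖σ j t x - σ j s x‖ ≤ K * |t - s| := by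
  refine exists_uniform_bound (fun j a b hab h => ⟨fun t ht => (h.1 t ht).mono hab,
    fun s hs t ht x => (h.2 s hs t ht x).trans (by gcongr)⟩) (fun j => ?_) B
  obtain ⟨c0, h0⟩ := hσ.bounded j 0 (by norm_num)
  obtain ⟨c1, h1⟩ := hσ.bounded j 1 (by norm_num)
  obtain ⟨c2, h2⟩ := hσ.bounded j 2 (by norm_num)
  obtain ⟨c3, h3⟩ := hσ.bounded j 3 (by norm_num)
  obtain ⟨D, -, ⟨c4, h4⟩, hD⟩ := hσ.time_deriv j
  have hle : ∀ c ∈ [c0, c1, c2, c3, c4], c ≤ |c0| + |c1| + |c2| + |c3| + |c4| := by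
    have a0 := abs_nonneg c0
    have a1 := abs_nonneg c1
    have a2 := abs_nonneg c2
    have a3 := abs_nonneg c3
    have a4 := abs_nonneg c4
    intro c hc
    simp only [List.mem_cons, List.not_mem_nil, or_false] at hc
    rcases hc with rfl | rfl | rfl | rfl | rfl <;> linarith [le_abs_self c]
  refine ⟨|c0| + |c1| + |c2| + |c3| + |c4|, fun t ht => ?_, fun s hs t ht x => ?_⟩
  · refine BoundedC3.of_iteratedFDeriv (hσ.contDiff j t ht) (fun x => ?_) (fun x => ?_)
      (fun x => ?_) (fun x => ?_)
    · exact (h0 t ht x).trans (hle _ (by simp))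
    · exact (h1 t ht x).trans (hle _ (by simp))
    · exact (h2 t ht x).trans (hle _ (by simp))
    · exact (h3 t ht x).trans (hle _ (by simp))
  · rw [← Real.norm_eq_abs (t - s)]
    exact (convex_Icc 0 T).norm_image_sub_le_of_norm_hasDerivWithin_le
      (fun r hr => hD r hr x) (fun r hr => (h4 r hr x).trans (hle _ (by simp))) hs ht

/-- The increment of the noise coefficient over the path `x`. -/
def incr (σ : Fin d → ℝ → Vec m → Vec m) (x : ℝ → Vec m) (j : Fin d) (s : ℝ) (e : Vec m) : Vec m :=
  σ j s (x s + e) - σ j s (x s)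

/-- The increment over the path `x` of the Gubinelli derivative of the noise coefficient. -/
noncomputable def incr' (σ : Fin d → ℝ → Vec m → Vec m) (x : ℝ → Vec m) (j i : Fin d) (s : ℝ)
    (e : Vec m) : Vec m :=
  fderiv ℝ (σ j s) (x s + e) (σ i s (x s + e)) - fderiv ℝ (σ j s) (x s) (σ i s (x s))

/-- Here `a` plays the role of `(u - s) ^ (1/3)`. Lipschitz dependence on time gives only sup bounds
of order `a ^ 3`; interpolation against three bounded space derivatives converts them into Lipschitz
constants of order `a ^ 2` for the coefficient and `a` for its Gubinelli derivative. No mixed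
derivative in time and space is required. -/
theorem norm_time_increment_le {K a : ℝ} {f f' h h' : Vec m → Vec m} (hK : 1 ≤ K) (ha : 0 ≤ a)
    (haK : a ≤ K) (hf : BoundedC3 K f) (hf' : BoundedC3 K f') (hh : BoundedC3 K h)
    (hh' : BoundedC3 K h') (hff' : ∀ x, ‖f' x - f x‖ ≤ K * a ^ 3)
    (hhh' : ∀ x, ‖h' x - h x‖ ≤ K * a ^ 3) :
    (∀ x y, ‖(f' x - f x) - (f' y - f y)‖ ≤ 4 * K * a ^ 2 * ‖x - y‖) ∧
    ∀ x y, ‖(fderiv ℝ f' x (h' x) - fderiv ℝ f x (h x)) -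
      (fderiv ℝ f' y (h' y) - fderiv ℝ f y (h y))‖ ≤ 3 * (8 * K ^ 2 + K ^ 3) * a * ‖x - y‖ := by
  have hg := hf'.sub hf
  have hD : ∀ x, ‖fderiv ℝ (fun x => f' x - f x) x‖ ≤ 4 * K * a ^ 2 := fun x => by
    have := norm_fderiv_le_of_lipschitz₂ hg.differentiable hg.differentiable_fderiv hg.nonneg ha
      hg.lip₂ (fun x => (hff' x).trans (by
        have : 0 ≤ a ^ 3 := by positivity
        nlinarith)) x
    linarith
  refine ⟨norm_sub_le_of_norm_fderiv hg.differentiable hD, ?_⟩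
  have hd1 := hf'.differentiable_apply hh'
  have hd2 := hf.differentiable_apply hh
  have heq : ∀ x, fderiv ℝ (fun x => fderiv ℝ f' x (h' x) - fderiv ℝ f x (h x)) x =
      fderiv ℝ (fun x => fderiv ℝ f' x (h' x)) x - fderiv ℝ (fun x => fderiv ℝ f x (h x)) x :=
    fun x => fderiv_fun_sub (hd1 x) (hd2 x)
  refine norm_sub_le_of_norm_fderiv (hd1.sub hd2) ?_
  -- The constant `8 * K ^ 2 + K ^ 3` dominates both the Lipschitz constant `8 * K ^ 2` of the
  -- derivative and the factor `4 * K ^ 2 + K ^ 3` of `a ^ 2` in the sup bound.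
  refine norm_fderiv_le_of_lipschitz (hd1.sub hd2) (by positivity) ha ?_ ?_
  · intro x y
    have e1 := hf'.lip_fderiv_apply hh' x y
    have e2 := hf.lip_fderiv_apply hh x y
    have : fderiv ℝ ((fun x => fderiv ℝ f' x (h' x)) - fun x => fderiv ℝ f x (h x)) =
      fderiv ℝ (fun x => fderiv ℝ f' x (h' x) - fderiv ℝ f x (h x)) := rfl
    rw [this, heq, heq, sub_sub_sub_comm]
    refine (norm_sub_le _ _).trans ?_
    have : 0 ≤ K ^ 3 * ‖x - y‖ := by positivity
    nlinarith
  · intro x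
    have e1 : fderiv ℝ (fun x => f' x - f x) x = fderiv ℝ f' x - fderiv ℝ f x :=
      fderiv_fun_sub (hf'.differentiable x) (hf.differentiable x)
    have e2 : ((fun x => fderiv ℝ f' x (h' x)) - fun x => fderiv ℝ f x (h x)) x =
        fderiv ℝ (fun x => f' x - f x) x (h' x) + fderiv ℝ f x (h' x - h x) := by
      rw [e1]
      simp
    rw [e2]
    have n1 : ‖fderiv ℝ (fun x => f' x - f x) x (h' x)‖ ≤ 4 * K * a ^ 2 * K :=
      (ContinuousLinearMap.le_opNorm _ _).trans
        (mul_le_mul (hD x) (hh'.norm_le x) (norm_nonneg _) (by positivity))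
    have n2 : ‖fderiv ℝ f x (h' x - h x)‖ ≤ K * (K * a ^ 3) :=
      (ContinuousLinearMap.le_opNorm _ _).trans
        (mul_le_mul (hf.norm_fderiv_le x) (hhh' x) (norm_nonneg _) (by positivity))
    refine (norm_add_le _ _).trans ((add_le_add n1 n2).trans ?_)
    have : K ^ 2 * a ^ 2 * a ≤ K ^ 2 * a ^ 2 * K := by gcongr
    have : 0 ≤ K ^ 2 * a ^ 2 := by positivity
    nlinarith

/-- Increments over `x` vanish at zero, which makes all the bounds linear. For `step`, the change of
the coefficient in time is `norm_time_increment_le`, and the rest, with time frozen at `s`, compares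
the Taylor remainders of `σ j s` along the two steps `x s → x u` and `x s + e → x u + e'`. -/
theorem IsNoiseCoeff.roughField {T κ C₀ : ℝ} {ζ : ℝ → Vec d} {A : ℝ → ℝ → Fin d → Fin d → ℝ}
    {σ : Fin d → ℝ → Vec m → Vec m} (hσ : IsNoiseCoeff T σ) (hκ : 1 / 3 < κ) (hC₀ : 0 ≤ C₀)
    (hT : 0 ≤ T)
    (hζ : ∀ s t, 0 ≤ s → s ≤ t → t ≤ T → ∀ j, |ζ t j - ζ s j| ≤ C₀ * (t - s) ^ κ)
    (hA : ∀ s t, 0 ≤ s → s ≤ t → t ≤ T → ∀ i j, |A s t i j| ≤ C₀ * (t - s) ^ (2 * κ))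
    (hchen : ∀ s u t, 0 ≤ s → s ≤ u → u ≤ t → t ≤ T → ∀ i j,
      A s t i j - A s u i j - A u t i j = (ζ u i - ζ s i) * (ζ t j - ζ u j))
    {x : ℝ → Vec m}
    (hx : ∀ s t, 0 ≤ s → s ≤ t → t ≤ T → ‖x t - x s‖ ≤ C₀ * (t - s) ^ (1 / 3 : ℝ))
    (hx' : ∀ s t, 0 ≤ s → s ≤ t → t ≤ T →
      ‖x t - x s - ∑ j, (ζ t j - ζ s j) • σ j s (x s)‖ ≤ C₀ * (t - s) ^ (2 / 3 : ℝ)) :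
    ∃ C, RoughField T κ C ζ A (incr σ x) (incr' σ x) := by
  obtain ⟨K, hK1, hKB, hK⟩ := hσ.exists_bound (T ^ (1 / 3 : ℝ))
  set b : ℝ := T ^ (κ - 1 / 3) with hb
  have hb0 : 0 ≤ b := Real.rpow_nonneg hT _
  set K' : ℝ := K + C₀ + d * (C₀ * b * K) with hK'
  have hx0 : 0 ≤ d * (C₀ * b * K) := by positivity
  have hKK' : K ≤ K' := by linarith
  have hK'0 : 0 ≤ K' := by linarith
  set C₁ : ℝ := 4 * K * (1 + K' ^ 2) + 5 * K' ^ 4 with hC₁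
  set C₂ : ℝ := 4 * K * K ^ 2 + 5 * K' ^ 4 with hC₂
  set C₃ : ℝ := 3 * (8 * K ^ 2 + K ^ 3) + 4 * K ^ 2 * C₀ with hC₃
  have hC₁0 : 0 ≤ C₁ := by positivity
  have hC₂0 : 0 ≤ C₂ := by positivity
  have hC₃0 : 0 ≤ C₃ := by positivity
  have hK2 : 0 ≤ K ^ 2 := by positivity
  set C : ℝ := C₀ + K + 2 * K ^ 2 + C₁ + C₂ + C₃ with hC
  have hpow : ∀ s u, 0 ≤ s → s ≤ u → u ≤ T → 0 ≤ (u - s) ^ (1 / 3 : ℝ) ∧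
      (u - s) ^ (1 / 3 : ℝ) ≤ K ∧ (u - s) ^ (2 / 3 : ℝ) = ((u - s) ^ (1 / 3 : ℝ)) ^ 2 ∧
      |u - s| = ((u - s) ^ (1 / 3 : ℝ)) ^ 3 ∧ (u - s) ^ κ ≤ b * (u - s) ^ (1 / 3 : ℝ) := by
    intro s u hs hsu hu
    have h0 : 0 ≤ u - s := sub_nonneg.2 hsu
    refine ⟨Real.rpow_nonneg h0 _, (Real.rpow_le_rpow h0 (by linarith) (by norm_num)).trans hKB,
      ?_, ?_, ?_⟩
    · rw [← Real.rpow_natCast, ← Real.rpow_mul h0]; norm_num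
    · rw [← Real.rpow_natCast, ← Real.rpow_mul h0, abs_of_nonneg h0]; norm_num
    · have hk : (u - s) ^ κ = (u - s) ^ (κ - 1 / 3) * (u - s) ^ (1 / 3 : ℝ) := by
        rw [← Real.rpow_add_of_nonneg h0 (by linarith) (by norm_num)]
        congr 1
        ring
      rw [hk]
      have : (u - s) ^ (κ - 1 / 3) ≤ b := Real.rpow_le_rpow h0 (by linarith) (by linarith)
      have := Real.rpow_nonneg h0 (1 / 3)
      gcongr
  refine ⟨C, ⟨by positivity, ?_, ?_, hchen, fun s _ j => by simp [incr],
    fun s _ j i => by simp [incr'], ?_, ?_, ?_, ?_⟩⟩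
  · intro s t hs hst ht j
    refine (hζ s t hs hst ht j).trans ?_
    have := Real.rpow_nonneg (sub_nonneg.2 hst) κ
    gcongr
    linarith
  · intro s t hs hst ht i j
    refine (hA s t hs hst ht i j).trans ?_
    have := Real.rpow_nonneg (sub_nonneg.2 hst) (2 * κ)
    gcongr
    linarith
  · intro s hs j e e'
    have := ((hK j).1 s hs).lip (x s + e) (x s + e')
    rw [add_sub_add_left_eq_sub] at this
    simp only [incr, sub_sub_sub_cancel_right]
    refine this.trans ?_
    gcongr
    linarith
  · intro s hs j i e e'
    have := norm_sub_le_of_norm_fderiv (((hK j).1 s hs).differentiable_apply ((hK i).1 s hs))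
      (((hK j).1 s hs).norm_fderiv_apply_le ((hK i).1 s hs)) (x s + e) (x s + e')
    rw [add_sub_add_left_eq_sub] at this
    simp only [incr', sub_sub_sub_cancel_right]
    refine this.trans ?_
    gcongr
    linarith
  · intro s u hs hsu hu j e e'
    obtain ⟨ha0, haK, ha2, ha3, haκ⟩ := hpow s u hs hsu hu
    have hsT : s ∈ Icc 0 T := ⟨hs, by linarith⟩
    have huT : u ∈ Icc 0 T := ⟨by linarith, hu⟩
    have hxx' := hx' s u hs hsu hu
    set a := (u - s) ^ (1 / 3 : ℝ) with ha
    rw [ha2] at hxx' ⊢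
    set y := e' - e - ∑ i, (ζ u i - ζ s i) • incr σ x i s e with hy
    let v : Vec m → Vec m := fun z => ∑ i, (ζ u i - ζ s i) • σ i s z
    have hZ : ∀ i, |ζ u i - ζ s i| ≤ C₀ * (b * a) := fun i =>
      (hζ s u hs hsu hu i).trans (by gcongr)
    have hv : ∀ z, HasFDerivAt v (∑ i, (ζ u i - ζ s i) • fderiv ℝ (σ i s) z) z := fun z =>
      HasFDerivAt.fun_sum fun i _ => (((hK i).1 s hsT).differentiable z).hasFDerivAt.fun_const_smul _
    have hva : d * (C₀ * (b * a) * K) ≤ K' * a := by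
      have : d * (C₀ * (b * a) * K) = d * (C₀ * b * K) * a := by ring
      rw [this]
      gcongr
      linarith
    -- Both steps have the form `z ↦ z + v z + r`; the difference of their remainders `r` is exactly
    -- `y`.
    have hrem := BoundedC3.norm_remainder_sub_le ((hK j).1 s hsT) (fun z => (hv z).differentiableAt)
      (K := K') (b := a) (by linarith) hKK' ha0 (by linarith)
      (fun z => (norm_sum_smul_le (by positivity) hZ
        (fun i => ((hK i).1 s hsT).norm_le z)).trans hva)
      (fun z => by
        rw [(hv z).fderiv]
        exact (norm_sum_smul_le (by positivity) hZ
          (fun i => ((hK i).1 s hsT).norm_fderiv_le z)).trans hva)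
      (r' := x u - (x s + v (x s))) (by
        rw [← sub_sub]
        exact hxx'.trans (by gcongr; linarith)) (x s + e) (x s)
      (x u + e' - (x s + e + v (x s + e)))
    rw [add_sub_cancel, add_sub_cancel, add_sub_cancel_left] at hrem
    have hry : x u + e' - (x s + e + v (x s + e)) - (x u - (x s + v (x s))) = y := by
      simp only [hy, v, incr, smul_sub, Finset.sum_sub_distrib]
      abel
    rw [hry] at hrem
    have hti := (norm_time_increment_le hK1 ha0 haK ((hK j).1 s hsT) ((hK j).1 u huT)
      ((hK j).1 s hsT) ((hK j).1 u huT)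
      (fun z => by rw [← ha3]; exact (hK j).2 s hsT u huT z)
      (fun z => by rw [← ha3]; exact (hK j).2 s hsT u huT z)).1 (x u + e') (x u)
    rw [add_sub_cancel_left] at hti
    -- The time increment was taken at `e'`, while the axiom `step` allows only `‖e‖` and `‖y‖` on
    -- the right.
    have he' : ‖e'‖ ≤ (1 + K' ^ 2) * ‖e‖ + ‖y‖ := by
      have h1 : e' = e + y + ∑ i, (ζ u i - ζ s i) • incr σ x i s e := by simp only [hy]; abel
      have h2 := norm_sum_smul_le (E := Vec m) (v := K * ‖e‖) (mul_nonneg hC₀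
        (Real.rpow_nonneg (sub_nonneg.2 hsu) κ)) (fun i => (hζ s u hs hsu hu i)) (fun i => by
          have := ((hK i).1 s hsT).lip (x s + e) (x s)
          rw [add_sub_cancel_left] at this
          exact this)
      have h3 : d * (C₀ * (u - s) ^ κ * (K * ‖e‖)) ≤ K' ^ 2 * ‖e‖ := by
        have h4 : d * (C₀ * (b * a) * K) ≤ K' ^ 2 := by
          rw [pow_two]
          exact hva.trans (mul_le_mul_of_nonneg_left (haK.trans hKK') hK'0)
        calc d * (C₀ * (u - s) ^ κ * (K * ‖e‖)) ≤ d * (C₀ * (b * a) * (K * ‖e‖)) := by gcongr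
          _ = d * (C₀ * (b * a) * K) * ‖e‖ := by ring
          _ ≤ _ := by gcongr
      have h5 : ‖e'‖ ≤ ‖e‖ + ‖y‖ + ‖∑ i, (ζ u i - ζ s i) • incr σ x i s e‖ := by
        conv_lhs => rw [h1]
        exact norm_add₃_le
      have h6 := h2.trans h3
      simp only [incr] at h5
      linarith
    have key : incr σ x j u e' - incr σ x j s e - ∑ i, (ζ u i - ζ s i) • incr' σ x j i s e =
        ((σ j u (x u + e') - σ j s (x u + e')) - (σ j u (x u) - σ j s (x u))) +
        ((σ j s (x u + e') - σ j s (x s + e) - fderiv ℝ (σ j s) (x s + e) (v (x s + e))) -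
          (σ j s (x u) - σ j s (x s) - fderiv ℝ (σ j s) (x s) (v (x s)))) := by
      simp only [incr, incr', v, map_sum, map_smul, smul_sub, Finset.sum_sub_distrib]
      abel
    rw [key]
    refine (norm_add_le _ _).trans ((add_le_add hti hrem).trans ?_)
    have q1 : 4 * K * a ^ 2 * ‖e'‖ ≤ 4 * K * a ^ 2 * ((1 + K' ^ 2) * ‖e‖ + ‖y‖) := by gcongr
    have q2 : 4 * K * a ^ 2 * ‖y‖ ≤ 4 * K * K ^ 2 * ‖y‖ := by gcongr
    have q3 : C₁ * (‖e‖ * a ^ 2) ≤ C * (‖e‖ * a ^ 2) := by gcongr; linarith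
    have q4 : C₂ * ‖y‖ ≤ C * ‖y‖ := by gcongr; linarith
    calc _ ≤ 4 * K * a ^ 2 * ((1 + K' ^ 2) * ‖e‖ + ‖y‖) + 5 * K' ^ 4 * (‖e‖ * a ^ 2 + ‖y‖) := by
          linarith
      _ ≤ C₁ * (‖e‖ * a ^ 2) + C₂ * ‖y‖ := by simp only [hC₁, hC₂]; linarith
      _ ≤ _ := by linarith
  · intro s u hs hsu hu j i e e'
    obtain ⟨ha0, haK, ha2, ha3, haκ⟩ := hpow s u hs hsu hu
    have hsT : s ∈ Icc 0 T := ⟨hs, by linarith⟩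
    have huT : u ∈ Icc 0 T := ⟨by linarith, hu⟩
    have hxx := hx s u hs hsu hu
    set a := (u - s) ^ (1 / 3 : ℝ) with ha
    have n1 := norm_sub_le_of_norm_fderiv (((hK j).1 u huT).differentiable_apply ((hK i).1 u huT))
      (((hK j).1 u huT).norm_fderiv_apply_le ((hK i).1 u huT)) (x u + e') (x u + e)
    have n2 := (norm_time_increment_le hK1 ha0 haK ((hK j).1 s hsT) ((hK j).1 u huT)
      ((hK i).1 s hsT) ((hK i).1 u huT)
      (fun z => by rw [← ha3]; exact (hK j).2 s hsT u huT z)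
      (fun z => by rw [← ha3]; exact (hK i).2 s hsT u huT z)).2 (x u + e) (x u)
    have n3 := norm_four_point_le (((hK j).1 s hsT).differentiable_apply ((hK i).1 s hsT))
      (((hK j).1 s hsT).lip_fderiv_apply ((hK i).1 s hsT)) (x s) (x u) e
    rw [add_sub_add_left_eq_sub] at n1
    rw [add_sub_cancel_left] at n2
    have key : incr' σ x j i u e' - incr' σ x j i s e =
        (fderiv ℝ (σ j u) (x u + e') (σ i u (x u + e')) -
          fderiv ℝ (σ j u) (x u + e) (σ i u (x u + e))) +
        ((fderiv ℝ (σ j u) (x u + e) (σ i u (x u + e)) -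
          fderiv ℝ (σ j s) (x u + e) (σ i s (x u + e))) -
          (fderiv ℝ (σ j u) (x u) (σ i u (x u)) - fderiv ℝ (σ j s) (x u) (σ i s (x u)))) +
        ((fderiv ℝ (σ j s) (x u + e) (σ i s (x u + e)) - fderiv ℝ (σ j s) (x u) (σ i s (x u))) -
          (fderiv ℝ (σ j s) (x s + e) (σ i s (x s + e)) -
            fderiv ℝ (σ j s) (x s) (σ i s (x s)))) := by
      simp only [incr']; abel
    rw [key]
    refine norm_add₃_le.trans ((add_le_add (add_le_add n1 n2) n3).trans ?_)
    have q1 : 4 * K ^ 2 * ‖e‖ * ‖x u - x s‖ ≤ 4 * K ^ 2 * ‖e‖ * (C₀ * a) := by gcongr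
    have q3 : C₃ * (‖e‖ * a) ≤ C * (‖e‖ * a) := by gcongr; linarith
    have q4 : 2 * K ^ 2 * ‖e' - e‖ ≤ C * ‖e' - e‖ := by gcongr; linarith
    calc _ ≤ C₃ * (‖e‖ * a) + 2 * K ^ 2 * ‖e' - e‖ := by simp only [hC₃]; linarith
      _ ≤ _ := by linarith

end RoughControl

/-! ### Solutions with linear growth -/

namespace RoughControl

theorem rpow_le_mul_rpow {τ T a b : ℝ} (h0 : 0 ≤ τ) (h1 : τ ≤ T) (ha : 0 ≤ a) (hab : a ≤ b) :
    τ ^ b ≤ T ^ (b - a) * τ ^ a := by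
  have hk : τ ^ b = τ ^ (b - a) * τ ^ a := by
    rw [← Real.rpow_add_of_nonneg h0 (by linarith) ha]
    congr 1
    ring
  rw [hk]
  have := Real.rpow_le_rpow h0 h1 (sub_nonneg.2 hab)
  have := Real.rpow_nonneg h0 a
  gcongr

theorem continuousOn_of_norm_sub_le_rpow {E : Type*} [NormedAddCommGroup E] {T κ C : ℝ}
    {z : ℝ → E} (hκ : 0 < κ)
    (h : ∀ s t, 0 ≤ s → s ≤ t → t ≤ T → ‖z t - z s‖ ≤ C * (t - s) ^ κ) :
    ContinuousOn z (Icc 0 T) := by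
  have h' : ∀ s ∈ Icc 0 T, ∀ t ∈ Icc 0 T, ‖z t - z s‖ ≤ C * |t - s| ^ κ := by
    intro s hs t ht
    rcases le_total s t with hst | hst
    · rw [abs_of_nonneg (sub_nonneg.2 hst)]; exact h s t hs.1 hst ht.2
    · rw [abs_sub_comm, abs_of_nonneg (sub_nonneg.2 hst), norm_sub_rev]
      exact h t s ht.1 hst hs.2
  intro s hs
  rw [ContinuousWithinAt, tendsto_iff_norm_sub_tendsto_zero]
  have hc : ContinuousWithinAt (fun t => C * |t - s| ^ κ) (Icc 0 T) s := by
    have : Continuous fun t : ℝ => C * |t - s| ^ κ :=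
      continuous_const.mul ((by fun_prop : Continuous fun t : ℝ => |t - s|).rpow_const
        fun _ => Or.inr hκ.le)
    exact this.continuousWithinAt
  rw [ContinuousWithinAt, sub_self, abs_zero, Real.zero_rpow hκ.ne', mul_zero] at hc
  exact squeeze_zero' (Filter.Eventually.of_forall fun _ => norm_nonneg _)
    (eventually_nhdsWithin_of_forall fun t ht => h' s hs t ht) hc

variable {E : Type*} [NormedAddCommGroup E] [NormedSpace ℝ E]

/-- `δ` solves `dδ = D(r, δ) dr + φ(r, δ) dζ` with quantitative bounds which are linear in the
value of `δ` at any earlier time and in the size of `D(·, 0)`. -/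
structure LinearGrowthSolution {d : ℕ} (T κ Λ : ℝ) (ζ : ℝ → Vec d)
    (A : ℝ → ℝ → Fin d → Fin d → ℝ) (φ : Fin d → ℝ → E → E) (ψ : Fin d → Fin d → ℝ → E → E)
    (D : ℝ → E → E) (δ : ℝ → E) : Prop where
  zero : δ 0 = 0
  continuousOn : ContinuousOn δ (Icc 0 T)
  norm_le : ∀ u t c, 0 ≤ u → u ≤ t → t ≤ T → 0 ≤ c → (∀ r ∈ Ioc u t, ‖D r 0‖ ≤ c) →
    ‖δ t‖ ≤ Λ * (‖δ u‖ + c)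
  holder : ∀ u s t c, 0 ≤ u → u ≤ s → s ≤ t → t ≤ T → 0 ≤ c → (∀ r ∈ Ioc u t, ‖D r 0‖ ≤ c) →
    ‖δ t - δ s‖ ≤ Λ * (‖δ u‖ + c) * (t - s) ^ κ
  remainder : ∀ u s t c, 0 ≤ u → u ≤ s → s ≤ t → t ≤ T → 0 ≤ c →
    (∀ r ∈ Ioc u t, ‖D r 0‖ ≤ c) →
    ‖δ t - δ s - ∑ j, (ζ t j - ζ s j) • φ j s (δ s)‖ ≤ Λ * (‖δ u‖ + c) * (t - s) ^ (2 * κ)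
  expansion : ∀ u s t c, 0 ≤ u → u ≤ s → s ≤ t → t ≤ T → 0 ≤ c →
    (∀ r ∈ Ioc u t, ‖D r 0‖ ≤ c) →
    ‖δ t - δ s - (∫ r in s..t, D r (δ r)) - noise ζ A φ ψ s t (δ s)‖ ≤
      Λ * (‖δ u‖ + c) * (t - s) ^ (κ + 2 / 3)

/-- The Hölder bound and the first-order remainder follow from the expansion with frozen drift by
estimating the surplus terms. The Hölder bound also supplies the continuity of `δ`, which
compactness alone does not give. Only then does the integral of `D r (δ r)` make sense; unfreezing
the drift costs order `κ + 1`. -/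
theorem RoughField.exists_linearGrowthSolution [ProperSpace E] {d : ℕ} {T κ C : ℝ} {ζ : ℝ → Vec d}
    {A : ℝ → ℝ → Fin d → Fin d → ℝ} {φ : Fin d → ℝ → E → E} {ψ : Fin d → Fin d → ℝ → E → E}
    (h : RoughField T κ C ζ A φ ψ) (hκ : 1 / 3 < κ) (hκ' : κ ≤ 1 / 2) (hT : 0 ≤ T) {L : ℝ}
    (hL : 0 ≤ L) : ∃ Λ, 0 ≤ Λ ∧ ∀ D, LipschitzDrift T L D →
      (∀ z, ContinuousOn z (Icc 0 T) → IntervalIntegrable (fun r => D r (z r)) volume 0 T) →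
      ∀ c₀, (∀ r ∈ Icc 0 T, ‖D r 0‖ ≤ c₀) → ∃ δ, LinearGrowthSolution T κ Λ ζ A φ ψ D δ := by
  obtain ⟨Λ, hΛ, hex⟩ := h.exists_solution hκ hκ' hT hL
  have hC := h.nonneg
  set C₁ : ℝ := Λ * T ^ (κ + 2 / 3 - κ) + (L * Λ + 1) * T ^ (1 - κ) +
    (d * C ^ 2 + d ^ 2 * C ^ 2 * T ^ (2 * κ - κ)) * Λ with hC₁
  set C₂ : ℝ := Λ * T ^ (κ + 2 / 3 - 2 * κ) + (L * Λ + 1) * T ^ (1 - 2 * κ) + d ^ 2 * C ^ 2 * Λ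
    with hC₂
  set C₃ : ℝ := Λ + L * C₁ * T ^ (κ + 1 - (κ + 2 / 3)) with hC₃
  have hp : ∀ a : ℝ, 0 ≤ T ^ a := fun a => Real.rpow_nonneg hT a
  have hC₁0 : 0 ≤ C₁ := by have := hp; positivity
  have hC₂0 : 0 ≤ C₂ := by have := hp; positivity
  have hC₃0 : 0 ≤ C₃ := by have := hp; positivity
  refine ⟨Λ + C₁ + C₂ + C₃, by positivity, fun D hD hcar c₀ hc₀ => ?_⟩
  obtain ⟨δ, hδ0, hδ⟩ := hex D hD c₀ hc₀
  have hc₀0 : 0 ≤ c₀ := (norm_nonneg _).trans (hc₀ 0 ⟨le_rfl, hT⟩)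
  have hs : ∀ u s c, 0 ≤ u → u ≤ s → s ≤ T → 0 ≤ c → (∀ r ∈ Ioc u s, ‖D r 0‖ ≤ c) →
      ‖δ s‖ ≤ Λ * (‖δ u‖ + c) := fun u s c hu hus hsT hc hDc =>
    (hδ u s s c hu hus le_rfl hsT hc hDc).1
  have hint : ∀ u s t c, 0 ≤ u → u ≤ s → s ≤ t → t ≤ T → 0 ≤ c →
      (∀ r ∈ Ioc u t, ‖D r 0‖ ≤ c) →
      ‖∫ r in s..t, D r (δ s)‖ ≤ (L * Λ + 1) * (‖δ u‖ + c) * (t - s) := by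
    intro u s t c hu hus hst ht hc hDc
    have h1 := hs u s c hu hus (by linarith) hc fun r hr => hDc r ⟨hr.1, hr.2.trans hst⟩
    refine (intervalIntegral.norm_integral_le_of_norm_le_const
      (C := (L * Λ + 1) * (‖δ u‖ + c)) fun r hr => ?_).trans
      (by rw [abs_of_nonneg (sub_nonneg.2 hst)])
    rw [uIoc_of_le hst] at hr
    have h2 := hD.norm_le ⟨by linarith [hr.1], hr.2.trans ht⟩
      (hDc r ⟨hus.trans_lt hr.1, hr.2⟩) (δ s)
    have h3 := mul_le_mul_of_nonneg_left h1 hL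
    have := norm_nonneg (δ u)
    linarith
  have hhol : ∀ u s t c, 0 ≤ u → u ≤ s → s ≤ t → t ≤ T → 0 ≤ c →
      (∀ r ∈ Ioc u t, ‖D r 0‖ ≤ c) → ‖δ t - δ s‖ ≤ C₁ * (‖δ u‖ + c) * (t - s) ^ κ := by
    intro u s t c hu hus hst ht hc hDc
    have hτ0 : 0 ≤ t - s := sub_nonneg.2 hst
    have hτT : t - s ≤ T := by linarith
    have h1 := hs u s c hu hus (by linarith) hc fun r hr => hDc r ⟨hr.1, hr.2.trans hst⟩
    have h2 := hint u s t c hu hus hst ht hc hDc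
    have h3 := (hδ u s t c hu hus hst ht hc hDc).2
    have h4 := h.norm_noise_le (by linarith) hst ht (δ s)
    set N := ‖δ u‖ + c with hN
    have hN0 : 0 ≤ N := by positivity
    have p1 := rpow_le_mul_rpow hτ0 hτT (a := κ) (b := κ + 2 / 3) (by linarith) (by linarith)
    have p2 := rpow_le_mul_rpow hτ0 hτT (a := κ) (b := 1) (by linarith) (by linarith)
    have p3 := rpow_le_mul_rpow hτ0 hτT (a := κ) (b := 2 * κ) (by linarith) (by linarith)
    rw [Real.rpow_one] at p2
    have p4 := Real.rpow_nonneg hτ0 κ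
    have p5 := Real.rpow_nonneg hτ0 (2 * κ)
    have h5 : δ t - δ s = (δ t - δ s - (∫ r in s..t, D r (δ s)) - noise ζ A φ ψ s t (δ s)) +
        (∫ r in s..t, D r (δ s)) + noise ζ A φ ψ s t (δ s) := by abel
    calc ‖δ t - δ s‖ ≤ Λ * N * (t - s) ^ (κ + 2 / 3) + (L * Λ + 1) * N * (t - s) +
          (d * C ^ 2 * (t - s) ^ κ + d ^ 2 * C ^ 2 * (t - s) ^ (2 * κ)) * ‖δ s‖ := by
          rw [h5]; exact norm_add₃_le.trans (by gcongr)
      _ ≤ Λ * N * (T ^ (κ + 2 / 3 - κ) * (t - s) ^ κ) +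
          (L * Λ + 1) * N * (T ^ (1 - κ) * (t - s) ^ κ) +
          (d * C ^ 2 * (t - s) ^ κ + d ^ 2 * C ^ 2 * (T ^ (2 * κ - κ) * (t - s) ^ κ)) *
            (Λ * N) := by gcongr
      _ = _ := by simp only [hC₁]; ring
  have hcont : ContinuousOn δ (Icc 0 T) := by
    refine continuousOn_of_norm_sub_le_rpow (κ := κ) (C := C₁ * (‖δ 0‖ + c₀)) (by linarith)
      fun s t hs' hst ht => hhol 0 s t c₀ le_rfl hs' hst ht hc₀0
        fun r hr => hc₀ r ⟨hr.1.le, hr.2.trans ht⟩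
  refine ⟨δ, hδ0, hcont, ?_, ?_, ?_, ?_⟩
  · intro u t c hu hut ht hc hDc
    refine (hs u t c hu hut ht hc hDc).trans ?_
    gcongr
    linarith
  · intro u s t c hu hus hst ht hc hDc
    refine (hhol u s t c hu hus hst ht hc hDc).trans ?_
    have := Real.rpow_nonneg (sub_nonneg.2 hst) κ
    gcongr
    linarith
  · intro u s t c hu hus hst ht hc hDc
    have hτ0 : 0 ≤ t - s := sub_nonneg.2 hst
    have hτT : t - s ≤ T := by linarith
    have hsT : s ∈ Icc 0 T := ⟨by linarith, by linarith⟩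
    have h1 := hs u s c hu hus (by linarith) hc fun r hr => hDc r ⟨hr.1, hr.2.trans hst⟩
    have h2 := hint u s t c hu hus hst ht hc hDc
    have h3 := (hδ u s t c hu hus hst ht hc hDc).2
    have p4 := Real.rpow_nonneg hτ0 (2 * κ)
    have h4 := norm_sum_sum_smul_le (mul_nonneg hC p4)
      (fun j i => h.area_le s t hsT.1 hst ht i j) (fun j i => h.norm_le' hsT j i (δ s))
    set N := ‖δ u‖ + c with hN
    have hN0 : 0 ≤ N := by positivity
    have p1 := rpow_le_mul_rpow hτ0 hτT (a := 2 * κ) (b := κ + 2 / 3) (by linarith) (by linarith)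
    have p2 := rpow_le_mul_rpow hτ0 hτT (a := 2 * κ) (b := 1) (by linarith) (by linarith)
    rw [Real.rpow_one] at p2
    have h5 : δ t - δ s - ∑ j, (ζ t j - ζ s j) • φ j s (δ s) =
        (δ t - δ s - (∫ r in s..t, D r (δ s)) - noise ζ A φ ψ s t (δ s)) +
        (∫ r in s..t, D r (δ s)) + ∑ j, ∑ i, A s t i j • ψ j i s (δ s) := by
      simp only [noise]; abel
    calc _ ≤ Λ * N * (t - s) ^ (κ + 2 / 3) + (L * Λ + 1) * N * (t - s) +
          d * (d * (C * (t - s) ^ (2 * κ) * (C * ‖δ s‖))) := by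
          rw [h5]; exact norm_add₃_le.trans (by gcongr)
      _ ≤ Λ * N * (T ^ (κ + 2 / 3 - 2 * κ) * (t - s) ^ (2 * κ)) +
          (L * Λ + 1) * N * (T ^ (1 - 2 * κ) * (t - s) ^ (2 * κ)) +
          d * (d * (C * (t - s) ^ (2 * κ) * (C * (Λ * N)))) := by gcongr
      _ = C₂ * N * (t - s) ^ (2 * κ) := by simp only [hC₂]; ring
      _ ≤ _ := by gcongr; linarith
  · intro u s t c hu hus hst ht hc hDc
    have hτ0 : 0 ≤ t - s := sub_nonneg.2 hst
    have hτT : t - s ≤ T := by linarith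
    have hsT : s ∈ Icc 0 T := ⟨by linarith, by linarith⟩
    have htT : t ∈ Icc 0 T := ⟨by linarith, ht⟩
    have h3 := (hδ u s t c hu hus hst ht hc hDc).2
    set N := ‖δ u‖ + c with hN
    have hN0 : 0 ≤ N := by positivity
    have hD1 := hD.integrable_of_mem hsT htT (δ s)
    have hD2 : IntervalIntegrable (fun r => D r (δ r)) volume s t := by
      refine (hcar δ hcont).mono_set ?_
      rw [uIcc_of_le hT]
      exact uIcc_subset_Icc hsT htT
    have h4 : ‖∫ r in s..t, (D r (δ s) - D r (δ r))‖ ≤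
        L * (C₁ * N * (t - s) ^ κ) * (t - s) := by
      refine (intervalIntegral.norm_integral_le_of_norm_le_const
        (C := L * (C₁ * N * (t - s) ^ κ)) fun r hr => ?_).trans
        (by rw [abs_of_nonneg hτ0])
      rw [uIoc_of_le hst] at hr
      refine (hD.lip r ⟨by linarith [hr.1, hsT.1], hr.2.trans ht⟩ _ _).trans ?_
      rw [norm_sub_rev]
      refine mul_le_mul_of_nonneg_left ((hhol u s r c hu hus hr.1.le (hr.2.trans ht) hc
        fun r' hr' => hDc r' ⟨hr'.1, hr'.2.trans hr.2⟩).trans ?_) hL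
      have : (r - s) ^ κ ≤ (t - s) ^ κ :=
        Real.rpow_le_rpow (by linarith [hr.1]) (by linarith [hr.2]) (by linarith)
      gcongr
    have p1 : (t - s) ^ κ * (t - s) ≤ T ^ (κ + 1 - (κ + 2 / 3)) * (t - s) ^ (κ + 2 / 3) := by
      rw [← Real.rpow_add_one' hτ0 (by linarith)]
      exact rpow_le_mul_rpow hτ0 hτT (by linarith) (by linarith)
    have p4 := Real.rpow_nonneg hτ0 (κ + 2 / 3)
    have h5 : δ t - δ s - (∫ r in s..t, D r (δ r)) - noise ζ A φ ψ s t (δ s) =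
        (δ t - δ s - (∫ r in s..t, D r (δ s)) - noise ζ A φ ψ s t (δ s)) +
        ∫ r in s..t, (D r (δ s) - D r (δ r)) := by
      rw [intervalIntegral.integral_sub hD1 hD2]; abel
    calc _ ≤ Λ * N * (t - s) ^ (κ + 2 / 3) + L * (C₁ * N * (t - s) ^ κ) * (t - s) := by
          rw [h5]; exact (norm_add_le _ _).trans (add_le_add h3 h4)
      _ = Λ * N * (t - s) ^ (κ + 2 / 3) + L * C₁ * N * ((t - s) ^ κ * (t - s)) := by ring
      _ ≤ Λ * N * (t - s) ^ (κ + 2 / 3) +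
          L * C₁ * N * (T ^ (κ + 1 - (κ + 2 / 3)) * (t - s) ^ (κ + 2 / 3)) := by gcongr
      _ = C₃ * N * (t - s) ^ (κ + 2 / 3) := by simp only [hC₃]; ring
      _ ≤ _ := by gcongr; linarith

end RoughControl

/-! ### Weak continuity of the control and the averaged drift -/

namespace RoughControl

open Filter Topology in
-- The easy half of Kantorovich duality: write the difference as one integral against a nearly
-- optimal coupling, use the Lipschitz bound, and pass from first to second moment by
-- Cauchy–Schwarz.
theorem abs_integral_sub_le_of_wasserstein2 {k : ℕ} {U : Set (Vec k)} {ν₁ ν₂ : ProbabilityMeasure U}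
    {w : ℝ} (hw : wasserstein2 ν₁ ν₂ ≤ ENNReal.ofReal w) {f : U → ℝ} {L : NNReal}
    (hf : LipschitzWith L f) {B : ℝ} (hB : ∀ a, |f a| ≤ B) :
    |(∫ a, f a ∂(ν₁ : Measure U)) - ∫ a, f a ∂(ν₂ : Measure U)| ≤ L * max w 0 := by
  have hmeas : Measurable f := hf.continuous.measurable
  refine le_of_forall_pos_le_add fun η hη => ?_
  -- The infimum over couplings need not be known to be attained, hence a strictly larger `w'`;
  -- dividing by `L + 1` covers `L = 0`.
  set w' : ℝ := max w 0 + η / (L + 1) with hw'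
  have hL0 : (0 : ℝ) ≤ L := L.coe_nonneg
  have hη' : 0 < η / ((L : ℝ) + 1) := by positivity
  have hlt : wasserstein2 ν₁ ν₂ < ENNReal.ofReal w' :=
    hw.trans_lt ((ENNReal.ofReal_lt_ofReal_iff (by
      have := le_max_right w 0
      linarith)).2 (by have := le_max_left w 0; linarith))
  rw [wasserstein2, iInf_lt_iff] at hlt
  obtain ⟨π, hπ⟩ := hlt
  rw [iInf_lt_iff] at hπ
  obtain ⟨⟨h1, h2⟩, hcost⟩ := hπ
  have hprob : IsProbabilityMeasure π := by
    constructor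
    have : (π.map Prod.fst) univ = 1 := by rw [h1]; exact measure_univ
    rwa [Measure.map_apply measurable_fst MeasurableSet.univ, preimage_univ] at this
  have hi1 : Integrable (fun q : U × U => f q.1) π :=
    Integrable.of_bound (hmeas.comp measurable_fst).aestronglyMeasurable B
      (ae_of_all _ fun q => hB _)
  have hi2 : Integrable (fun q : U × U => f q.2) π :=
    Integrable.of_bound (hmeas.comp measurable_snd).aestronglyMeasurable B
      (ae_of_all _ fun q => hB _)
  rw [← h1, ← h2, integral_map measurable_fst.aemeasurable hmeas.aestronglyMeasurable,
    integral_map measurable_snd.aemeasurable hmeas.aestronglyMeasurable, ← integral_sub hi1 hi2,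
    ← Real.norm_eq_abs]
  have hed : Measurable fun q : U × U => edist q.1 q.2 := measurable_edist
  have hcs : ∫⁻ q : U × U, edist q.1 q.2 ∂π ≤ ENNReal.ofReal w' := by
    have := ENNReal.lintegral_mul_le_Lp_mul_Lq π (p := 2) (q := 2) Real.HolderConjugate.two_two
      (f := fun q : U × U => edist q.1 q.2) (g := fun _ => 1) hed.aemeasurable aemeasurable_const
    simp only [Pi.mul_apply, mul_one, one_pow, ENNReal.one_rpow, lintegral_const, measure_univ,
      ENNReal.rpow_two] at this
    exact this.trans hcost.le
  have hnorm : ∫⁻ q : U × U, ‖f q.1 - f q.2‖ₑ ∂π ≤ L * ENNReal.ofReal w' := by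
    calc _ ≤ ∫⁻ q : U × U, L * edist q.1 q.2 ∂π := by
          refine lintegral_mono fun q => ?_
          rw [← edist_eq_enorm_sub]
          exact hf q.1 q.2
      _ = L * ∫⁻ q : U × U, edist q.1 q.2 ∂π := lintegral_const_mul _ hed
      _ ≤ _ := by gcongr
  have hw'0 : 0 ≤ w' := by
    have := le_max_right w 0
    linarith
  calc ‖∫ q : U × U, (f q.1 - f q.2) ∂π‖ ≤ (∫⁻ q : U × U, ‖f q.1 - f q.2‖ₑ ∂π).toReal := by
        rw [← toReal_enorm]
        refine ENNReal.toReal_mono (ne_top_of_le_ne_top ?_ hnorm) (enorm_integral_le_lintegral_enorm _)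
        exact ENNReal.mul_ne_top ENNReal.coe_ne_top ENNReal.ofReal_ne_top
    _ ≤ (L * ENNReal.ofReal w').toReal :=
        ENNReal.toReal_mono (ENNReal.mul_ne_top ENNReal.coe_ne_top ENNReal.ofReal_ne_top) hnorm
    _ = L * w' := by
        rw [ENNReal.toReal_mul, ENNReal.coe_toReal, ENNReal.toReal_ofReal hw'0]
    _ ≤ L * max w 0 + η := by
        have : (L : ℝ) * (η / (L + 1)) ≤ η := by
          rw [mul_div_assoc', div_le_iff₀ (by positivity)]
          nlinarith
        rw [hw']
        linarith

open Filter Topology in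
-- Bounded Lipschitz test functions determine weak convergence, and on these the Wasserstein modulus
-- acts directly.
theorem continuousOn_of_mem_holderControls {k : ℕ} {U : Set (Vec k)} {T ε L : ℝ} (hε : 0 < ε)
    {K : Set (ProbabilityMeasure U)} {γ : ℝ → ProbabilityMeasure U}
    (hγ : γ ∈ HolderControls T ε L K) : ContinuousOn γ (Icc 0 T) := by
  intro t ht
  rw [ContinuousWithinAt, tendsto_iff_forall_lipschitz_integral_tendsto]
  rintro f ⟨C, hC⟩ ⟨M, hM⟩
  have hne : Nonempty U := (γ t).nonempty
  obtain ⟨a₀⟩ := hne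
  have hB : ∀ a, |f a| ≤ |f a₀| + C := fun a => by
    have := hC a a₀
    rw [Real.dist_eq] at this
    have h2 := abs_add_le (f a - f a₀) (f a₀)
    rw [sub_add_cancel] at h2
    linarith
  rw [tendsto_iff_norm_sub_tendsto_zero]
  have hlim : Tendsto (fun s => (M : ℝ) * max (L * |s - t| ^ ε) 0) (𝓝[Icc 0 T] t) (𝓝 0) := by
    have hc : Continuous fun s : ℝ => (M : ℝ) * max (L * |s - t| ^ ε) 0 :=
      continuous_const.mul ((continuous_const.mul
        ((by fun_prop : Continuous fun s : ℝ => |s - t|).rpow_const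
          fun _ => Or.inr hε.le)).max continuous_const)
    have h0 := hc.tendsto t
    rw [sub_self, abs_zero, Real.zero_rpow hε.ne', mul_zero, max_self, mul_zero] at h0
    exact h0.mono_left nhdsWithin_le_nhds
  refine squeeze_zero' (Eventually.of_forall fun _ => norm_nonneg _)
    (eventually_nhdsWithin_of_forall fun s hs => ?_) hlim
  have := hγ.2 t ht s hs
  rw [Real.norm_eq_abs, abs_sub_comm]
  exact abs_integral_sub_le_of_wasserstein2 this hM hB

/-- The drift averaged over a relaxed control value. -/
noncomputable def meanDrift {m k : ℕ} {U : Set (Vec k)} (b : ℝ → Vec m → Vec k → Vec m)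
    (ν : ProbabilityMeasure U) (t : ℝ) (x : Vec m) : Vec m :=
  ∫ a : U, b t x a ∂(ν : Measure U)

namespace IsDriftCoeff

variable {m k : ℕ} {T : ℝ} {U : Set (Vec k)} {b : ℝ → Vec m → Vec k → Vec m}

theorem continuous_control (hb : IsDriftCoeff T U b) {t : ℝ} (ht : t ∈ Icc 0 T) (x : Vec m) :
    Continuous fun a : U => b t x a :=
  hb.continuous.comp_continuous (f := fun a : U => (t, x, (a : Vec k))) (by fun_prop)
    fun a => ⟨ht, mem_univ _, a.2⟩

theorem continuous_control_fderiv (hb : IsDriftCoeff T U b) {t : ℝ} (ht : t ∈ Icc 0 T)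
    (x : Vec m) : Continuous fun a : U => fderiv ℝ (fun z => b t z a) x :=
  hb.continuous_fderiv.comp_continuous (f := fun a : U => (t, x, (a : Vec k))) (by fun_prop)
    fun a => ⟨ht, mem_univ _, a.2⟩

theorem integrable (hb : IsDriftCoeff T U b) {t : ℝ} (ht : t ∈ Icc 0 T) (x : Vec m)
    (ν : ProbabilityMeasure U) : Integrable (fun a : U => b t x a) (ν : Measure U) := by
  obtain ⟨C, hC⟩ := hb.bounded
  exact Integrable.of_bound (hb.continuous_control ht x).aestronglyMeasurable C
    (ae_of_all _ fun a => hC t ht x a a.2)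

theorem norm_integral_sub_le (hb : IsDriftCoeff T U b) {s t : ℝ} (hs : s ∈ Icc 0 T)
    (ht : t ∈ Icc 0 T) {x x' : Vec m} {M : ℝ} (h : ∀ a ∈ U, ‖b t x a - b s x' a‖ ≤ M)
    (ν : ProbabilityMeasure U) : ‖meanDrift b ν t x - meanDrift b ν s x'‖ ≤ M := by
  rw [meanDrift, meanDrift, ← integral_sub (hb.integrable ht x ν) (hb.integrable hs x' ν)]
  have := norm_integral_le_of_norm_le_const (μ := (ν : Measure U))
    (f := fun a : U => b t x a - b s x' a) (C := M) (ae_of_all _ fun a => h a a.2)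
  simpa using this

theorem exists_meanDrift_bound (hb : IsDriftCoeff T U b) : ∃ C, 0 ≤ C ∧
    (∀ t ∈ Icc 0 T, ∀ x, ∀ ν : ProbabilityMeasure U, ‖meanDrift b ν t x‖ ≤ C) ∧
    ∀ t ∈ Icc 0 T, ∀ x x', ∀ ν : ProbabilityMeasure U,
      ‖meanDrift b ν t x - meanDrift b ν t x'‖ ≤ C * ‖x - x'‖ := by
  obtain ⟨C, hC⟩ := hb.bounded
  obtain ⟨C', hC'⟩ := hb.lipschitz
  refine ⟨|C| + |C'|, by positivity, fun t ht x ν => ?_, fun t ht x x' ν => ?_⟩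
  · have := norm_integral_le_of_norm_le_const (μ := (ν : Measure U))
      (f := fun a : U => b t x a) (C := |C| + |C'|) (ae_of_all _ fun a =>
        (hC t ht x a a.2).trans (by linarith [le_abs_self C, abs_nonneg C']))
    simpa [meanDrift] using this
  · refine hb.norm_integral_sub_le ht ht (fun a ha => (hC' t ht a ha x x').trans ?_) ν
    gcongr
    linarith [le_abs_self C', abs_nonneg C]

open Filter Topology in
-- Time, space and control are moved one after the other. The first two moves are uniform in the
-- control value, so weak convergence is needed only for a fixed bounded continuous integrand,
-- coordinate by coordinate.
theorem continuousOn_meanDrift (hb : IsDriftCoeff T U b) {γ : ℝ → ProbabilityMeasure U}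
    (hγ : ContinuousOn γ (Icc 0 T)) {z : ℝ → Vec m} (hz : ContinuousOn z (Icc 0 T)) :
    ContinuousOn (fun t => meanDrift b (γ t) t (z t)) (Icc 0 T) := by
  intro t ht
  obtain ⟨C, hC0, -, hCl⟩ := hb.exists_meanDrift_bound
  obtain ⟨C', hC'⟩ := hb.bounded
  have h1 : Tendsto (fun s => meanDrift b (γ s) s (z s) - meanDrift b (γ s) t (z s))
      (𝓝[Icc 0 T] t) (𝓝 0) := by
    rw [Metric.tendsto_nhds]
    intro η hη
    obtain ⟨δ, hδ, hun⟩ := hb.uniform_in_time (η / 2) (half_pos hη)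
    filter_upwards [self_mem_nhdsWithin, mem_nhdsWithin_of_mem_nhds (Metric.ball_mem_nhds t hδ)]
      with s hs hsδ
    rw [dist_zero_right]
    refine (hb.norm_integral_sub_le ht hs (fun a ha => (hun t ht s hs ?_ _ a ha).le) _).trans_lt
      (half_lt_self hη)
    rwa [← Real.dist_eq]
  have h2 : Tendsto (fun s => meanDrift b (γ s) t (z s) - meanDrift b (γ s) t (z t))
      (𝓝[Icc 0 T] t) (𝓝 0) := by
    refine squeeze_zero_norm (fun s => hCl t ht (z s) (z t) (γ s)) ?_
    have := (tendsto_iff_norm_sub_tendsto_zero.1 (hz t ht)).const_mul C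
    rwa [mul_zero] at this
  have h3 : Tendsto (fun s => meanDrift b (γ s) t (z t)) (𝓝[Icc 0 T] t)
      (𝓝 (meanDrift b (γ t) t (z t))) := by
    have hw := ProbabilityMeasure.tendsto_iff_forall_integral_tendsto.1 (hγ t ht)
    have hind := (EuclideanSpace.equiv (Fin m) ℝ).toHomeomorph.isInducing
    rw [hind.tendsto_nhds_iff, tendsto_pi_nhds]
    intro i
    have hcoord : ∀ ν : ProbabilityMeasure U, (meanDrift b ν t (z t)) i =
        ∫ a : U, (b t (z t) a) i ∂(ν : Measure U) := fun ν =>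
      ((EuclideanSpace.proj (𝕜 := ℝ) i).integral_comp_comm (hb.integrable ht (z t) ν)).symm
    let f : BoundedContinuousFunction U ℝ := BoundedContinuousFunction.ofNormedAddCommGroup
      (fun a : U => (b t (z t) a) i)
      ((EuclideanSpace.proj (𝕜 := ℝ) i).continuous.comp (hb.continuous_control ht (z t))) C'
      (fun a => (PiLp.norm_apply_le _ i).trans (hC' t ht _ a a.2))
    have := hw f
    simp only [Function.comp_def]
    change Tendsto (fun s => (meanDrift b (γ s) t (z t)) i) _ (𝓝 ((meanDrift b (γ t) t (z t)) i))
    simp only [hcoord]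
    exact this
  have h4 := (h1.add h2).add h3
  simp only [zero_add] at h4
  refine h4.congr fun s => ?_
  abel

theorem hasFDerivAt_meanDrift (hb : IsDriftCoeff T U b) {t : ℝ} (ht : t ∈ Icc 0 T)
    (ν : ProbabilityMeasure U) (x : Vec m) : HasFDerivAt (meanDrift b ν t)
      (∫ a : U, fderiv ℝ (fun z => b t z a) x ∂(ν : Measure U)) x := by
  obtain ⟨C, hC⟩ := hb.bounded_fderiv
  exact hasFDerivAt_integral_of_dominated_of_fderiv_le (F := fun (z : Vec m) (a : U) => b t z a)
    (F' := fun z (a : U) => fderiv ℝ (fun z => b t z a) z) (bound := fun _ => C)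
    Filter.univ_mem (Filter.Eventually.of_forall fun z =>
      (hb.continuous_control ht z).aestronglyMeasurable) (hb.integrable ht x ν)
    (hb.continuous_control_fderiv ht x).aestronglyMeasurable
    (ae_of_all _ fun a z _ => hC t ht z a a.2) (integrable_const C)
    (ae_of_all _ fun a z _ => (hb.differentiable t ht a a.2 z).hasFDerivAt)

theorem exists_norm_integral_fderiv_le (hb : IsDriftCoeff T U b) : ∃ C, ∀ t ∈ Icc 0 T, ∀ x,
    ∀ ν : ProbabilityMeasure U, ‖∫ a : U, fderiv ℝ (fun z => b t z a) x ∂(ν : Measure U)‖ ≤ C := by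
  obtain ⟨C, hC⟩ := hb.bounded_fderiv
  refine ⟨C, fun t ht x ν => ?_⟩
  have := norm_integral_le_of_norm_le_const (μ := (ν : Measure U))
    (f := fun a : U => fderiv ℝ (fun z => b t z a) x) (C := C)
    (ae_of_all _ fun a => hC t ht x a a.2)
  simpa using this

end IsDriftCoeff

end RoughControl

/-! ### The state of a perturbed control -/

namespace RoughControl

variable {m d k n : ℕ}

theorem le_abs_mul_rpow {τ T a b C v : ℝ} (h0 : 0 ≤ τ) (h1 : τ ≤ T) (ha : 0 ≤ a) (hab : a ≤ b)
    (h : v ≤ C * τ ^ b) : v ≤ |C| * T ^ (b - a) * τ ^ a := by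
  have h2 := rpow_le_mul_rpow h0 h1 ha hab
  have h3 := Real.rpow_nonneg h0 b
  calc v ≤ C * τ ^ b := h
    _ ≤ |C| * τ ^ b := by gcongr; exact le_abs_self C
    _ ≤ |C| * (T ^ (b - a) * τ ^ a) := by gcongr
    _ = _ := by ring

theorem IsWeaklyControlled.mono {κ κ' T : ℝ} {ζ : ℝ → Vec d} {z : ℝ → Vec n}
    {z' : ℝ → Fin d → Vec n} (h : IsWeaklyControlled κ T ζ z z') (hκ' : 0 ≤ κ') (hκ : κ' ≤ κ) :
    IsWeaklyControlled κ' T ζ z z' := by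
  obtain ⟨⟨c1, h1⟩, ⟨c2, h2⟩, ⟨c3, h3⟩⟩ := h
  exact ⟨⟨_, fun s t hs hst ht =>
      le_abs_mul_rpow (sub_nonneg.2 hst) (by linarith) hκ' hκ (h1 s t hs hst ht)⟩,
    ⟨_, fun s t hs hst ht j =>
      le_abs_mul_rpow (sub_nonneg.2 hst) (by linarith) hκ' hκ (h2 s t hs hst ht j)⟩,
    ⟨_, fun s t hs hst ht =>
      le_abs_mul_rpow (sub_nonneg.2 hst) (by linarith) (by linarith) (by linarith)
        (h3 s t hs hst ht)⟩⟩

theorem IsWeaklyControlled.continuousOn {κ T : ℝ} {ζ : ℝ → Vec d} {z : ℝ → Vec n}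
    {z' : ℝ → Fin d → Vec n} (h : IsWeaklyControlled κ T ζ z z') (hκ : 0 < κ) :
    ContinuousOn z (Icc 0 T) := by
  obtain ⟨C, hC⟩ := h.holder
  exact continuousOn_of_norm_sub_le_rpow hκ hC

theorem IsGeometricRoughPath.abs_sub_le {α T : ℝ} {ζ : ℝ → Vec d}
    {A : ℝ → ℝ → Fin d → Fin d → ℝ} (hζ : IsGeometricRoughPath α T ζ A) {κ : ℝ} (hκ : 0 ≤ κ)
    (hκα : κ ≤ α) (hT : 0 ≤ T) : ∃ C, 0 ≤ C ∧
      (∀ s t, 0 ≤ s → s ≤ t → t ≤ T → ∀ j, |ζ t j - ζ s j| ≤ C * (t - s) ^ κ) ∧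
      ∀ s t, 0 ≤ s → s ≤ t → t ≤ T → ∀ i j, |A s t i j| ≤ C * (t - s) ^ (2 * κ) := by
  obtain ⟨c1, h1⟩ := hζ.holder
  obtain ⟨c2, h2⟩ := hζ.area_holder
  have p1 := Real.rpow_nonneg hT (α - κ)
  have p2 := Real.rpow_nonneg hT (2 * α - 2 * κ)
  have q1 : 0 ≤ |c1| * T ^ (α - κ) := by positivity
  have q2 : 0 ≤ |c2| * T ^ (2 * α - 2 * κ) := by positivity
  refine ⟨|c1| * T ^ (α - κ) + |c2| * T ^ (2 * α - 2 * κ), by positivity, ?_, ?_⟩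
  · intro s t hs hst ht j
    have e1 : |ζ t j - ζ s j| ≤ c1 * (t - s) ^ α :=
      (PiLp.norm_apply_le (ζ t - ζ s) j).trans (h1 s t hs hst ht)
    refine (le_abs_mul_rpow (T := T) (sub_nonneg.2 hst) (by linarith) hκ hκα e1).trans ?_
    have := Real.rpow_nonneg (sub_nonneg.2 hst) κ
    gcongr
    linarith
  · intro s t hs hst ht i j
    refine (le_abs_mul_rpow (T := T) (a := 2 * κ) (sub_nonneg.2 hst) (by linarith) (by linarith)
      (by linarith) (h2 s t hs hst ht i j)).trans ?_
    have := Real.rpow_nonneg (sub_nonneg.2 hst) (2 * κ)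
    gcongr
    linarith

theorem exists_roughField {κ α T : ℝ} (hκ : 1 / 3 < κ) (hκα : κ ≤ α) (hT : 0 ≤ T)
    {ζ : ℝ → Vec d} {A : ℝ → ℝ → Fin d → Fin d → ℝ} (hζ : IsGeometricRoughPath α T ζ A)
    {σ : Fin d → ℝ → Vec m → Vec m} (hσ : IsNoiseCoeff T σ) {x : ℝ → Vec m}
    (hx : IsWeaklyControlled κ T ζ x (fun t j => σ j t (x t))) :
    ∃ C, RoughField T κ C ζ A (incr σ x) (incr' σ x) := by
  obtain ⟨C, hC, hζ1, hA1⟩ := hζ.abs_sub_le (κ := κ) (by linarith) hκα hT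
  have hx3 := hx.mono (κ' := 1 / 3) (by norm_num) hκ.le
  obtain ⟨c1, h1⟩ := hx3.holder
  obtain ⟨c3, h3⟩ := hx3.remainder
  refine hσ.roughField (C₀ := C + |c1| + |c3|) hκ (by positivity) hT ?_ ?_ hζ.chen ?_ ?_
  · intro s t hs hst ht j
    refine (hζ1 s t hs hst ht j).trans ?_
    have := Real.rpow_nonneg (sub_nonneg.2 hst) κ
    gcongr
    linarith [abs_nonneg c1, abs_nonneg c3]
  · intro s t hs hst ht i j
    refine (hA1 s t hs hst ht i j).trans ?_
    have := Real.rpow_nonneg (sub_nonneg.2 hst) (2 * κ)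
    gcongr
    linarith [abs_nonneg c1, abs_nonneg c3]
  · intro s t hs hst ht
    refine (h1 s t hs hst ht).trans ?_
    have := Real.rpow_nonneg (sub_nonneg.2 hst) (1 / 3)
    gcongr
    linarith [le_abs_self c1, abs_nonneg c3]
  · intro s t hs hst ht
    refine (h3 s t hs hst ht).trans ?_
    have := Real.rpow_nonneg (sub_nonneg.2 hst) (2 / 3)
    norm_num
    gcongr
    linarith [le_abs_self c3, abs_nonneg c1]

/-- The drift of the difference between the states of the controls `γ'` and `γ`. -/
noncomputable def driftDiff {U : Set (Vec k)} (b : ℝ → Vec m → Vec k → Vec m)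
    (γ γ' : ℝ → ProbabilityMeasure U) (x : ℝ → Vec m) (r : ℝ) (e : Vec m) : Vec m :=
  meanDrift b (γ' r) r (x r + e) - meanDrift b (γ r) r (x r)

/-- The coefficients at `x` plus their increments over `x` are the coefficients at `x + δ`, both for
`σ` and for its Gubinelli derivative. Hence the controlled-path bounds and the local expansions of
`x` and `δ` simply add. -/
theorem solvesState_add {κ α T Λ : ℝ} (hκ : 1 / 3 < κ) (hκα : κ < α) (hκ2 : κ ≤ 1 / 2)
    (hT : 0 ≤ T)
    {ζ : ℝ → Vec d} {A : ℝ → ℝ → Fin d → Fin d → ℝ} {U : Set (Vec k)}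
    {b : ℝ → Vec m → Vec k → Vec m} (hb : IsDriftCoeff T U b)
    {σ : Fin d → ℝ → Vec m → Vec m} (hσ : IsNoiseCoeff T σ) {x : ℝ → Vec m} {y : Vec m}
    {γ γ' : ℝ → ProbabilityMeasure U} (hx : SolvesState α T ζ A b σ y γ x)
    (hxc : IsWeaklyControlled κ T ζ x (fun t j => σ j t (x t)))
    (hγ' : ∀ z : ℝ → Vec m, ContinuousOn z (Icc 0 T) →
      IntervalIntegrable (fun r => meanDrift b (γ' r) r (z r)) volume 0 T) {δ : ℝ → Vec m}
    (hδ : LinearGrowthSolution T κ Λ ζ A (incr σ x) (incr' σ x) (driftDiff b γ γ' x) δ) :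
    SolvesState α T ζ A b σ y γ' (fun t => x t + δ t) := by
  obtain ⟨hx0, hxr⟩ := hx
  obtain ⟨C, hC0, hCb, -⟩ := hb.exists_meanDrift_bound
  have hDb : ∀ r ∈ Ioc 0 T, ‖driftDiff b γ γ' x r 0‖ ≤ 2 * C := fun r hr => by
    have hr' : r ∈ Icc 0 T := ⟨hr.1.le, hr.2⟩
    exact (norm_sub_le _ _).trans (by linarith [hCb r hr' (x r + 0) (γ' r), hCb r hr' (x r) (γ r)])
  have hDb' : ∀ t, t ≤ T → ∀ r ∈ Ioc 0 t, ‖driftDiff b γ γ' x r 0‖ ≤ 2 * C :=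
    fun t ht r hr => hDb r ⟨hr.1, hr.2.trans ht⟩
  have hzc : ContinuousOn (fun t => x t + δ t) (Icc 0 T) :=
    (hxc.continuousOn (by linarith)).add hδ.continuousOn
  have hint : IntervalIntegrable (fun r => meanDrift b (γ' r) r (x r + δ r)) volume 0 T := hγ' _ hzc
  have hsub : ∀ {f : ℝ → Vec m}, IntervalIntegrable f volume 0 T → ∀ {s t}, s ∈ Icc 0 T →
      t ∈ Icc 0 T → IntervalIntegrable f volume s t := fun hf s t hs ht =>
    hf.mono_set (by rw [uIcc_of_le hT]; exact uIcc_subset_Icc hs ht)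
  obtain ⟨K, hK1, -, hK⟩ := hσ.exists_bound 1
  obtain ⟨c1, h1⟩ := hxc.holder
  obtain ⟨c3, h3⟩ := hxc.remainder
  set N := Λ * (‖δ 0‖ + 2 * C) with hN
  have hd1 : ∀ s t, 0 ≤ s → s ≤ t → t ≤ T → ‖δ t - δ s‖ ≤ N * (t - s) ^ κ :=
    fun s t hs hst ht => hδ.holder 0 s t (2 * C) le_rfl hs hst ht (by positivity) (hDb' t ht)
  have hz1 : ∀ s t, 0 ≤ s → s ≤ t → t ≤ T →
      ‖(x t + δ t) - (x s + δ s)‖ ≤ (c1 + N) * (t - s) ^ κ := by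
    intro s t hs hst ht
    rw [add_sub_add_comm]
    refine (norm_add_le _ _).trans ?_
    linarith [h1 s t hs hst ht, hd1 s t hs hst ht]
  refine ⟨by simp [hx0, hδ.zero], ⟨κ, hκ, hκα, ⟨⟨c1 + N, hz1⟩, ⟨K * T ^ (1 - κ) + K * (c1 + N), ?_⟩,
    ⟨c3 + N, ?_⟩⟩⟩, hint, ?_⟩
  · intro s t hs hst ht j
    have hsT : s ∈ Icc 0 T := ⟨hs, hst.trans ht⟩
    have htT : t ∈ Icc 0 T := ⟨hs.trans hst, ht⟩
    have e1 := (hK j).2 s hsT t htT (x t + δ t)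
    have e2 := ((hK j).1 s hsT).lip (x t + δ t) (x s + δ s)
    have e3 := hz1 s t hs hst ht
    have e4 := rpow_le_mul_rpow (sub_nonneg.2 hst) (by linarith : t - s ≤ T) (a := κ) (b := 1)
      (by linarith) (by linarith)
    rw [Real.rpow_one] at e4
    rw [abs_of_nonneg (sub_nonneg.2 hst)] at e1
    have e5 : σ j t (x t + δ t) - σ j s (x s + δ s) =
        (σ j t (x t + δ t) - σ j s (x t + δ t)) +
        (σ j s (x t + δ t) - σ j s (x s + δ s)) := by abel
    rw [e5]
    refine (norm_add_le _ _).trans ?_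
    have hK0 : 0 ≤ K := by linarith
    have e6 := mul_le_mul_of_nonneg_left e3 hK0
    have e7 := mul_le_mul_of_nonneg_left e4 hK0
    linarith
  · intro s t hs hst ht
    have e1 := h3 s t hs hst ht
    have e2 := hδ.remainder 0 s t (2 * C) le_rfl hs hst ht (by positivity) (hDb' t ht)
    have e3 : x t + δ t - (x s + δ s) - ∑ j, (ζ t j - ζ s j) • σ j s (x s + δ s) =
        (x t - x s - ∑ j, (ζ t j - ζ s j) • σ j s (x s)) +
        (δ t - δ s - ∑ j, (ζ t j - ζ s j) • incr σ x j s (δ s)) := by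
      simp only [incr, smul_sub, Finset.sum_sub_distrib]; abel
    rw [e3]
    refine (norm_add_le _ _).trans ?_
    linarith
  · obtain ⟨I, ⟨hIadd, θ, c, hθ, hI⟩, hIeq⟩ := hxr.equation
    -- The rough integral is defined as the increment of the path minus its drift, so additivity is
    -- automatic. The two expansions have different orders, both above one, and the smaller one is
    -- kept.
    refine ⟨fun s t => (x t + δ t) - (x s + δ s) - ∫ r in s..t, meanDrift b (γ' r) r (x r + δ r),
      ⟨?_, min θ (κ + 2 / 3), |c| * T ^ (θ - min θ (κ + 2 / 3)) +
        |N| * T ^ (κ + 2 / 3 - min θ (κ + 2 / 3)), ?_, ?_⟩, fun s t hs hst ht => ?_⟩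
    · intro s u t hs hsu hut ht
      have hsT : s ∈ Icc 0 T := ⟨hs, by linarith⟩
      have huT : u ∈ Icc 0 T := ⟨by linarith, by linarith⟩
      have htT : t ∈ Icc 0 T := ⟨by linarith, ht⟩
      simp only
      rw [← intervalIntegral.integral_add_adjacent_intervals (hsub hint hsT huT)
        (hsub hint huT htT)]
      abel
    · rw [lt_min_iff]; constructor <;> linarith
    · intro s t hs hst ht
      have hsT : s ∈ Icc 0 T := ⟨hs, hst.trans ht⟩
      have htT : t ∈ Icc 0 T := ⟨hs.trans hst, ht⟩
      have e1 := hI s t hs hst ht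
      have e2 := hδ.expansion 0 s t (2 * C) le_rfl hs hst ht (by positivity) (hDb' t ht)
      have hmin0 : 0 ≤ min θ (κ + 2 / 3) := le_min (by linarith) (by linarith)
      have e1' := le_abs_mul_rpow (sub_nonneg.2 hst) (by linarith : t - s ≤ T) hmin0
        (min_le_left θ (κ + 2 / 3)) e1
      have e2' := le_abs_mul_rpow (sub_nonneg.2 hst) (by linarith : t - s ≤ T) hmin0
        (min_le_right θ (κ + 2 / 3)) e2
      have e3 := hIeq s t hs hst ht
      have e4 : ∫ r in s..t, driftDiff b γ γ' x r (δ r) =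
          (∫ r in s..t, meanDrift b (γ' r) r (x r + δ r)) -
          ∫ r in s..t, ∫ a : U, b r (x r) a ∂(γ r : Measure U) :=
        intervalIntegral.integral_sub (hsub hint hsT htT) (hsub hxr.drift_integrable hsT htT)
      have e5 : (x t + δ t) - (x s + δ s) - (∫ r in s..t, meanDrift b (γ' r) r (x r + δ r)) -
          ((∑ j, (ζ t j - ζ s j) • σ j s (x s + δ s)) + ∑ j, ∑ i, A s t i j •
            fderiv ℝ (σ j s) (x s + δ s) (σ i s (x s + δ s))) =
          (I s t - ((∑ j, (ζ t j - ζ s j) • σ j s (x s)) + ∑ j, ∑ i, A s t i j •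
            fderiv ℝ (σ j s) (x s) (σ i s (x s)))) +
          (δ t - δ s - (∫ r in s..t, driftDiff b γ γ' x r (δ r)) -
            noise ζ A (incr σ x) (incr' σ x) s t (δ s)) := by
        have e6 : I s t = x t - x s - ∫ r in s..t, ∫ a : U, b r (x r) a ∂(γ r : Measure U) := by
          rw [e3]; abel
        rw [e6, e4]
        simp only [noise, incr, incr', smul_sub, Finset.sum_sub_distrib]
        abel
      rw [e5]
      refine (norm_add_le _ _).trans ?_
      linarith
    · simp only [meanDrift]; abel

end RoughControl

/-! ### Duality between the adjoint path and a difference of states -/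

namespace RoughControl

section Algebra

variable {E : Type*} [NormedAddCommGroup E] [InnerProductSpace ℝ E] [CompleteSpace E]

open ContinuousLinearMap in
/-- The rough parts of a linearised equation and of its adjoint cancel, if the driving path is
geometric. -/
theorem inner_increment_eq {d : ℕ} (S : Fin d → E →L[ℝ] E) (Q : Fin d → Fin d → E →L[ℝ] E)
    (Z : Fin d → ℝ) (a : Fin d → Fin d → ℝ) (ha : ∀ i j, a i j + a j i = Z i * Z j)
    (p p' δ δ' : E) :
    inner ℝ p' δ' - inner ℝ p δ =
      inner ℝ p (δ' - δ - (∑ j, Z j • S j δ) - ∑ j, ∑ i, a i j • (Q j i δ + S j (S i δ))) +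
      inner ℝ (p' - p + (∑ j, Z j • adjoint (S j) p) + ∑ j, ∑ i, a i j •
        (adjoint (Q j i) p - adjoint (S j) (adjoint (S i) p))) δ -
      inner ℝ (∑ j, Z j • adjoint (S j) p) (δ' - δ - ∑ j, Z j • S j δ) +
      inner ℝ (p' - p + ∑ j, Z j • adjoint (S j) p) (δ' - δ) := by
  -- The `Q` terms cancel. The area terms left by the state and by the adjoint carry `S` in opposite
  -- orders, so together they see only the symmetric part of `a`. Geometricity makes this `Z i * Z
  -- j`, which the product of the two first-order terms compensates.
  have hsym : ∑ j, ∑ i, a i j * inner ℝ p (S j (S i δ)) + ∑ j, ∑ i, a i j * inner ℝ p (S i (S j δ))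
      = ∑ j, ∑ i, Z j * (Z i * inner ℝ p (S i (S j δ))) := by
    rw [Finset.sum_comm (f := fun j i => a i j * inner ℝ p (S j (S i δ))),
      ← Finset.sum_add_distrib]
    refine Finset.sum_congr rfl fun j _ => ?_
    rw [← Finset.sum_add_distrib]
    refine Finset.sum_congr rfl fun i _ => ?_
    rw [← mul_assoc, ← ha j i]
    ring
  simp only [inner_add_left, inner_sub_left, inner_sub_right, inner_add_right, sum_inner,
    inner_sum, real_inner_smul_left, real_inner_smul_right, adjoint_inner_left, mul_add, mul_sub,
    Finset.sum_add_distrib, Finset.sum_sub_distrib]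
  linarith [hsym]

end Algebra

variable {m d k : ℕ}

open ContinuousLinearMap in
/-- Quantitative form of the backward linear equation `-dp = η dt + ∑ⱼ Sⱼᵀ p dζʲ`. -/
structure AdjointPath (T θ C : ℝ) (ζ : ℝ → Vec d) (A : ℝ → ℝ → Fin d → Fin d → ℝ)
    (S : Fin d → ℝ → Vec m →L[ℝ] Vec m) (Q : Fin d → Fin d → ℝ → Vec m →L[ℝ] Vec m)
    (η p : ℝ → Vec m) : Prop where
  integrable : IntervalIntegrable η volume 0 T
  norm_drift_le : ∀ t ∈ Icc 0 T, ‖η t‖ ≤ C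
  norm_le : ∀ t ∈ Icc 0 T, ‖p t‖ ≤ C
  continuousOn : ContinuousOn p (Icc 0 T)
  holder : ∀ s t, 0 ≤ s → s ≤ t → t ≤ T → ‖p t - p s‖ ≤ C * (t - s) ^ (1 / 3 : ℝ)
  remainder : ∀ s t, 0 ≤ s → s ≤ t → t ≤ T →
    ‖p t - p s + ∑ j, (ζ t j - ζ s j) • adjoint (S j s) (p s)‖ ≤ C * (t - s) ^ (2 / 3 : ℝ)
  expansion : ∀ s t, 0 ≤ s → s ≤ t → t ≤ T →
    ‖p t - p s + (∫ r in s..t, η r) + (∑ j, (ζ t j - ζ s j) • adjoint (S j s) (p s)) +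
      ∑ j, ∑ i, A s t i j • (adjoint (Q j i s) (p s) - adjoint (S j s) (adjoint (S i s) (p s)))‖
      ≤ C * (t - s) ^ θ

theorem mul_rpow_mul_rpow {τ a b : ℝ} (h0 : 0 ≤ τ) (ha : 0 ≤ a) (hb : 0 ≤ b) :
    τ ^ a * τ ^ b = τ ^ (a + b) := (Real.rpow_add_of_nonneg h0 ha hb).symm

theorem intervalIntegrable_inner {T : ℝ} (hT : 0 ≤ T) {p f : ℝ → Vec m}
    (hp : ContinuousOn p (Icc 0 T)) (hf : IntervalIntegrable f volume 0 T) :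
    IntervalIntegrable (fun r => inner ℝ (p r) (f r)) volume 0 T := by
  obtain ⟨C, hC⟩ := isCompact_Icc.exists_bound_of_continuousOn hp
  rw [intervalIntegrable_iff, uIoc_of_le hT] at hf ⊢
  refine Integrable.mono' (g := fun r => C * ‖f r‖) (hf.norm.const_mul C) ?_ ?_
  · exact ((hp.mono Ioc_subset_Icc_self).aestronglyMeasurable measurableSet_Ioc).inner
      hf.aestronglyMeasurable
  · exact (ae_restrict_mem measurableSet_Ioc).mono fun r hr => (norm_inner_le_norm _ _).trans
      (mul_le_mul_of_nonneg_right (hC r (Ioc_subset_Icc_self hr)) (norm_nonneg _))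

theorem norm_incr_sub_le {K : ℝ} {σ : Fin d → ℝ → Vec m → Vec m} {s : ℝ}
    (hK : ∀ j, BoundedC3 K (σ j s)) (x : ℝ → Vec m) (j : Fin d) (e : Vec m) :
    ‖incr σ x j s e - fderiv ℝ (σ j s) (x s) e‖ ≤ K * ‖e‖ ^ 2 :=
  norm_taylor_two_le (hK j).differentiable (hK j).nonneg (hK j).lip₁ (x s) e

theorem norm_incr'_sub_le {K : ℝ} {σ : Fin d → ℝ → Vec m → Vec m} {s : ℝ}
    (hK : ∀ j, BoundedC3 K (σ j s)) (x : ℝ → Vec m) (j i : Fin d) (e : Vec m) :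
    ‖incr' σ x j i s e - (fderiv ℝ (fderiv ℝ (σ j s)) (x s) (σ i s (x s)) e +
      fderiv ℝ (σ j s) (x s) (fderiv ℝ (σ i s) (x s) e))‖ ≤ 4 * K ^ 2 * ‖e‖ ^ 2 := by
  have := norm_taylor_two_le ((hK j).differentiable_apply (hK i)) (by positivity)
    ((hK j).lip_fderiv_apply (hK i)) (x s) e
  rw [(hK j).fderiv_apply (hK i)] at this
  simpa [incr', (hK j).symm (x s) e (σ i s (x s))] using this

/-- The pairing of a solution of the adjoint equation with a difference of states satisfies an
equation without rough integral, up to small errors. -/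
theorem AdjointPath.inner_increment_le {T κ θ C C' L K : ℝ} {ζ : ℝ → Vec d}
    {A : ℝ → ℝ → Fin d → Fin d → ℝ} {σ : Fin d → ℝ → Vec m → Vec m} {x η p : ℝ → Vec m}
    (hp : AdjointPath T θ C ζ A (fun j s => fderiv ℝ (σ j s) (x s))
      (fun j i s => fderiv ℝ (fderiv ℝ (σ j s)) (x s) (σ i s (x s))) η p)
    (hf : RoughField T κ C' ζ A (incr σ x) (incr' σ x))
    (hgeo : ∀ s t, 0 ≤ s → s ≤ t → t ≤ T → ∀ i j,
      A s t i j + A s t j i = (ζ t i - ζ s i) * (ζ t j - ζ s j))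
    (hK : ∀ j, ∀ t ∈ Icc 0 T, BoundedC3 K (σ j t)) (hK1 : 1 ≤ K) (hT : 0 ≤ T) (hC : 0 ≤ C)
    (hL : 0 ≤ L) (hκ : 1 / 3 < κ) (hκ2 : κ ≤ 1 / 2) (hθ : 1 < θ) :
    ∃ B, 0 ≤ B ∧ ∀ (δ f : ℝ → Vec m) (N s t : ℝ), 0 ≤ N → 0 ≤ s → s ≤ t → t ≤ T →
      ContinuousOn δ (Icc 0 T) → IntervalIntegrable f volume 0 T →
      (∀ r ∈ Icc s t, ‖δ r‖ ≤ N ∧ ‖δ r - δ s‖ ≤ N * (r - s) ^ κ) →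
      (∀ r ∈ Ioc s t, ‖f r‖ ≤ L * N) →
      ‖δ t - δ s - ∑ j, (ζ t j - ζ s j) • incr σ x j s (δ s)‖ ≤ N * (t - s) ^ (2 * κ) →
      ‖δ t - δ s - (∫ r in s..t, f r) - noise ζ A (incr σ x) (incr' σ x) s t (δ s)‖ ≤
        N * (t - s) ^ (κ + 2 / 3) →
      |inner ℝ (p t) (δ t) - inner ℝ (p s) (δ s) -
        ∫ r in s..t, (inner ℝ (p r) (f r) - inner ℝ (η r) (δ r))| ≤
        B * (N * (t - s) ^ (min θ (κ + 2 / 3)) + N ^ 2 * (t - s) ^ κ) := by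
  have hC' := hf.nonneg
  have hK0 : 0 ≤ K := by linarith
  set θ' := min θ (κ + 2 / 3) with hθ'
  have hθ'0 : 0 ≤ θ' := le_min (by linarith) (by linarith)
  have hpT : ∀ a : ℝ, 0 ≤ T ^ a := fun a => Real.rpow_nonneg hT a
  set c₁ : ℝ := T ^ (κ + 2 / 3 - θ') with hc₁
  set c₂ : ℝ := T ^ (θ - θ') with hc₂
  set c₃ : ℝ := T ^ (κ + 2 * κ - θ') with hc₃
  set c₄ : ℝ := T ^ (1 / 3 + 1 - θ') with hc₄
  set c₅ : ℝ := T ^ (κ + 1 - θ') with hc₅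
  set c₆ : ℝ := T ^ (2 * κ - κ) with hc₆
  have hc₁0 : 0 ≤ c₁ := hpT _
  have hc₂0 : 0 ≤ c₂ := hpT _
  have hc₃0 : 0 ≤ c₃ := hpT _
  have hc₄0 : 0 ≤ c₄ := hpT _
  have hc₅0 : 0 ≤ c₅ := hpT _
  have hc₆0 : 0 ≤ c₆ := hpT _
  -- `BN` collects the errors linear in `N`, all of order at least `θ'`. `BQ` collects the Taylor
  -- errors from linearising `incr` and `incr'`, which have only order `κ` in `τ` but are quadratic
  -- in `N`.
  set BN : ℝ := C * c₁ + C * c₂ + d * (C' * K * C) * c₃ + C * c₁ + C * L * c₄ + C * c₅ with hBN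
  set BQ : ℝ := C * (d * C' * K + d ^ 2 * C' * (4 * K ^ 2) * c₆) +
    d * (C' * K * C) * (d * C' * K) * c₆ with hBQ
  have hBN0 : 0 ≤ BN := by positivity
  have hBQ0 : 0 ≤ BQ := by positivity
  refine ⟨BN + BQ, by positivity, ?_⟩
  intro δ f N s t hN hs hst ht hδc hfi hδ hfN hrem hexp
  have hsT : s ∈ Icc 0 T := ⟨hs, hst.trans ht⟩
  have htT : t ∈ Icc 0 T := ⟨hs.trans hst, ht⟩
  have hτ0 : 0 ≤ t - s := sub_nonneg.2 hst
  have hτT : t - s ≤ T := by linarith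
  set τ := t - s with hτ
  have pn : ∀ a : ℝ, 0 ≤ τ ^ a := fun a => Real.rpow_nonneg hτ0 a
  have p1 : τ ^ (κ + 2 / 3) ≤ c₁ * τ ^ θ' := rpow_le_mul_rpow hτ0 hτT hθ'0 (min_le_right _ _)
  have p2 : τ ^ θ ≤ c₂ * τ ^ θ' := rpow_le_mul_rpow hτ0 hτT hθ'0 (min_le_left _ _)
  have p3 : τ ^ κ * τ ^ (2 * κ) ≤ c₃ * τ ^ θ' := by
    rw [mul_rpow_mul_rpow hτ0 (by linarith) (by linarith)]
    exact rpow_le_mul_rpow hτ0 hτT hθ'0 ((min_le_right _ _).trans (by linarith))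
  have p4 : τ ^ (1 / 3 : ℝ) * τ ≤ c₄ * τ ^ θ' := by
    rw [← Real.rpow_add_one' hτ0 (by norm_num)]
    exact rpow_le_mul_rpow hτ0 hτT hθ'0 ((min_le_right _ _).trans (by linarith))
  have p5 : τ ^ κ * τ ≤ c₅ * τ ^ θ' := by
    rw [← Real.rpow_add_one' hτ0 (by linarith)]
    exact rpow_le_mul_rpow hτ0 hτT hθ'0 ((min_le_right _ _).trans (by linarith))
  have p6 : τ ^ (2 * κ) ≤ c₆ * τ ^ κ := rpow_le_mul_rpow hτ0 hτT (by linarith) (by linarith)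
  have p7 : τ ^ (2 / 3 : ℝ) * τ ^ κ = τ ^ (κ + 2 / 3) := by
    rw [mul_rpow_mul_rpow hτ0 (by norm_num) (by linarith), add_comm]
  have hδs : ‖δ s‖ ≤ N := (hδ s ⟨le_rfl, hst⟩).1
  have hδt : ‖δ t - δ s‖ ≤ N * τ ^ κ := (hδ t ⟨hst, le_rfl⟩).2
  have hδs2 : ‖δ s‖ ^ 2 ≤ N ^ 2 := by gcongr
  have hps := hp.norm_le s hsT
  have hZ := hf.path_le s t hs hst ht
  have hA := hf.area_le s t hs hst ht
  set S : Fin d → Vec m →L[ℝ] Vec m := fun j => fderiv ℝ (σ j s) (x s) with hS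
  set Q : Fin d → Fin d → Vec m →L[ℝ] Vec m :=
    fun j i => fderiv ℝ (fderiv ℝ (σ j s)) (x s) (σ i s (x s)) with hQ
  have hadjS : ∀ j, ‖ContinuousLinearMap.adjoint (S j) (p s)‖ ≤ K * C := fun j => by
    refine (ContinuousLinearMap.le_opNorm _ _).trans ?_
    rw [LinearIsometryEquiv.norm_map]
    exact mul_le_mul ((hK j s hsT).norm_fderiv_le _) hps (norm_nonneg _) hK0
  have hquad : ‖∑ j, (ζ t j - ζ s j) • (incr σ x j s (δ s) - S j (δ s))‖ ≤
      d * (C' * τ ^ κ * (K * N ^ 2)) :=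
    norm_sum_smul_le (mul_nonneg hC' (pn κ)) hZ fun j =>
      (norm_incr_sub_le (fun j => hK j s hsT) x j (δ s)).trans (by gcongr)
  have hquad' : ‖∑ j, ∑ i, A s t i j • (incr' σ x j i s (δ s) -
      (Q j i (δ s) + S j (S i (δ s))))‖ ≤ d * (d * (C' * τ ^ (2 * κ) * (4 * K ^ 2 * N ^ 2))) :=
    norm_sum_sum_smul_le (mul_nonneg hC' (pn (2 * κ))) (fun j i => hA i j) fun j i =>
      (norm_incr'_sub_le (fun j => hK j s hsT) x j i (δ s)).trans (by gcongr)
  have hsub : ∀ {E : Type} [NormedAddCommGroup E] {g : ℝ → E}, IntervalIntegrable g volume 0 T →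
      IntervalIntegrable g volume s t := fun hg =>
    hg.mono_set (by rw [uIcc_of_le hT]; exact uIcc_subset_Icc hsT htT)
  have hfi' := hsub hfi
  have hηi' := hsub hp.integrable
  have hst' : Icc s t ⊆ Icc 0 T := Icc_subset_Icc hs ht
  have hint1 : IntervalIntegrable (fun r => inner ℝ (p r) (f r)) volume s t :=
    hsub (intervalIntegrable_inner hT hp.continuousOn hfi)
  have hint2 : IntervalIntegrable (fun r => inner ℝ (η r) (δ r)) volume s t := by
    rw [funext fun r => real_inner_comm (δ r) (η r)]
    exact hsub (intervalIntegrable_inner hT hδc hp.integrable)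
  have t5 : ‖∫ r in s..t, inner ℝ (p s - p r) (f r)‖ ≤ C * τ ^ (1 / 3 : ℝ) * (L * N) * τ := by
    refine (intervalIntegral.norm_integral_le_of_norm_le_const
      (C := C * τ ^ (1 / 3 : ℝ) * (L * N)) fun r hr => ?_).trans (by rw [abs_of_nonneg hτ0])
    rw [uIoc_of_le hst] at hr
    refine (norm_inner_le_norm _ _).trans (mul_le_mul ?_ (hfN r hr) (norm_nonneg _)
      (mul_nonneg hC (pn _)))
    rw [norm_sub_rev]
    refine (hp.holder s r hs hr.1.le (hr.2.trans ht)).trans ?_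
    have : (r - s) ^ (1 / 3 : ℝ) ≤ τ ^ (1 / 3 : ℝ) :=
      Real.rpow_le_rpow (by linarith [hr.1]) (by simp only [hτ]; linarith [hr.2]) (by norm_num)
    gcongr
  have t6 : ‖∫ r in s..t, inner ℝ (η r) (δ r - δ s)‖ ≤ C * (N * τ ^ κ) * τ := by
    refine (intervalIntegral.norm_integral_le_of_norm_le_const
      (C := C * (N * τ ^ κ)) fun r hr => ?_).trans (by rw [abs_of_nonneg hτ0])
    rw [uIoc_of_le hst] at hr
    refine (norm_inner_le_norm _ _).trans (mul_le_mul
      (hp.norm_drift_le r (hst' ⟨hr.1.le, hr.2⟩)) ?_ (norm_nonneg _) hC)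
    refine (hδ r ⟨hr.1.le, hr.2⟩).2.trans ?_
    have : (r - s) ^ κ ≤ τ ^ κ :=
      Real.rpow_le_rpow (by linarith [hr.1]) (by simp only [hτ]; linarith [hr.2]) (by linarith)
    gcongr
  have e5 : ∫ r in s..t, inner ℝ (p s - p r) (f r) =
      inner ℝ (p s) (∫ r in s..t, f r) - ∫ r in s..t, inner ℝ (p r) (f r) := by
    have h1 : inner ℝ (p s) (∫ r in s..t, f r) = ∫ r in s..t, inner ℝ (p s) (f r) :=
      ((innerSL ℝ (p s)).intervalIntegral_comp_comm hfi').symm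
    have h2 : IntervalIntegrable (fun r => inner ℝ (p s) (f r)) volume s t :=
      ⟨(innerSL ℝ (p s)).integrable_comp hfi'.1, (innerSL ℝ (p s)).integrable_comp hfi'.2⟩
    rw [h1, ← intervalIntegral.integral_sub h2 hint1]
    simp only [inner_sub_left]
  have e6 : ∫ r in s..t, inner ℝ (η r) (δ r - δ s) =
      (∫ r in s..t, inner ℝ (η r) (δ r)) - inner ℝ (∫ r in s..t, η r) (δ s) := by
    have h1 : inner ℝ (∫ r in s..t, η r) (δ s) = ∫ r in s..t, inner ℝ (η r) (δ s) := by
      rw [real_inner_comm]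
      rw [funext fun r => real_inner_comm (δ s) (η r)]
      exact ((innerSL ℝ (δ s)).intervalIntegral_comp_comm hηi').symm
    have h2 : IntervalIntegrable (fun r => inner ℝ (η r) (δ s)) volume s t := by
      rw [funext fun r => real_inner_comm (δ s) (η r)]
      exact ⟨(innerSL ℝ (δ s)).integrable_comp hηi'.1, (innerSL ℝ (δ s)).integrable_comp hηi'.2⟩
    rw [h1, ← intervalIntegral.integral_sub hint2 h2]
    simp only [inner_sub_right]
  have halg := inner_increment_eq S Q (fun j => ζ t j - ζ s j) (A s t)
    (hgeo s t hs hst ht) (p s) (p t) (δ s) (δ t)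
  set v₁ : Vec m := δ t - δ s - (∑ j, (ζ t j - ζ s j) • S j (δ s)) -
    ∑ j, ∑ i, A s t i j • (Q j i (δ s) + S j (S i (δ s))) with hv₁
  set v₂ : Vec m := p t - p s + (∑ j, (ζ t j - ζ s j) • ContinuousLinearMap.adjoint (S j) (p s)) +
    ∑ j, ∑ i, A s t i j • (ContinuousLinearMap.adjoint (Q j i) (p s) -
      ContinuousLinearMap.adjoint (S j) (ContinuousLinearMap.adjoint (S i) (p s))) with hv₂
  set v₃ : Vec m := ∑ j, (ζ t j - ζ s j) • ContinuousLinearMap.adjoint (S j) (p s) with hv₃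
  set v₄ : Vec m := δ t - δ s - ∑ j, (ζ t j - ζ s j) • S j (δ s) with hv₄
  have n1 : ‖v₁ - ∫ r in s..t, f r‖ ≤ N * τ ^ (κ + 2 / 3) + d * (C' * τ ^ κ * (K * N ^ 2)) +
      d * (d * (C' * τ ^ (2 * κ) * (4 * K ^ 2 * N ^ 2))) := by
    have : v₁ - ∫ r in s..t, f r =
        (δ t - δ s - (∫ r in s..t, f r) - noise ζ A (incr σ x) (incr' σ x) s t (δ s)) +
        (∑ j, (ζ t j - ζ s j) • (incr σ x j s (δ s) - S j (δ s))) +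
        ∑ j, ∑ i, A s t i j • (incr' σ x j i s (δ s) - (Q j i (δ s) + S j (S i (δ s)))) := by
      simp only [hv₁, hv₄, noise, smul_sub, Finset.sum_sub_distrib]
      abel
    rw [this]
    exact norm_add₃_le.trans (add_le_add (add_le_add hexp hquad) hquad')
  have n2 : ‖v₂ + ∫ r in s..t, η r‖ ≤ C * τ ^ θ := by
    have := hp.expansion s t hs hst ht
    have e : v₂ + ∫ r in s..t, η r = p t - p s + (∫ r in s..t, η r) + v₃ +
        ∑ j, ∑ i, A s t i j • (ContinuousLinearMap.adjoint (Q j i) (p s) -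
          ContinuousLinearMap.adjoint (S j) (ContinuousLinearMap.adjoint (S i) (p s))) := by
      simp only [hv₂]; abel
    rw [e]
    exact this
  have n3 : ‖v₃‖ ≤ d * (C' * τ ^ κ * (K * C)) :=
    norm_sum_smul_le (mul_nonneg hC' (pn κ)) hZ hadjS
  have n4 : ‖v₄‖ ≤ N * τ ^ (2 * κ) + d * (C' * τ ^ κ * (K * N ^ 2)) := by
    have : v₄ = (δ t - δ s - ∑ j, (ζ t j - ζ s j) • incr σ x j s (δ s)) +
        ∑ j, (ζ t j - ζ s j) • (incr σ x j s (δ s) - S j (δ s)) := by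
      simp only [hv₄, smul_sub, Finset.sum_sub_distrib]; abel
    rw [this]
    exact (norm_add_le _ _).trans (add_le_add hrem hquad)
  have n5 : ‖p t - p s + v₃‖ ≤ C * τ ^ (2 / 3 : ℝ) := hp.remainder s t hs hst ht
  -- The exact identity `inner_increment_eq` with the drift integrals inserted. Its last two terms
  -- correct for freezing `p` against `f`, and `δ` against `η`, at time `s`.
  have hid : inner ℝ (p t) (δ t) - inner ℝ (p s) (δ s) -
      ∫ r in s..t, (inner ℝ (p r) (f r) - inner ℝ (η r) (δ r)) =
      inner ℝ (p s) (v₁ - ∫ r in s..t, f r) + inner ℝ (v₂ + ∫ r in s..t, η r) (δ s) -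
      inner ℝ v₃ v₄ + inner ℝ (p t - p s + v₃) (δ t - δ s) +
      (∫ r in s..t, inner ℝ (p s - p r) (f r)) + ∫ r in s..t, inner ℝ (η r) (δ r - δ s) := by
    rw [halg, intervalIntegral.integral_sub hint1 hint2, e5, e6, inner_sub_right (p s) v₁,
      inner_add_left v₂]
    ring
  clear_value v₁ v₂ v₃ v₄
  have ib : ∀ {v w : Vec m} {a b : ℝ}, ‖v‖ ≤ a → ‖w‖ ≤ b → 0 ≤ a → |inner ℝ v w| ≤ a * b :=
    fun hv hw ha => (abs_real_inner_le_norm _ _).trans (mul_le_mul hv hw (norm_nonneg _) ha)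
  have i1 := ib hps n1 hC
  have i2 := ib n2 hδs (mul_nonneg hC (pn θ))
  have i3 := ib n3 n4 ((norm_nonneg _).trans n3)
  have i4 := ib n5 hδt (mul_nonneg hC (pn _))
  rw [Real.norm_eq_abs] at t5 t6
  rw [hid]
  have habs : ∀ a b c e f g : ℝ, |a + b - c + e + f + g| ≤ |a| + |b| + |c| + |e| + |f| + |g| := by
    intro a b c e f g
    refine (abs_add_le _ _).trans (add_le_add_left ((abs_add_le _ _).trans (add_le_add_left
      ((abs_add_le _ _).trans (add_le_add_left ((abs_sub _ _).trans (add_le_add_left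
      (abs_add_le _ _) _)) _)) _)) _)
  refine (habs _ _ _ _ _ _).trans ((add_le_add (add_le_add (add_le_add (add_le_add
    (add_le_add i1 i2) i3) i4) t5) t6).trans ?_)
  have hNθ : 0 ≤ N * τ ^ θ' := mul_nonneg hN (pn _)
  have hNκ : 0 ≤ N ^ 2 * τ ^ κ := mul_nonneg (sq_nonneg _) (pn _)
  have pκ2 : τ ^ κ * τ ^ κ = τ ^ (2 * κ) := by
    rw [mul_rpow_mul_rpow hτ0 (by linarith) (by linarith)]; congr 1; ring
  calc _ = C * N * τ ^ (κ + 2 / 3) + C * N * τ ^ θ +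
        d * (C' * K * C) * N * (τ ^ κ * τ ^ (2 * κ)) + C * N * (τ ^ (2 / 3 : ℝ) * τ ^ κ) +
        C * L * N * (τ ^ (1 / 3 : ℝ) * τ) + C * N * (τ ^ κ * τ) +
        (C * (d * C' * K * τ ^ κ + d ^ 2 * C' * (4 * K ^ 2) * τ ^ (2 * κ)) * N ^ 2 +
          d * (C' * K * C) * (d * C' * K) * N ^ 2 * (τ ^ κ * τ ^ κ)) := by ring
    _ ≤ BN * (N * τ ^ θ') + BQ * (N ^ 2 * τ ^ κ) := by
        rw [p7, pκ2]
        have q1 : 0 ≤ C * N := mul_nonneg hC hN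
        have q2 : 0 ≤ d * (C' * K * C) * N := by positivity
        have q3 : 0 ≤ C * L * N := by positivity
        have q4 : 0 ≤ C * (d ^ 2 * C' * (4 * K ^ 2)) * N ^ 2 := by positivity
        have q5 : 0 ≤ d * (C' * K * C) * (d * C' * K) * N ^ 2 := by positivity
        have r1 := mul_le_mul_of_nonneg_left p1 q1
        have r2 := mul_le_mul_of_nonneg_left p2 q1
        have r3 := mul_le_mul_of_nonneg_left p3 q2
        have r4 := mul_le_mul_of_nonneg_left p4 q3
        have r5 := mul_le_mul_of_nonneg_left p5 q1
        have r6 := mul_le_mul_of_nonneg_left p6 q4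
        have r7 := mul_le_mul_of_nonneg_left p6 q5
        rw [hBN, hBQ]
        linear_combination r1 + r2 + r3 + r1 + r4 + r5 + r6 + r7
    _ ≤ (BN + BQ) * (N * τ ^ θ') + (BN + BQ) * (N ^ 2 * τ ^ κ) := 
        add_le_add (mul_le_mul_of_nonneg_right (by linarith) hNθ)
          (mul_le_mul_of_nonneg_right (by linarith) hNκ)
    _ = _ := by ring

end RoughControl

/-! ### Global duality estimate and bounds for the adjoint path -/

namespace RoughControl

theorem abs_sub_le_of_increment_le {V : ℝ → ℝ} {u T w : ℝ} {n : ℕ} (hn : 0 < n) (huT : u ≤ T)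
    (h : ∀ s t, u ≤ s → s ≤ t → t ≤ T → t - s = (T - u) / n → |V t - V s| ≤ w) :
    |V T - V u| ≤ n * w := by
  have hn' : (0 : ℝ) < n := by exact_mod_cast hn
  set τ := (T - u) / n with hτ
  have hτ0 : 0 ≤ τ := div_nonneg (sub_nonneg.2 huT) hn'.le
  have hnτ : n * τ = T - u := by rw [hτ]; field_simp
  have key := dist_le_range_sum_of_dist_le (f := fun i : ℕ => V (u + i * τ)) (d := fun _ => w) n
    fun {i} hi => by
      rw [dist_comm, Real.dist_eq]
      have hi' : ((i : ℝ) + 1) ≤ n := by exact_mod_cast hi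
      have h1 : ((i : ℝ) + 1) * τ ≤ n * τ := mul_le_mul_of_nonneg_right hi' hτ0
      have h2 : 0 ≤ (i : ℝ) * τ := by positivity
      push_cast
      exact h _ _ (by linarith) (by linarith) (by linarith) (by ring)
  rw [dist_comm, Real.dist_eq] at key
  simpa [hnτ] using key

variable {m d : ℕ}

open Filter Topology in
/-- After a perturbation of the drift has ended, the duality pairing of the perturbation with the
adjoint path satisfies an ordinary equation up to an error of lower order. -/
theorem AdjointPath.inner_integral_le {T κ θ C C' L K Λ : ℝ} {ζ : ℝ → Vec d}
    {A : ℝ → ℝ → Fin d → Fin d → ℝ} {σ : Fin d → ℝ → Vec m → Vec m} {x η p : ℝ → Vec m}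
    (hp : AdjointPath T θ C ζ A (fun j s => fderiv ℝ (σ j s) (x s))
      (fun j i s => fderiv ℝ (fderiv ℝ (σ j s)) (x s) (σ i s (x s))) η p)
    (hf : RoughField T κ C' ζ A (incr σ x) (incr' σ x))
    (hgeo : ∀ s t, 0 ≤ s → s ≤ t → t ≤ T → ∀ i j,
      A s t i j + A s t j i = (ζ t i - ζ s i) * (ζ t j - ζ s j))
    (hK : ∀ j, ∀ t ∈ Icc 0 T, BoundedC3 K (σ j t)) (hK1 : 1 ≤ K) (hT : 0 ≤ T) (hC : 0 ≤ C)
    (hL : 0 ≤ L) (hκ : 1 / 3 < κ) (hκ2 : κ ≤ 1 / 2) (hθ : 1 < θ) (hΛ : 0 ≤ Λ) {ε : ℝ}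
    (hε : 0 < ε) :
    ∃ N₀, 0 < N₀ ∧ ∀ D δ u, LipschitzDrift T L D →
      (∀ z, ContinuousOn z (Icc 0 T) → IntervalIntegrable (fun r => D r (z r)) volume 0 T) →
      LinearGrowthSolution T κ Λ ζ A (incr σ x) (incr' σ x) D δ → 0 ≤ u → u ≤ T →
      (∀ r ∈ Ioc u T, D r 0 = 0) → ‖δ u‖ ≤ N₀ →
      |inner ℝ (p T) (δ T) - inner ℝ (p u) (δ u) -
        ∫ r in u..T, (inner ℝ (p r) (D r (δ r)) - inner ℝ (η r) (δ r))| ≤ ε * ‖δ u‖ := by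
  obtain ⟨B, hB, key⟩ := hp.inner_increment_le hf hgeo hK hK1 hT hC hL hκ hκ2 hθ
  set θ' := min θ (κ + 2 / 3) with hθ'
  have hθ'1 : 1 < θ' := lt_min hθ (by linarith)
  have hlim : Tendsto (fun n : ℕ => B * Λ * T ^ θ' * (n : ℝ) ^ (-(θ' - 1))) atTop (𝓝 0) := by
    have := ((tendsto_rpow_neg_atTop (sub_pos.2 hθ'1)).comp tendsto_natCast_atTop_atTop).const_mul
      (B * Λ * T ^ θ')
    rwa [mul_zero] at this
  -- The number of steps is fixed first: as `θ' > 1`, `n * (T / n) ^ θ'` tends to zero, so the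
  -- linear errors sum to at most `ε / 2` times `‖δ u‖`.
  obtain ⟨n, hn, hn0⟩ := ((hlim.eventually (gt_mem_nhds (half_pos hε))).and
    (eventually_gt_atTop 0)).exists
  have hn' : (0 : ℝ) < n := by exact_mod_cast hn0
  set M : ℝ := n * (B * (Λ ^ 2 * (T / n) ^ κ)) with hM
  have hTn : 0 ≤ T / n := by positivity
  have hM0 : 0 ≤ M := by positivity
  -- With `n` fixed, the quadratic errors sum to `M * ‖δ u‖ ^ 2`; smallness of `‖δ u‖` makes this at
  -- most `ε / 2 * ‖δ u‖`.
  refine ⟨ε / 2 / (M + 1), by positivity, ?_⟩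
  intro D δ u hD hDz hδ hu huT hD0 hδu
  have hc : ∀ t ≤ T, ∀ r ∈ Ioc u t, ‖D r 0‖ ≤ 0 := fun t ht r hr => by
    rw [hD0 r ⟨hr.1, hr.2.trans ht⟩, norm_zero]
  set N := Λ * ‖δ u‖ with hN
  have hN0 : 0 ≤ N := by positivity
  set g : ℝ → ℝ := fun r => inner ℝ (p r) (D r (δ r)) - inner ℝ (η r) (δ r) with hg
  have hDδ := hDz δ hδ.continuousOn
  have hgi : IntervalIntegrable g volume 0 T := by
    refine (intervalIntegrable_inner hT hp.continuousOn hDδ).sub ?_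
    rw [funext fun r => real_inner_comm (δ r) (η r)]
    exact intervalIntegrable_inner hT hδ.continuousOn hp.integrable
  have hgi' : ∀ t, u ≤ t → t ≤ T → IntervalIntegrable g volume u t := fun t hut ht =>
    hgi.mono_set (by rw [uIcc_of_le hT]; exact uIcc_subset_Icc ⟨hu, huT⟩ ⟨hu.trans hut, ht⟩)
  have hδn : ∀ r, u ≤ r → r ≤ T → ‖δ r‖ ≤ N := fun r hur hr => by
    have := hδ.norm_le u r 0 hu hur hr le_rfl (hc r hr)
    rwa [add_zero] at this
  have htel := abs_sub_le_of_increment_le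
    (V := fun t => inner ℝ (p t) (δ t) - ∫ r in u..t, g r) (w := B * (N * (T / n) ^ θ' +
      N ^ 2 * (T / n) ^ κ)) hn0 huT fun s t hus hst ht hτ => by
    have h1 := key δ (fun r => D r (δ r)) N s t hN0 (hu.trans hus) hst ht hδ.continuousOn hDδ
      (fun r hr => ⟨hδn r (hus.trans hr.1) (hr.2.trans ht), by
        have := hδ.holder u s r 0 hu hus hr.1 (hr.2.trans ht) le_rfl (hc r (hr.2.trans ht))
        rwa [add_zero] at this⟩)
      (fun r hr => by
        have hur : u < r := hus.trans_lt hr.1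
        have hrT : r ≤ T := hr.2.trans ht
        have := hD.norm_le (c := 0) (r := r) ⟨hu.trans hur.le, hrT⟩
          (hc T le_rfl r ⟨hur, hrT⟩) (δ r)
        rw [add_zero] at this
        exact this.trans (mul_le_mul_of_nonneg_left (hδn r hur.le hrT) hL))
      (by
        have := hδ.remainder u s t 0 hu hus hst ht le_rfl (hc t ht)
        rwa [add_zero] at this)
      (by
        have := hδ.expansion u s t 0 hu hus hst ht le_rfl (hc t ht)
        rwa [add_zero] at this)
    have h2 : (∫ r in u..t, g r) - ∫ r in u..s, g r = ∫ r in s..t, g r :=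
      intervalIntegral.integral_interval_sub_left (hgi' t (hus.trans hst) ht)
        (hgi' s hus (hst.trans ht))
    have h3 : inner ℝ (p t) (δ t) - (∫ r in u..t, g r) -
        (inner ℝ (p s) (δ s) - ∫ r in u..s, g r) =
        inner ℝ (p t) (δ t) - inner ℝ (p s) (δ s) - ∫ r in s..t, g r := by
      rw [← h2]; ring
    rw [h3]
    refine h1.trans ?_
    have hle : t - s ≤ T / n := by rw [hτ]; gcongr; linarith
    have h0 : 0 ≤ t - s := sub_nonneg.2 hst
    have e1 := Real.rpow_le_rpow h0 hle (by linarith : 0 ≤ θ')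
    have e2 := Real.rpow_le_rpow h0 hle (by linarith : 0 ≤ κ)
    gcongr
  have hfin : inner ℝ (p T) (δ T) - (∫ r in u..T, g r) - (inner ℝ (p u) (δ u) - ∫ r in u..u, g r)
      = inner ℝ (p T) (δ T) - inner ℝ (p u) (δ u) - ∫ r in u..T, g r := by
    rw [intervalIntegral.integral_same]; ring
  rw [hfin] at htel
  refine htel.trans ?_
  have hsplit : (n : ℝ) * (T / n) ^ θ' = T ^ θ' * (n : ℝ) ^ (-(θ' - 1)) := by
    rw [Real.div_rpow hT hn'.le, neg_sub, Real.rpow_sub hn', Real.rpow_one]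
    ring
  have e1 : (n : ℝ) * (B * (N * (T / n) ^ θ' + N ^ 2 * (T / n) ^ κ)) =
      (B * Λ * T ^ θ' * (n : ℝ) ^ (-(θ' - 1))) * ‖δ u‖ + M * ‖δ u‖ * ‖δ u‖ := by
    rw [hM, hN]
    linear_combination B * Λ * ‖δ u‖ * hsplit
  have e2 : M * ‖δ u‖ ≤ ε / 2 := by
    calc M * ‖δ u‖ ≤ (M + 1) * (ε / 2 / (M + 1)) := by gcongr; linarith
      _ = ε / 2 := by field_simp
  rw [e1]
  have := norm_nonneg (δ u)
  calc _ ≤ ε / 2 * ‖δ u‖ + ε / 2 * ‖δ u‖ := by gcongr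
    _ = _ := by ring

/-- The adjoint equation in quantitative form. -/
theorem SolvesAdjoint.exists_adjointPath {k : ℕ} {α T : ℝ} {ζ : ℝ → Vec d}
    {A : ℝ → ℝ → Fin d → Fin d → ℝ} {U : Set (Vec k)} {K : Set (ProbabilityMeasure U)}
    {b : ℝ → Vec m → Vec k → Vec m} (hb : IsDriftCoeff T U b) {σ : Fin d → ℝ → Vec m → Vec m}
    {F : ℝ → Vec m → ProbabilityMeasure U → ℝ} (hF : IsRunningReward T K F) {G : Vec m → ℝ}
    {x : ℝ → Vec m} {γ : ℝ → ProbabilityMeasure U} (hγ : ∀ t ∈ Icc 0 T, γ t ∈ K) {p : ℝ → Vec m}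
    (hp : SolvesAdjoint α T ζ A b σ F G x γ p) :
    ∃ θ C, 1 < θ ∧ 0 ≤ C ∧ AdjointPath T θ C ζ A (fun j s => fderiv ℝ (σ j s) (x s))
      (fun j i s => fderiv ℝ (fderiv ℝ (σ j s)) (x s) (σ i s (x s)))
      (fun t => ContinuousLinearMap.adjoint
        (∫ a : U, fderiv ℝ (fun z => b t z a) (x t) ∂(γ t : Measure U)) (p t)
        + gradient (fun z => F t z (γ t)) (x t)) p := by
  obtain ⟨-, ⟨κ, hκ, -, hctrl⟩, hint, I, ⟨-, θ, c, hθ, hI⟩, heq⟩ := hp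
  have h3 := hctrl.mono (κ' := 1 / 3) (by norm_num) hκ.le
  obtain ⟨c1, h1⟩ := h3.holder
  obtain ⟨c2, h2⟩ := h3.remainder
  have hpc : ContinuousOn p (Icc 0 T) := by
    simpa only [neg_neg] using (h3.continuousOn (by norm_num)).fun_neg
  obtain ⟨c3, hc3⟩ := isCompact_Icc.exists_bound_of_continuousOn hpc
  obtain ⟨c4, hc4⟩ := hb.exists_norm_integral_fderiv_le
  obtain ⟨c5, hc5⟩ := hF.bounded_gradient
  have n1 := abs_nonneg c1
  have n2 := abs_nonneg c2
  have n3 := abs_nonneg c3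
  have n4 := abs_nonneg c4
  have n5 := abs_nonneg c5
  have n6 := abs_nonneg c
  set C := |c| + |c1| + |c2| + |c3| + |c4| * |c3| + |c5| with hC
  have n7 : 0 ≤ |c4| * |c3| := by positivity
  have hle : ∀ {v a τ e : ℝ}, v ≤ a * τ ^ e → 0 ≤ τ → |a| ≤ C → v ≤ C * τ ^ e :=
    fun hv hτ ha => hv.trans
      (mul_le_mul_of_nonneg_right ((le_abs_self _).trans ha) (Real.rpow_nonneg hτ _))
  refine ⟨θ, C, hθ, by positivity, hint, fun t ht => ?_, fun t ht => ?_, hpc, ?_, ?_, ?_⟩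
  · have e1 := hc4 t ht (x t) (γ t)
    have e2 := hc5 t ht (x t) (γ t) (hγ t ht)
    have e3 := hc3 t ht
    refine (norm_add_le _ _).trans ?_
    have e4 : ‖ContinuousLinearMap.adjoint
        (∫ a : U, fderiv ℝ (fun z => b t z a) (x t) ∂(γ t : Measure U)) (p t)‖ ≤ |c4| * |c3| := by
      refine (ContinuousLinearMap.le_opNorm _ _).trans ?_
      rw [LinearIsometryEquiv.norm_map]
      exact mul_le_mul (e1.trans (le_abs_self _)) (e3.trans (le_abs_self _)) (norm_nonneg _) n4
    linarith [le_abs_self c5]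
  · linarith [hc3 t ht, le_abs_self c3]
  · intro s t hs hst ht
    have := h1 s t hs hst ht
    rw [neg_sub_neg, norm_sub_rev] at this
    exact hle this (sub_nonneg.2 hst) (by linarith)
  · intro s t hs hst ht
    have := h2 s t hs hst ht
    rw [← norm_neg, show (2 * (1 / 3) : ℝ) = 2 / 3 by norm_num] at this
    refine le_of_eq_of_le ?_ (hle this (sub_nonneg.2 hst) (by linarith))
    congr 1
    abel
  · intro s t hs hst ht
    have e1 := hI s t hs hst ht
    have e2 := heq s t hs hst ht
    rw [← norm_neg] at e1
    refine le_of_eq_of_le ?_ (hle e1 (sub_nonneg.2 hst) (by linarith))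
    congr 1
    rw [eq_sub_of_add_eq' e2.symm]
    abel

end RoughControl

/-! ### Limits of difference quotients and needle variations -/

namespace RoughControl

open Filter Topology in
-- Right differentiation of an integral at a point of continuity, stable under perturbations of the
-- integrand of size `O(h)`.
theorem tendsto_inv_smul_integral {E : Type*} [NormedAddCommGroup E] [NormedSpace ℝ E]
    [CompleteSpace E] {T t c : ℝ} (ht : t ∈ Ico 0 T) {φ : ℝ → E} (hφ : ContinuousOn φ (Icc 0 T))
    {ψ : ℝ → ℝ → E} (hψ : ∀ h ∈ Ioo 0 (T - t), IntervalIntegrable (ψ h) volume t (t + h) ∧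
      ∀ r ∈ Ioc t (t + h), ‖ψ h r - φ r‖ ≤ c * h) :
    Tendsto (fun h => h⁻¹ • ∫ r in t..t + h, ψ h r) (𝓝[>] 0) (𝓝 (φ t)) := by
  rw [Metric.tendsto_nhds]
  intro ε hε
  obtain ⟨δ, hδ, hδφ⟩ := Metric.continuousOn_iff.1 hφ t ⟨ht.1, ht.2.le⟩ (ε / 2) (half_pos hε)
  have hc : Tendsto (fun h : ℝ => c * h) (𝓝[>] 0) (𝓝 0) := by
    have : Tendsto (fun h : ℝ => c * h) (𝓝 0) (𝓝 (c * 0)) := tendsto_id.const_mul c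
    rw [mul_zero] at this
    exact this.mono_left nhdsWithin_le_nhds
  filter_upwards [Ioo_mem_nhdsGT (sub_pos.2 ht.2), Ioo_mem_nhdsGT hδ,
    hc.eventually (gt_mem_nhds (half_pos hε))] with h hh hhδ hhc
  obtain ⟨hi, hle⟩ := hψ h hh
  have h0 : 0 < h := hh.1
  have e1 : ∫ r in t..t + h, (ψ h r - φ t) = (∫ r in t..t + h, ψ h r) - h • φ t := by
    rw [intervalIntegral.integral_sub hi intervalIntegrable_const,
      intervalIntegral.integral_const, add_sub_cancel_left]
  have e2 : h⁻¹ • (∫ r in t..t + h, ψ h r) - φ t = h⁻¹ • ∫ r in t..t + h, (ψ h r - φ t) := by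
    rw [e1, smul_sub, inv_smul_smul₀ h0.ne']
  have e3 : ‖∫ r in t..t + h, (ψ h r - φ t)‖ ≤ (c * h + ε / 2) * h := by
    refine (intervalIntegral.norm_integral_le_of_norm_le_const (C := c * h + ε / 2)
      fun r hr => ?_).trans (by rw [add_sub_cancel_left, abs_of_pos h0])
    rw [uIoc_of_le (by linarith)] at hr
    have h1 := hδφ r ⟨ht.1.trans hr.1.le, by linarith [hr.2, hh.2]⟩ (by
      rw [Real.dist_eq, abs_of_pos (sub_pos.2 hr.1)]
      linarith [hr.2, hhδ.2])
    rw [dist_eq_norm] at h1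
    rw [← sub_add_sub_cancel (ψ h r) (φ r) (φ t)]
    exact (norm_add_le _ _).trans (add_le_add (hle r hr) h1.le)
  rw [dist_eq_norm, e2, norm_smul, norm_inv, Real.norm_of_nonneg h0.le]
  calc h⁻¹ * ‖∫ r in t..t + h, (ψ h r - φ t)‖ ≤ h⁻¹ * ((c * h + ε / 2) * h) := by gcongr
    _ = c * h + ε / 2 := by field_simp
    _ < ε := by linarith

open Filter Topology in
/-- First-order remainders along perturbations of size `O(h)` are negligible in mean. -/
theorem tendsto_inv_mul_integral_remainder {E : Type*} [NormedAddCommGroup E]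
    [InnerProductSpace ℝ E] [CompleteSpace E] {T h₀ c C : ℝ} (hT : 0 ≤ T) (hh₀ : 0 < h₀)
    {Φ : ℝ → E → ℝ} {x η : ℝ → E} {δ : ℝ → ℝ → E} (hc : 0 ≤ c)
    (hΦ : ∀ r ∈ Icc 0 T, HasGradientAt (Φ r) (η r) (x r))
    (hlip : ∀ r ∈ Icc 0 T, ∀ e, |Φ r (x r + e) - Φ r (x r) - inner ℝ (η r) e| ≤ c * ‖e‖)
    (hδ : ∀ h ∈ Ioo 0 h₀, ∀ r ∈ Icc 0 T, ‖δ h r‖ ≤ C * h)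
    (hint : ∀ h ∈ Ioo 0 h₀, IntervalIntegrable
      (fun r => Φ r (x r + δ h r) - Φ r (x r) - inner ℝ (η r) (δ h r)) volume 0 T) :
    Tendsto (fun h => h⁻¹ * ∫ r in (0 : ℝ)..T,
      |Φ r (x r + δ h r) - Φ r (x r) - inner ℝ (η r) (δ h r)|) (𝓝[>] 0) (𝓝 0) := by
  have hev : ∀ᶠ h : ℝ in 𝓝[>] 0, h ∈ Ioo 0 h₀ := Ioo_mem_nhdsGT hh₀
  -- Differentiability of `Φ r` at `x r` has no modulus uniform in `r`, so the limit is taken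
  -- pointwise in `r`; the Lipschitz bound with `‖δ h r‖ ≤ C * h` gives the dominating constant `c *
  -- C`.
  have key := intervalIntegral.tendsto_integral_filter_of_dominated_convergence (a := 0) (b := T)
    (μ := volume) (l := 𝓝[>] (0 : ℝ)) (fun _ => c * C)
    (F := fun h r => h⁻¹ * |Φ r (x r + δ h r) - Φ r (x r) - inner ℝ (η r) (δ h r)|)
    (f := fun _ => 0) ?_ ?_ intervalIntegrable_const ?_
  · simpa only [intervalIntegral.integral_const_mul, intervalIntegral.integral_zero] using key
  · filter_upwards [hev] with h hh
    have := (hint h hh).norm.const_mul h⁻¹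
    exact (intervalIntegrable_iff.1 this).aestronglyMeasurable
  · filter_upwards [hev] with h hh
    refine ae_of_all _ fun r hr => ?_
    rw [uIoc_of_le hT] at hr
    have hr' := Ioc_subset_Icc_self hr
    rw [Real.norm_of_nonneg (mul_nonneg (inv_nonneg.2 hh.1.le) (abs_nonneg _)),
      inv_mul_le_iff₀ hh.1]
    refine (hlip r hr' _).trans ?_
    calc c * ‖δ h r‖ ≤ c * (C * h) := by gcongr; exact hδ h hh r hr'
      _ = h * (c * C) := by ring
  · refine ae_of_all _ fun r hr => ?_
    rw [uIoc_of_le hT] at hr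
    have hr' := Ioc_subset_Icc_self hr
    have hO : (fun h => δ h r) =O[𝓝[>] 0] (fun h : ℝ => h) :=
      Asymptotics.IsBigO.of_bound C (by
        filter_upwards [hev] with h hh
        rw [Real.norm_of_nonneg hh.1.le]
        exact hδ h hh r hr')
    have h0 : Tendsto (fun h => δ h r) (𝓝[>] 0) (𝓝 0) :=
      hO.trans_tendsto (tendsto_id.mono_left nhdsWithin_le_nhds)
    have hl := ((hasFDerivAt_iff_isLittleO_nhds_zero.1 (hΦ r hr').hasFDerivAt).comp_tendsto
      h0).trans_isBigO hO
    have := (hl.tendsto_div_nhds_zero).abs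
    rw [abs_zero] at this
    refine this.congr' ?_
    filter_upwards [hev] with h hh
    simp only [Function.comp_apply, InnerProductSpace.toDual_apply_apply]
    rw [abs_div, abs_of_pos hh.1, div_eq_inv_mul]

variable {m d k : ℕ} {U : Set (Vec k)}

open Classical in
/-- The needle variation of `γ` with value `ν` on `(t, t + h]`. -/
noncomputable def spike (γ : ℝ → ProbabilityMeasure U) (ν : ProbabilityMeasure U) (t h : ℝ) :
    ℝ → ProbabilityMeasure U :=
  fun r => if r ∈ Ioc t (t + h) then ν else γ r

theorem spike_of_mem {γ : ℝ → ProbabilityMeasure U} {ν : ProbabilityMeasure U} {t h r : ℝ}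
    (hr : r ∈ Ioc t (t + h)) : spike γ ν t h r = ν := if_pos hr

theorem spike_of_notMem {γ : ℝ → ProbabilityMeasure U} {ν : ProbabilityMeasure U} {t h r : ℝ}
    (hr : r ∉ Ioc t (t + h)) : spike γ ν t h r = γ r := if_neg hr

theorem IsRelaxedControl.spike {T : ℝ} {K : Set (ProbabilityMeasure U)}
    {γ : ℝ → ProbabilityMeasure U} (hγ : IsRelaxedControl T K γ) {ν : ProbabilityMeasure U}
    (hν : ν ∈ K) (t h : ℝ) : IsRelaxedControl T K (spike γ ν t h) := by
  classical
  refine ⟨fun r hr => ?_, ?_⟩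
  · by_cases hrt : r ∈ Ioc t (t + h)
    · rwa [spike_of_mem hrt]
    · rw [spike_of_notMem hrt]; exact hγ.mem r hr
  · have hs : MeasurableSet {r : Icc (0 : ℝ) T | (r : ℝ) ∈ Ioc t (t + h)} :=
      measurable_subtype_coe measurableSet_Ioc
    have : Measurable fun r : Icc (0 : ℝ) T =>
        if (r : ℝ) ∈ Ioc t (t + h) then (ν : Measure U) else γ r :=
      Measurable.ite hs measurable_const hγ.measurable
    convert this using 2 with r
    by_cases hrt : (r : ℝ) ∈ Ioc t (t + h)
    · rw [spike_of_mem hrt, if_pos hrt]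
    · rw [spike_of_notMem hrt, if_neg hrt]

theorem IsDriftCoeff.intervalIntegrable_spike {T : ℝ} (hT : 0 ≤ T)
    {b : ℝ → Vec m → Vec k → Vec m} (hb : IsDriftCoeff T U b) {γ : ℝ → ProbabilityMeasure U}
    (hγ : ContinuousOn γ (Icc 0 T)) (ν : ProbabilityMeasure U) (t h : ℝ) {z : ℝ → Vec m}
    (hz : ContinuousOn z (Icc 0 T)) :
    IntervalIntegrable (fun r => meanDrift b (spike γ ν t h r) r (z r)) volume 0 T := by
  classical
  have h1 := (hb.continuousOn_meanDrift (continuousOn_const (c := ν)) hz).integrableOn_Icc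
    (μ := volume)
  have h2 := (hb.continuousOn_meanDrift hγ hz).integrableOn_Icc (μ := volume)
  rw [intervalIntegrable_iff_integrableOn_Icc_of_le hT]
  have h3 := Integrable.piecewise (s := Ioc t (t + h)) measurableSet_Ioc
    (Integrable.integrableOn h1) (Integrable.integrableOn h2)
  refine h3.congr (ae_of_all _ fun r => ?_)
  by_cases hrt : r ∈ Ioc t (t + h)
  · simp only [piecewise_eq_of_mem _ _ _ hrt, spike_of_mem hrt]
  · simp only [piecewise_eq_of_notMem _ _ _ hrt, spike_of_notMem hrt]

theorem driftDiff_spike_zero {b : ℝ → Vec m → Vec k → Vec m} {γ : ℝ → ProbabilityMeasure U}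
    {ν : ProbabilityMeasure U} {x : ℝ → Vec m} {t h r : ℝ} (hr : r ∉ Ioc t (t + h)) :
    driftDiff b γ (spike γ ν t h) x r 0 = 0 := by
  rw [driftDiff, spike_of_notMem hr, add_zero, sub_self]

theorem IsDriftCoeff.lipschitzDrift {T C : ℝ} (hT : 0 ≤ T) {b : ℝ → Vec m → Vec k → Vec m}
    (hb : IsDriftCoeff T U b) {γ : ℝ → ProbabilityMeasure U}
    (hγ : ContinuousOn γ (Icc 0 T)) {x : ℝ → Vec m} (hx : ContinuousOn x (Icc 0 T))
    (hC : ∀ t ∈ Icc 0 T, ∀ x x', ∀ ν : ProbabilityMeasure U,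
      ‖meanDrift b ν t x - meanDrift b ν t x'‖ ≤ C * ‖x - x'‖)
    {γ' : ℝ → ProbabilityMeasure U} (hγ' : ∀ z : ℝ → Vec m, ContinuousOn z (Icc 0 T) →
      IntervalIntegrable (fun r => meanDrift b (γ' r) r (z r)) volume 0 T) :
    LipschitzDrift T C (driftDiff b γ γ' x) ∧ ∀ z, ContinuousOn z (Icc 0 T) →
      IntervalIntegrable (fun r => driftDiff b γ γ' x r (z r)) volume 0 T := by
  have h1 : ∀ z, ContinuousOn z (Icc 0 T) →
      IntervalIntegrable (fun r => driftDiff b γ γ' x r (z r)) volume 0 T := fun z hz =>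
    (hγ' _ (hx.add hz)).sub ((hb.continuousOn_meanDrift hγ hx).intervalIntegrable_of_Icc hT)
  refine ⟨⟨fun e => h1 _ continuousOn_const, fun r hr e e' => ?_⟩, h1⟩
  rw [driftDiff, driftDiff, sub_sub_sub_cancel_right]
  have := hC r hr (x r + e) (x r + e') (γ' r)
  rwa [add_sub_add_left_eq_sub] at this

section Spike

variable {T κ Λ C t h : ℝ} {ζ : ℝ → Vec d} {A : ℝ → ℝ → Fin d → Fin d → ℝ}
  {b : ℝ → Vec m → Vec k → Vec m} {σ : Fin d → ℝ → Vec m → Vec m} {x δ : ℝ → Vec m}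
  {γ : ℝ → ProbabilityMeasure U} {ν : ProbabilityMeasure U}

/-- Before the needle the drift vanishes at zero, so the growth bound started at time `0` with `c =
0` forces the value zero. It takes the place of uniqueness. -/
theorem LinearGrowthSolution.eq_zero_of_le
    (hδ : LinearGrowthSolution T κ Λ ζ A (incr σ x) (incr' σ x)
      (driftDiff b γ (spike γ ν t h) x) δ) (htT : t ≤ T) {r : ℝ} (hr : 0 ≤ r) (hrt : r ≤ t) :
    δ r = 0 := by
  have := hδ.norm_le 0 r 0 le_rfl hr (hrt.trans htT) le_rfl fun r' hr' => by
    rw [driftDiff_spike_zero fun h' => (hr'.2.trans hrt).not_gt h'.1, norm_zero]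
  rwa [hδ.zero, norm_zero, add_zero, mul_zero, norm_le_zero_iff] at this

theorem norm_driftDiff_le (hC : ∀ t ∈ Icc 0 T, ∀ x, ∀ ν : ProbabilityMeasure U,
      ‖meanDrift b ν t x‖ ≤ C) {r : ℝ} (hr : r ∈ Icc 0 T) (γ' : ℝ → ProbabilityMeasure U)
    (e : Vec m) : ‖driftDiff b γ γ' x r e‖ ≤ 2 * C := by
  rw [driftDiff, two_mul]
  exact (norm_sub_le _ _).trans (add_le_add (hC r hr _ _) (hC r hr _ _))

/-- The expansion is based at `t`, where `δ` is zero, and there the compensated noise increment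
vanishes too. -/
theorem LinearGrowthSolution.norm_sub_integral_le
    (hδ : LinearGrowthSolution T κ Λ ζ A (incr σ x) (incr' σ x)
      (driftDiff b γ (spike γ ν t h) x) δ)
    (hC0 : 0 ≤ C)
    (hC : ∀ t ∈ Icc 0 T, ∀ x, ∀ ν : ProbabilityMeasure U, ‖meanDrift b ν t x‖ ≤ C)
    (ht : 0 ≤ t) {r : ℝ} (htr : t ≤ r) (hr : r ≤ T) :
    ‖δ r - ∫ r' in t..r, driftDiff b γ (spike γ ν t h) x r' (δ r')‖ ≤
      Λ * (2 * C) * (r - t) ^ (κ + 2 / 3) := by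
  have h0 := hδ.eq_zero_of_le (htr.trans hr) ht le_rfl
  have := hδ.expansion t t r (2 * C) ht le_rfl htr hr (by positivity) fun r' hr' =>
    norm_driftDiff_le hC ⟨ht.trans hr'.1.le, hr'.2.trans hr⟩ _ _
  have hn : noise ζ A (incr σ x) (incr' σ x) t r (0 : Vec m) = 0 := by
    simp [noise, incr, incr']
  rwa [h0, hn, norm_zero, zero_add, sub_zero, sub_zero] at this

/-- The order `h`, rather than `h ^ κ`, is essential for dividing by `h`. On the needle, `δ` is a
drift integral of order `h` up to an error of order `κ + 2/3 > 1`. After it, the growth bound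
restarts at `t + h` with `c = 0` and only multiplies by `Λ`. -/
theorem LinearGrowthSolution.norm_le_mul
    (hδ : LinearGrowthSolution T κ Λ ζ A (incr σ x) (incr' σ x)
      (driftDiff b γ (spike γ ν t h) x) δ)
    (hκ : 1 / 3 < κ) (hΛ : 0 ≤ Λ)
    (hC0 : 0 ≤ C)
    (hC : ∀ t ∈ Icc 0 T, ∀ x, ∀ ν : ProbabilityMeasure U, ‖meanDrift b ν t x‖ ≤ C)
    (ht : 0 ≤ t) (hh : 0 ≤ h) (hhT : t + h ≤ T) {r : ℝ} (hr : r ∈ Icc 0 T) :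
    ‖δ r‖ ≤ (1 + Λ) * (2 * C + Λ * (2 * C) * T ^ (κ - 1 / 3)) * h := by
  have hT : 0 ≤ T := by linarith
  have hp := Real.rpow_nonneg hT (κ - 1 / 3)
  set M := 2 * C + Λ * (2 * C) * T ^ (κ - 1 / 3) with hM
  have hM0 : 0 ≤ M := by positivity
  have h1 : ∀ r, t ≤ r → r ≤ t + h → ‖δ r‖ ≤ M * h := fun r htr hrt => by
    have e1 := hδ.norm_sub_integral_le hC0 hC ht htr (hrt.trans hhT)
    have e2 : ‖∫ r' in t..r, driftDiff b γ (spike γ ν t h) x r' (δ r')‖ ≤ 2 * C * (r - t) := by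
      refine (intervalIntegral.norm_integral_le_of_norm_le_const (C := 2 * C)
        fun r' hr' => ?_).trans (by rw [abs_of_nonneg (sub_nonneg.2 htr)])
      rw [uIoc_of_le htr] at hr'
      exact norm_driftDiff_le hC ⟨ht.trans hr'.1.le, by linarith [hr'.2]⟩ _ _
    have e3 := rpow_le_mul_rpow (a := 1) (b := κ + 2 / 3) (sub_nonneg.2 htr)
      (by linarith : r - t ≤ T) zero_le_one (by linarith)
    rw [Real.rpow_one, show κ + 2 / 3 - 1 = κ - 1 / 3 by ring] at e3
    have e4 := norm_add_le (δ r - ∫ r' in t..r, driftDiff b γ (spike γ ν t h) x r' (δ r'))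
      (∫ r' in t..r, driftDiff b γ (spike γ ν t h) x r' (δ r'))
    rw [sub_add_cancel] at e4
    have e5 : Λ * (2 * C) * (r - t) ^ (κ + 2 / 3) ≤
        Λ * (2 * C) * (T ^ (κ - 1 / 3) * (r - t)) := by gcongr
    calc ‖δ r‖ ≤ M * (r - t) := by rw [hM]; linarith
      _ ≤ M * h := by gcongr; linarith
  have hMh : 0 ≤ M * h := by positivity
  have hΛM : 0 ≤ Λ * (M * h) := by positivity
  rcases le_total r t with hrt | htr
  · rw [hδ.eq_zero_of_le (by linarith) hr.1 hrt, norm_zero]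
    positivity
  · rcases le_total r (t + h) with hrt | htr'
    · linarith [h1 r htr hrt]
    · have e1 := hδ.norm_le (t + h) r 0 (by linarith) htr' hr.2 le_rfl fun r' hr' => by
        rw [driftDiff_spike_zero fun h' => h'.2.not_gt hr'.1, norm_zero]
      have e2 := mul_le_mul_of_nonneg_left (h1 (t + h) (by linarith) le_rfl) hΛ
      rw [add_zero] at e1
      linarith

end Spike

end RoughControl

/-! ### Gradient of the Hamiltonian and variation of the reward -/

namespace RoughControl

variable {m d k : ℕ} {U : Set (Vec k)}

namespace IsRunningReward

variable {T : ℝ} {K : Set (ProbabilityMeasure U)} {F : ℝ → Vec m → ProbabilityMeasure U → ℝ}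

theorem exists_lipschitz (hF : IsRunningReward T K F) : ∃ C, 0 ≤ C ∧ ∀ t ∈ Icc 0 T, ∀ ν ∈ K,
    ∀ x x', |F t x ν - F t x' ν| ≤ C * ‖x - x'‖ := by
  obtain ⟨C, hC⟩ := hF.bounded_gradient
  refine ⟨|C|, abs_nonneg C, fun t ht ν hν x x' => ?_⟩
  refine norm_sub_le_of_norm_fderiv (hF.differentiable t ht ν hν) (fun z => ?_) x x'
  have := hC t ht z ν hν
  rw [gradient, LinearIsometryEquiv.norm_map] at this
  exact this.trans (le_abs_self C)

theorem continuousOn_comp (hF : IsRunningReward T K F) {γ : ℝ → ProbabilityMeasure U}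
    (hγ : ContinuousOn γ (Icc 0 T)) (hγK : ∀ t ∈ Icc 0 T, γ t ∈ K) {z : ℝ → Vec m}
    (hz : ContinuousOn z (Icc 0 T)) : ContinuousOn (fun t => F t (z t) (γ t)) (Icc 0 T) :=
  hF.continuous.comp (f := fun t => (t, z t, γ t))
    (continuousOn_id.prodMk (hz.prodMk hγ)) fun t ht => ⟨ht, mem_univ _, hγK t ht⟩

end IsRunningReward

open ContinuousLinearMap in
-- At the control value `γ t`, this gradient along the optimal state is the drift of the adjoint
-- equation, which is why the reward and the duality pairing fit together.
theorem hasGradientAt_hamiltonian {T : ℝ} {K : Set (ProbabilityMeasure U)}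
    {b : ℝ → Vec m → Vec k → Vec m} (hb : IsDriftCoeff T U b)
    {F : ℝ → Vec m → ProbabilityMeasure U → ℝ} (hF : IsRunningReward T K F) {t : ℝ}
    (ht : t ∈ Icc 0 T) {ν : ProbabilityMeasure U} (hν : ν ∈ K) (x p : Vec m) :
    HasGradientAt (fun z => hamiltonian b F t z ν p)
      (adjoint (∫ a : U, fderiv ℝ (fun z => b t z a) x ∂(ν : Measure U)) p +
        gradient (fun z => F t z ν) x) x := by
  have h1 := (innerSL ℝ p).hasFDerivAt.comp x (hb.hasFDerivAt_meanDrift ht ν x)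
  have h2 := (hF.differentiable t ht ν hν x).hasGradientAt.hasFDerivAt
  rw [hasGradientAt_iff_hasFDerivAt, map_add]
  refine ((h1.add h2).congr_fderiv ?_).congr_of_eventuallyEq
    (Filter.Eventually.of_forall fun z => ?_)
  · ext v
    simp [adjoint_inner_left]
  · simp [hamiltonian, meanDrift, real_inner_comm]

/-- The reward of a needle variation, split along the variation. -/
theorem reward_spike_sub {T t h : ℝ} (ht : 0 ≤ t) (hh : 0 ≤ h) (htT : t + h ≤ T)
    {K : Set (ProbabilityMeasure U)} {F : ℝ → Vec m → ProbabilityMeasure U → ℝ}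
    (hF : IsRunningReward T K F) (G : Vec m → ℝ) {γ : ℝ → ProbabilityMeasure U}
    (hγ : ContinuousOn γ (Icc 0 T)) (hγK : ∀ t ∈ Icc 0 T, γ t ∈ K) {ν : ProbabilityMeasure U}
    (hν : ν ∈ K) {x δ : ℝ → Vec m} (hx : ContinuousOn x (Icc 0 T))
    (hδ : ContinuousOn δ (Icc 0 T)) (hδ0 : ∀ r ∈ Icc 0 t, δ r = 0) :
    reward T F G (spike γ ν t h) (fun r => x r + δ r) - reward T F G γ x =
      (∫ r in t..t + h, (F r (x r + δ r) ν - F r (x r) (γ r))) +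
      (∫ r in t + h..T, (F r (x r + δ r) (γ r) - F r (x r) (γ r))) +
      (G (x T + δ T) - G (x T)) := by
  have hT : 0 ≤ T := by linarith
  have i1 := (hF.continuousOn_comp hγ hγK hx).intervalIntegrable_of_Icc (μ := volume) hT
  have i2 := (hF.continuousOn_comp hγ hγK (hx.add hδ)).intervalIntegrable_of_Icc (μ := volume) hT
  have i3 := (hF.continuousOn_comp (continuousOn_const (c := ν)) (fun _ _ => hν)
    (hx.add hδ)).intervalIntegrable_of_Icc (μ := volume) hT
  have hsub : ∀ {g : ℝ → ℝ}, IntervalIntegrable g volume 0 T → ∀ {s u}, 0 ≤ s → s ≤ u → u ≤ T →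
      IntervalIntegrable g volume s u := fun hg s u hs hsu hu =>
    hg.mono_set (by
      rw [uIcc_of_le hT]
      exact uIcc_subset_Icc ⟨hs, hsu.trans hu⟩ ⟨hs.trans hsu, hu⟩)
  set g : ℝ → ℝ := fun r => F r (x r + δ r) (spike γ ν t h r) - F r (x r) (γ r) with hg
  have c1 : ∀ r ∈ uIoc 0 t, (fun _ => (0 : ℝ)) r = g r := fun r hr => by
    rw [uIoc_of_le ht] at hr
    simp only [hg, hδ0 r ⟨hr.1.le, hr.2⟩, add_zero, spike_of_notMem fun h' => hr.2.not_gt h'.1,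
      sub_self]
  have c2 : ∀ r ∈ uIoc t (t + h), F r (x r + δ r) ν - F r (x r) (γ r) = g r := fun r hr => by
    rw [uIoc_of_le (by linarith)] at hr
    simp only [hg, spike_of_mem hr]
  have c3 : ∀ r ∈ uIoc (t + h) T, F r (x r + δ r) (γ r) - F r (x r) (γ r) = g r := fun r hr => by
    rw [uIoc_of_le htT] at hr
    simp only [hg, spike_of_notMem fun h' => h'.2.not_gt hr.1]
  have j1 : IntervalIntegrable g volume 0 t := intervalIntegrable_const.congr c1
  have j2 : IntervalIntegrable g volume t (t + h) :=
    ((hsub i3 ht (by linarith) htT).sub (hsub i1 ht (by linarith) htT)).congr c2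
  have j3 : IntervalIntegrable g volume (t + h) T :=
    ((hsub i2 (by linarith) htT le_rfl).sub (hsub i1 (by linarith) htT le_rfl)).congr c3
  have e0 : (∫ r in (0 : ℝ)..T, F r (x r + δ r) (spike γ ν t h r)) -
      ∫ r in (0 : ℝ)..T, F r (x r) (γ r) = ∫ r in (0 : ℝ)..T, g r := by
    rw [hg, intervalIntegral.integral_sub _ i1]
    have := ((j1.trans j2).trans j3).add i1
    refine this.congr fun r _ => ?_
    simp only [hg, sub_add_cancel]
  have e1 : ∫ r in (0 : ℝ)..T, g r = (∫ r in t..t + h, g r) + ∫ r in t + h..T, g r := by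
    rw [← intervalIntegral.integral_add_adjacent_intervals (j1.trans j2) j3,
      ← intervalIntegral.integral_add_adjacent_intervals j1 j2,
      intervalIntegral.integral_congr_ae (ae_of_all _ fun r hr => (c1 r hr).symm),
      intervalIntegral.integral_zero, zero_add]
  rw [intervalIntegral.integral_congr_ae (ae_of_all _ c2),
    intervalIntegral.integral_congr_ae (ae_of_all _ c3), ← e1, ← e0, reward, reward]
  ring

end RoughControl

/-! ### The maximum principle -/

namespace RoughControl

variable {m d k : ℕ} {U : Set (Vec k)}

theorem continuousOn_hamiltonian {T : ℝ} {K : Set (ProbabilityMeasure U)}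
    {b : ℝ → Vec m → Vec k → Vec m} (hb : IsDriftCoeff T U b)
    {F : ℝ → Vec m → ProbabilityMeasure U → ℝ} (hF : IsRunningReward T K F)
    {γ : ℝ → ProbabilityMeasure U} (hγ : ContinuousOn γ (Icc 0 T)) (hγK : ∀ t ∈ Icc 0 T, γ t ∈ K)
    {z p : ℝ → Vec m} (hz : ContinuousOn z (Icc 0 T)) (hp : ContinuousOn p (Icc 0 T)) :
    ContinuousOn (fun t => hamiltonian b F t (z t) (γ t) (p t)) (Icc 0 T) :=
  ((hb.continuousOn_meanDrift hγ hz).inner hp).add (hF.continuousOn_comp hγ hγK hz)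

open Filter Topology in
/-- The maximum principle at times before the terminal time. -/
theorem hamiltonian_le_of_lt {α T : ℝ} {ζ : ℝ → Vec d}
    {A : ℝ → ℝ → Fin d → Fin d → ℝ} (hζ : IsGeometricRoughPath α T ζ A)
    {K : Set (ProbabilityMeasure U)} {b : ℝ → Vec m → Vec k → Vec m} (hb : IsDriftCoeff T U b)
    {σ : Fin d → ℝ → Vec m → Vec m} (hσ : IsNoiseCoeff T σ)
    {F : ℝ → Vec m → ProbabilityMeasure U → ℝ} (hF : IsRunningReward T K F) {G : Vec m → ℝ}
    (hG : IsTerminalReward G) {y : Vec m} {x p : ℝ → Vec m} {γ : ℝ → ProbabilityMeasure U}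
    (hγ : ContinuousOn γ (Icc 0 T)) (hopt : IsOptimalPair α T ζ A b σ F G K y x γ)
    (hp : SolvesAdjoint α T ζ A b σ F G x γ p) {t : ℝ} (ht : t ∈ Ico 0 T)
    {ν : ProbabilityMeasure U} (hν : ν ∈ K) :
    hamiltonian b F t (x t) ν (p t) ≤ hamiltonian b F t (x t) (γ t) (p t) := by
  have hT : 0 ≤ T := ht.1.trans ht.2.le
  have htT : t ∈ Icc 0 T := ⟨ht.1, ht.2.le⟩
  obtain ⟨hγr, hx, hmax⟩ := hopt
  have hγK := hγr.mem
  obtain ⟨κ', hκ', hκ'α, hxc'⟩ := hx.2.controlled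
  -- An exponent at most `1/2` lets drift increments, of order one, fit into remainders of order `2
  -- * κ`.
  obtain ⟨κ, hκ, hκα, hκ2, hκκ'⟩ : ∃ κ : ℝ, 1 / 3 < κ ∧ κ < α ∧ κ ≤ 1 / 2 ∧ κ ≤ κ' :=
    ⟨min κ' (1 / 2), lt_min hκ' (by norm_num), (min_le_left _ _).trans_lt hκ'α, min_le_right _ _,
      min_le_left _ _⟩
  have hxc := hxc'.mono (by linarith) hκκ'
  have hxcont := hxc.continuousOn (by linarith)
  obtain ⟨C, hC0, hCb, hCl⟩ := hb.exists_meanDrift_bound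
  obtain ⟨CF, hCF0, hCF⟩ := hF.exists_lipschitz
  obtain ⟨C', hf⟩ := exists_roughField hκ hκα.le hT hζ hσ hxc
  obtain ⟨Kσ, hK1, -, hKσ⟩ := hσ.exists_bound 0
  obtain ⟨Λ, hΛ, hex⟩ := hf.exists_linearGrowthSolution hκ hκ2 hT hC0
  obtain ⟨θ, Cp, hθ, hCp, hadj⟩ := hp.exists_adjointPath hb hF hγK
  set η : ℝ → Vec m := fun t => ContinuousLinearMap.adjoint
        (∫ a : U, fderiv ℝ (fun z => b t z a) (x t) ∂(γ t : Measure U)) (p t)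
        + gradient (fun z => F t z (γ t)) (x t) with hη
  have hspike := fun h z hz => hb.intervalIntegrable_spike hT hγ ν t h (z := z) hz
  have hdrift := fun h => hb.lipschitzDrift hT hγ hxcont hCl (hspike h)
  -- `Λ` was fixed before `h`, so the bounds on `δ h` are uniform over all needles.
  choose δ hδ using fun h => hex _ (hdrift h).1 (hdrift h).2 (2 * C) fun r hr =>
    norm_driftDiff_le hCb hr _ _
  set C₁ := (1 + Λ) * (2 * C + Λ * (2 * C) * T ^ (κ - 1 / 3)) with hC₁
  have hC₁0 : 0 ≤ C₁ := by have := Real.rpow_nonneg hT (κ - 1 / 3); positivity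
  have hh₀ : 0 < T - t := sub_pos.2 ht.2
  have hδ1 : ∀ h ∈ Ioo 0 (T - t), ∀ r ∈ Icc 0 T, ‖δ h r‖ ≤ C₁ * h := fun h hh r hr =>
    (hδ h).norm_le_mul hκ hΛ hC0 hCb ht.1 hh.1.le (by linarith [hh.2]) hr
  have hev : ∀ᶠ h : ℝ in 𝓝[>] 0, h ∈ Ioo 0 (T - t) := Ioo_mem_nhdsGT hh₀
  have hO : ∀ r ∈ Icc 0 T, (fun h => δ h r) =O[𝓝[>] 0] (fun h : ℝ => h) := fun r hr =>
    Asymptotics.IsBigO.of_bound C₁ (by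
      filter_upwards [hev] with h hh
      rw [Real.norm_of_nonneg hh.1.le]
      exact hδ1 h hh r hr)
  have hid : Tendsto (fun h : ℝ => h) (𝓝[>] 0) (𝓝 0) := tendsto_id.mono_left nhdsWithin_le_nhds
  -- the perturbation at the end of the needle
  have lim1 : Tendsto (fun h => h⁻¹ • ∫ r in t..t + h,
      driftDiff b γ (spike γ ν t h) x r (δ h r)) (𝓝[>] 0)
      (𝓝 (meanDrift b ν t (x t) - meanDrift b (γ t) t (x t))) := by
    refine tendsto_inv_smul_integral (c := C * C₁) ht
      (φ := fun r => meanDrift b ν r (x r) - meanDrift b (γ r) r (x r))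
      ((hb.continuousOn_meanDrift continuousOn_const hxcont).sub
        (hb.continuousOn_meanDrift hγ hxcont)) fun h hh => ⟨?_, fun r hr => ?_⟩
    · refine ((hdrift h).2 _ (hδ h).continuousOn).mono_set ?_
      rw [uIcc_of_le hT]
      exact uIcc_subset_Icc htT ⟨by linarith [ht.1, hh.1], by linarith [hh.2]⟩
    · have hr' : r ∈ Icc 0 T := ⟨ht.1.trans hr.1.le, by linarith [hr.2, hh.2]⟩
      rw [driftDiff, spike_of_mem hr, sub_sub_sub_cancel_right]
      refine (hCl r hr' _ _ _).trans ?_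
      rw [add_sub_cancel_left, mul_assoc]
      exact mul_le_mul_of_nonneg_left (hδ1 h hh r hr') hC0
  have lim2 : Tendsto (fun h => h⁻¹ • δ h (t + h)) (𝓝[>] 0)
      (𝓝 (meanDrift b ν t (x t) - meanDrift b (γ t) t (x t))) := by
    have h0 : Tendsto (fun h => h⁻¹ • (δ h (t + h) -
        ∫ r in t..t + h, driftDiff b γ (spike γ ν t h) x r (δ h r))) (𝓝[>] 0) (𝓝 0) := by
      -- The error `h ^ (κ + 2/3)` divided by `h` leaves the positive power `κ - 1/3`.
      have h1 : Tendsto (fun h : ℝ => Λ * (2 * C) * h ^ (κ - 1 / 3)) (𝓝[>] 0) (𝓝 0) := by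
        have := ((hid.rpow_const (p := κ - 1 / 3) (Or.inr (by linarith))).const_mul (Λ * (2 * C)))
        rwa [Real.zero_rpow (by linarith), mul_zero] at this
      refine squeeze_zero_norm' ?_ h1
      filter_upwards [hev] with h hh
      have := (hδ h).norm_sub_integral_le hC0 hCb ht.1 (r := t + h) (by linarith [hh.1])
        (by linarith [hh.2])
      rw [add_sub_cancel_left] at this
      rw [norm_smul, norm_inv, Real.norm_of_nonneg hh.1.le, inv_mul_le_iff₀ hh.1]
      refine this.trans_eq ?_
      rw [show κ + 2 / 3 = κ - 1 / 3 + 1 by ring, Real.rpow_add_one hh.1.ne']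
      ring
    have := h0.add lim1
    rw [zero_add] at this
    refine this.congr fun h => ?_
    rw [← smul_add, sub_add_cancel]
  have lim3 : Tendsto (fun h => p (t + h)) (𝓝[>] 0) (𝓝 (p t)) := by
    refine (hadj.continuousOn t htT).tendsto.comp (tendsto_nhdsWithin_iff.2 ⟨?_, ?_⟩)
    · simpa using hid.const_add t
    · filter_upwards [hev] with h hh
      exact ⟨by linarith [ht.1, hh.1], by linarith [hh.2]⟩
  have lim4 := lim3.inner (𝕜 := ℝ) lim2
  -- the running reward on the needle
  have lim5 : Tendsto (fun h => h⁻¹ • ∫ r in t..t + h,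
      (F r (x r + δ h r) ν - F r (x r) (γ r))) (𝓝[>] 0)
      (𝓝 (F t (x t) ν - F t (x t) (γ t))) := by
    refine tendsto_inv_smul_integral (c := CF * C₁) ht
      (φ := fun r => F r (x r) ν - F r (x r) (γ r))
      ((hF.continuousOn_comp continuousOn_const (fun _ _ => hν) hxcont).sub
        (hF.continuousOn_comp hγ hγK hxcont)) fun h hh => ⟨?_, fun r hr => ?_⟩
    · refine ContinuousOn.intervalIntegrable (((hF.continuousOn_comp continuousOn_const
        (fun _ _ => hν) (hxcont.add (hδ h).continuousOn)).sub
        (hF.continuousOn_comp hγ hγK hxcont)).mono ?_)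
      exact uIcc_subset_Icc htT ⟨by linarith [ht.1, hh.1], by linarith [hh.2]⟩
    · have hr' : r ∈ Icc 0 T := ⟨ht.1.trans hr.1.le, by linarith [hr.2, hh.2]⟩
      rw [sub_sub_sub_cancel_right]
      refine (hCF r hr' ν hν _ _).trans ?_
      rw [add_sub_cancel_left, mul_assoc]
      exact mul_le_mul_of_nonneg_left (hδ1 h hh r hr') hCF0
  -- the remainder of the Hamiltonian
  set R : ℝ → ℝ → ℝ := fun h r => hamiltonian b F r (x r + δ h r) (γ r) (p r) -
    hamiltonian b F r (x r) (γ r) (p r) - inner ℝ (η r) (δ h r) with hR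
  have hRint : ∀ h, IntervalIntegrable (R h) volume 0 T := fun h => by
    refine (((continuousOn_hamiltonian hb hF hγ hγK (hxcont.add (hδ h).continuousOn)
      hadj.continuousOn).sub (continuousOn_hamiltonian hb hF hγ hγK hxcont
      hadj.continuousOn)).intervalIntegrable_of_Icc hT).sub ?_
    rw [funext fun r => real_inner_comm (δ h r) (η r)]
    exact intervalIntegrable_inner hT (hδ h).continuousOn hadj.integrable
  have lim6 : Tendsto (fun h => h⁻¹ * ∫ r in (0 : ℝ)..T, |R h r|) (𝓝[>] 0) (𝓝 0) := by
    refine tendsto_inv_mul_integral_remainder hT hh₀ (c := C * Cp + CF + Cp) (by positivity)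
      (Φ := fun r z => hamiltonian b F r z (γ r) (p r))
      (fun r hr => hasGradientAt_hamiltonian hb hF hr (hγK r hr) (x r) (p r)) ?_ hδ1
      fun h _ => hRint h
    intro r hr e
    have e1 : |inner ℝ (meanDrift b (γ r) r (x r + e) - meanDrift b (γ r) r (x r)) (p r)| ≤
        C * ‖e‖ * Cp := by
      refine (abs_real_inner_le_norm _ _).trans
        (mul_le_mul ?_ (hadj.norm_le r hr) (norm_nonneg _) (by positivity))
      have := hCl r hr (x r + e) (x r) (γ r)
      rwa [add_sub_cancel_left] at this
    have e2 := hCF r hr (γ r) (hγK r hr) (x r + e) (x r)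
    rw [add_sub_cancel_left] at e2
    have e3 : |inner ℝ (η r) e| ≤ Cp * ‖e‖ := (abs_real_inner_le_norm _ _).trans
      (mul_le_mul_of_nonneg_right (hadj.norm_drift_le r hr) (norm_nonneg _))
    have e4 : hamiltonian b F r (x r + e) (γ r) (p r) - hamiltonian b F r (x r) (γ r) (p r) =
        inner ℝ (meanDrift b (γ r) r (x r + e) - meanDrift b (γ r) r (x r)) (p r) +
        (F r (x r + e) (γ r) - F r (x r) (γ r)) := by
      rw [inner_sub_left, hamiltonian, hamiltonian, meanDrift, meanDrift]
      ring
    rw [e4]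
    refine (abs_sub _ _).trans ((add_le_add_left (abs_add_le _ _) _).trans ?_)
    linarith
  -- the error in the adjoint equation
  set S : ℝ → ℝ := fun h => inner ℝ (p T) (δ h T) - inner ℝ (p (t + h)) (δ h (t + h)) -
    ∫ r in t + h..T, (inner ℝ (p r) (driftDiff b γ (spike γ ν t h) x r (δ h r)) -
      inner ℝ (η r) (δ h r)) with hS
  have lim7 : Tendsto (fun h => h⁻¹ * S h) (𝓝[>] 0) (𝓝 0) := by
    rw [Metric.tendsto_nhds]
    intro ε hε
    obtain ⟨N₀, hN₀, hN⟩ := hadj.inner_integral_le hf hζ.geometric (fun j => (hKσ j).1) hK1 hT hCp hC0 hκ hκ2 hθ hΛ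
      (ε := ε / (C₁ + 1)) (by positivity)
    have hC₁h : Tendsto (fun h => C₁ * h) (𝓝[>] 0) (𝓝 0) := by simpa using hid.const_mul C₁
    filter_upwards [hev, hC₁h.eventually (ge_mem_nhds hN₀)] with h hh hhN
    have h1 := hδ1 h hh (t + h) ⟨by linarith [ht.1, hh.1], by linarith [hh.2]⟩
    have h2 := hN _ (δ h) (t + h) (hdrift h).1 (hdrift h).2 (hδ h) (by linarith [ht.1, hh.1])
      (by linarith [hh.2]) (fun r hr => driftDiff_spike_zero fun h' => h'.2.not_gt hr.1)
      (h1.trans hhN)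
    rw [dist_zero_right, norm_mul, norm_inv, Real.norm_of_nonneg hh.1.le, inv_mul_lt_iff₀ hh.1]
    calc ‖S h‖ ≤ ε / (C₁ + 1) * ‖δ h (t + h)‖ := h2
      _ ≤ ε / (C₁ + 1) * (C₁ * h) := by gcongr
      _ < ε / (C₁ + 1) * ((C₁ + 1) * h) := by
        have := hh.1
        gcongr
        linarith
      _ = h * ε := by field_simp
  -- the terminal reward
  have lim8 : Tendsto (fun h => (G (x T + δ h T) - G (x T) - inner ℝ (p T) (δ h T)) / h) (𝓝[>] 0)
      (𝓝 0) := by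
    have hTT : T ∈ Icc 0 T := ⟨hT, le_rfl⟩
    have hG1 := ((hG.contDiff.differentiable one_ne_zero) (x T)).hasGradientAt.hasFDerivAt
    rw [← hp.1] at hG1
    have := (((hasFDerivAt_iff_isLittleO_nhds_zero.1 hG1).comp_tendsto
      ((hO T hTT).trans_tendsto hid)).trans_isBigO (hO T hTT)).tendsto_div_nhds_zero
    refine this.congr fun h => ?_
    simp only [Function.comp_apply, InnerProductSpace.toDual_apply_apply]
  -- The change of reward equals the needle integral of `F`, plus `⟨p, δ⟩` at `t + h`, plus the
  -- integral of `R` over `[t + h, T]`, plus `S`, plus the Taylor remainder of `G`. Here `S` trades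
  -- `⟨p, δ⟩` at `T` for its value at `t + h`, and its integral is exactly what turns the increment
  -- of `F` into `R`. The integral of `R` is then bounded below by minus that of `|R|` over the
  -- fixed interval `[0, T]`.
  have hfinal : ∀ᶠ h : ℝ in 𝓝[>] 0, h⁻¹ • (∫ r in t..t + h,
      (F r (x r + δ h r) ν - F r (x r) (γ r))) + inner ℝ (p (t + h)) (h⁻¹ • δ h (t + h)) -
      h⁻¹ * (∫ r in (0 : ℝ)..T, |R h r|) + h⁻¹ * S h +
      (G (x T + δ h T) - G (x T) - inner ℝ (p T) (δ h T)) / h ≤ 0 := by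
    filter_upwards [hev] with h hh
    have hh0 := hh.1
    have hth0 : 0 ≤ t + h := by linarith [ht.1]
    have hthT : t + h ≤ T := by linarith [hh.2]
    have hrew := hmax _ _ (hγr.spike hν t h)
      (solvesState_add hκ hκα hκ2 hT hb hσ hx hxc (hspike h) (hδ h))
    have heq := reward_spike_sub ht.1 hh0.le hthT hF G hγ hγK hν hxcont (hδ h).continuousOn
      fun r hr => (hδ h).eq_zero_of_le ht.2.le hr.1 hr.2
    have hsub : ∀ {g : ℝ → ℝ}, IntervalIntegrable g volume 0 T →
        IntervalIntegrable g volume (t + h) T := fun hg => hg.mono_set (by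
      rw [uIcc_of_le hT]
      exact uIcc_subset_Icc ⟨hth0, hthT⟩ ⟨hT, le_rfl⟩)
    have i1 : IntervalIntegrable (fun r => F r (x r + δ h r) (γ r) - F r (x r) (γ r)) volume
        (t + h) T := hsub (((hF.continuousOn_comp hγ hγK (hxcont.add (hδ h).continuousOn)).sub
          (hF.continuousOn_comp hγ hγK hxcont)).intervalIntegrable_of_Icc hT)
    have i2 : IntervalIntegrable (fun r => inner ℝ (p r)
        (driftDiff b γ (spike γ ν t h) x r (δ h r)) - inner ℝ (η r) (δ h r)) volume (t + h) T := by
      refine hsub ((intervalIntegrable_inner hT hadj.continuousOn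
        ((hdrift h).2 _ (hδ h).continuousOn)).sub ?_)
      rw [funext fun r => real_inner_comm (δ h r) (η r)]
      exact intervalIntegrable_inner hT (hδ h).continuousOn hadj.integrable
    have hRsum : (∫ r in t + h..T, (F r (x r + δ h r) (γ r) - F r (x r) (γ r))) +
        (∫ r in t + h..T, (inner ℝ (p r) (driftDiff b γ (spike γ ν t h) x r (δ h r)) -
          inner ℝ (η r) (δ h r))) = ∫ r in t + h..T, R h r := by
      rw [← intervalIntegral.integral_add i1 i2]
      refine intervalIntegral.integral_congr_ae (ae_of_all _ fun r hr => ?_)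
      rw [uIoc_of_le hthT] at hr
      rw [driftDiff, spike_of_notMem fun h' => h'.2.not_gt hr.1, real_inner_comm, inner_sub_left]
      simp only [hR, hamiltonian, meanDrift]
      ring
    have hRle : |∫ r in t + h..T, R h r| ≤ ∫ r in (0 : ℝ)..T, |R h r| := by
      refine (intervalIntegral.abs_integral_le_integral_abs hthT).trans ?_
      exact intervalIntegral.integral_mono_interval hth0 hthT le_rfl
        (ae_of_all _ fun r => abs_nonneg _) (hRint h).abs
    have hneg := neg_abs_le (∫ r in t + h..T, R h r)
    have hle : (∫ r in t..t + h, (F r (x r + δ h r) ν - F r (x r) (γ r))) +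
        inner ℝ (p (t + h)) (δ h (t + h)) - (∫ r in (0 : ℝ)..T, |R h r|) + S h +
        (G (x T + δ h T) - G (x T) - inner ℝ (p T) (δ h T)) ≤ 0 := by
      simp only [hS]
      linarith
    rw [real_inner_smul_right, smul_eq_mul, div_eq_inv_mul]
    have := mul_nonpos_of_nonneg_of_nonpos (inv_nonneg.2 hh0.le) hle
    linarith
  have hlim := le_of_tendsto (((((lim5.add lim4).sub lim6).add lim7).add lim8)) hfinal
  rw [inner_sub_right, real_inner_comm, real_inner_comm (meanDrift b (γ t) t (x t))] at hlim
  simp only [hamiltonian, meanDrift] at hlim ⊢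
  linarith

open Filter Topology in
-- At `T` there is no room for a needle, but both sides are continuous in time and `[0, T)` is dense
-- in `[0, T]`.
theorem hamiltonian_le {α T : ℝ} (hT : 0 < T) {ζ : ℝ → Vec d}
    {A : ℝ → ℝ → Fin d → Fin d → ℝ} (hζ : IsGeometricRoughPath α T ζ A)
    {K : Set (ProbabilityMeasure U)} {b : ℝ → Vec m → Vec k → Vec m} (hb : IsDriftCoeff T U b)
    {σ : Fin d → ℝ → Vec m → Vec m} (hσ : IsNoiseCoeff T σ)
    {F : ℝ → Vec m → ProbabilityMeasure U → ℝ} (hF : IsRunningReward T K F) {G : Vec m → ℝ}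
    (hG : IsTerminalReward G) {y : Vec m} {x p : ℝ → Vec m} {γ : ℝ → ProbabilityMeasure U}
    (hγ : ContinuousOn γ (Icc 0 T)) (hopt : IsOptimalPair α T ζ A b σ F G K y x γ)
    (hp : SolvesAdjoint α T ζ A b σ F G x γ p) {t : ℝ} (ht : t ∈ Icc 0 T)
    {ν : ProbabilityMeasure U} (hν : ν ∈ K) :
    hamiltonian b F t (x t) ν (p t) ≤ hamiltonian b F t (x t) (γ t) (p t) := by
  have hγK := hopt.1.mem
  obtain ⟨κ, hκ, -, hxc⟩ := hopt.2.1.2.controlled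
  obtain ⟨θ, C, -, -, hadj⟩ := hp.exists_adjointPath hb hF hγK
  have hxcont := hxc.continuousOn (by linarith)
  have h1 := continuousOn_hamiltonian hb hF (continuousOn_const (c := ν)) (fun _ _ => hν) hxcont
    hadj.continuousOn
  have h2 := continuousOn_hamiltonian hb hF hγ hγK hxcont hadj.continuousOn
  rw [← closure_Ico hT.ne] at ht h1 h2
  exact le_on_closure (fun s hs => hamiltonian_le_of_lt hζ hb hσ hF hG hγ hopt hp hs hν) h1 h2 ht

end RoughControl

theorem mainTheorem1 {m d k : ℕ} (α T ε L : ℝ) (hα : 1 / 3 < α) (hT : 0 < T)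
    (hε : 0 < ε) (hL : 0 < L)
    (ζ : ℝ → RoughControl.Vec d) (A : ℝ → ℝ → Fin d → Fin d → ℝ)
    (hζ : RoughControl.IsGeometricRoughPath α T ζ A)
    (U : Set (RoughControl.Vec k)) (K : Set (ProbabilityMeasure U)) (hK : IsCompact K)
    (b : ℝ → RoughControl.Vec m → RoughControl.Vec k → RoughControl.Vec m)
    (hb : RoughControl.IsDriftCoeff T U b)
    (σ : Fin d → ℝ → RoughControl.Vec m → RoughControl.Vec m)
    (hσ : RoughControl.IsNoiseCoeff T σ)
    (F : ℝ → RoughControl.Vec m → ProbabilityMeasure U → ℝ)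
    (hF : RoughControl.IsRunningReward T K F)
    (G : RoughControl.Vec m → ℝ) (hG : RoughControl.IsTerminalReward G)
    (y : RoughControl.Vec m) (x : ℝ → RoughControl.Vec m) (γ : ℝ → ProbabilityMeasure U)
    (hγ : γ ∈ RoughControl.HolderControls T ε L K)
    (hopt : RoughControl.IsOptimalPair α T ζ A b σ F G K y x γ)
    (p : ℝ → RoughControl.Vec m)
    (hp : RoughControl.SolvesAdjoint α T ζ A b σ F G x γ p) :
    ∀ t ∈ Icc 0 T, IsGreatest
      ((fun ν => RoughControl.hamiltonian b F t (x t) ν (p t)) '' K)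
      (RoughControl.hamiltonian b F t (x t) (γ t) (p t)) := by
  intro t ht
  exact ⟨mem_image_of_mem _ (hγ.1 t ht), forall_mem_image.2 fun ν hν =>
    RoughControl.hamiltonian_le hT hζ hb hσ hF hG
      (RoughControl.continuousOn_of_mem_holderControls hε hγ) hopt hp ht hν⟩
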